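/- **Setting.** Let $(X,Z,C,Y_1,Y_0)$ be covariates, a binary treatment assignment, a binary principal stratum and two potential outcomes with finite second moments. The observed data are $O=(X,Z,S,Y)$ with $S=ZC$ and $Y=ZY_1+(1-Z)Y_0$. Assume $Z\perp\!\!\!\perp(C,Y_1,Y_0)\mid X$. Fix $c\in\{0,1\}$ with $\mathrm P(C=c)>0$, and write $e_1(X)=\mathrm P(Z=1\mid X)$, $e_0=1-e_1$, $\pi_c(X)=\mathrm P(C=c\mid X)$, $\pi_c=\mathrm E[\pi_c(X)]$, $\mu_{1c}(X)=\mathrm E[Y_1\mid X,C=c]$ and $\mu_0(X)=\mathrm E[Y\mid X,Z=0]$. Let $$\Delta_c^{\mathrm{PI}}=\frac{\mathrm E\{\pi_c(X)[\mu_{1c}(X)-\mu_0(X)]\}}{\pi_c},$$ regarded as a functional of the law of $O$ through $\pi_c(X)=\mathrm P(S=c\mid X,Z=1)$, $\mu_{1c}(X)=\mathrm E[Y\mid X,Z=1,S=c]$ and $\mu_0(X)=\mathrm E[Y\mid X,Z=0]$. For nuisance functions $\eta=(e_1,\pi_c,\mu_{1c},\mu_0)$ put $$\phi_{\pi}(O;\eta)=\tfrac{Z}{e_1(X)}[\mathrm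 I(C=c)-\pi_c(X)]+\pi_c(X),$$ $$\phi_{1}(O;\eta)=\tfrac{Z}{e_1(X)}\mathrm I(C=c)[Y-\mu_{1c}(X)]+\tfrac{Z}{e_1(X)}\mu_{1c}(X)[\mathrm I(C=c)-\pi_c(X)]+\pi_c(X)\mu_{1c}(X),$$ $$\phi_{0}(O;\eta)=\tfrac{1-Z}{e_0(X)}\pi_c(X)[Y-\mu_{0}(X)]+\tfrac{Z}{e_1(X)}\mu_{0}(X)[\mathrm I(C=c)-\pi_c(X)]+\pi_c(X)\mu_{0}(X),$$ where $Z\,\mathrm I(C=c)=Z\,\mathrm I(S=c)$ is observed. **Estimator.** Let $O_1,O_2,\dots$ be i.i.d. copies of $O$. The evaluation observations $1,\dots,n$ are divided into a fixed number of folds. For each fold $k$, estimates $\tilde\eta_k=(\tilde e_1,\tilde\pi_c,\tilde\mu_{1c},\tilde\mu_0)$, with $\tilde e_0=1-\tilde e_1$ and $0\le\tilde\pi_c\le1$, are computed (measurably) from finitely many observations outside fold $k$. This includes cross-fitting, and sample splitting with a separate training sample. Let $$\hat\Delta_{c,\mathrm{IF}}^{\mathrm{PI}}=\frac{\frac1n\sum_{i\le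 n}\phi_1(O_i;\tilde\eta_{k(i)})-\frac1n\sum_{i\le n}\phi_0(O_i;\tilde\eta_{k(i)})}{\frac1n\sum_{i\le n}\phi_\pi(O_i;\tilde\eta_{k(i)})},$$ where $k(i)$ is the fold of $i$. **Assumptions.** Let $\|\cdot\|_2$ be the $L^2$ norm and $\|\cdot\|_\infty$ the essential supremum norm with respect to the law of $X$, the estimates being held fixed. Assume, for every fold: * positivity: for some $\epsilon>0$, $\epsilon\le e_1(X)<1-\epsilon$ almost surely; * bounded contrast: $\mu_{1c}(X)-\mu_0(X)$ is essentially bounded; * consistency: $\|\tilde e_1-e_1\|_2$, $\|\tilde\pi_c-\pi_c\|_2$, $\|\tilde\mu_{1c}-\mu_{1c}\|_2$ and $\|\tilde\mu_0-\mu_0\|_2$ are $o_p(1)$; * bounded propensity score estimation: $\|1/\tilde e_1\|_\infty=O_p(1)$ and $\|1/\tilde e_0\|_\infty=O_p(1)$ (in particular $0<\tilde e_1<1$ almost everywhere with probability tending to one); * rates: $\|\tilde e_1-e_1\|_2\|\tilde\pi_c-\pi_c\|_2$, $\|\tilde e_1-e_1\|_2\|\tilde\mu_{1c}-\mu_{1c}\|_2$,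 $\|\tilde e_1-e_1\|_2\|\tilde\mu_0-\mu_0\|_2$ and $\|\tilde\pi_c-\pi_c\|_2\|\tilde\mu_0-\mu_0\|_2$ are all $o_p(n^{-1/2})$. **Conclusion.** The estimator $\hat\Delta_{c,\mathrm{IF}}^{\mathrm{PI}}$ is root-$n$ consistent and asymptotically normal: $$\hat\Delta_{c,\mathrm{IF}}^{\mathrm{PI}}-\Delta_c^{\mathrm{PI}}=O_p(n^{-1/2}),\qquad \sqrt n\,(\hat\Delta_{c,\mathrm{IF}}^{\mathrm{PI}}-\Delta_c^{\mathrm{PI}})\xrightarrow{d}\mathrm N\big(0,\operatorname{var}\varphi(O)\big).$$ Here $$\varphi(O)=\frac1{\pi_c}\big\{\phi_1(O;\eta)-\phi_0(O;\eta)-\Delta_c^{\mathrm{PI}}\phi_\pi(O;\eta)\big\},$$ evaluated at the true $\eta$, is the nonparametric influence function of $\Delta_c^{\mathrm{PI}}$: it is centered, square integrable, and along each path $d\rho_t=(1+ts)\,d\rho$ through the law $\rho$ of $O$ with bounded centered score $s$, the derivative of $\Delta_c^{\mathrm{PI}}(\rho_t)$ at $t=0$ is $\mathrm E[\varphi(O)s(O)]$.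 Under principal ignorability, $\mathrm E[Y_0\mid X,C=1]=\mathrm E[Y_0\mid X,C=0]$, one has $\Delta_c^{\mathrm{PI}}=\Delta_c:=\mathrm E[Y_1-Y_0\mid C=c]$. -/

import Mathlib

open MeasureTheory ProbabilityTheory Filter Topology
open scoped ENNReal

namespace PrincipalStrat

/-- An observed data point `O = (X, Z, S, Y)`: covariates, treatment assignment, treatment
actually received, outcome (`true` stands for 1 and `false` for 0). -/
abbrev Obs (𝒳 : Type*) : Type _ := 𝒳 × Bool × Bool × ℝ

/-- The observed data of an individual with full data `(X, Z, C, Y₁, Y₀)`, under consistency: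
`S = Z C` and `Y = Z Y₁ + (1 - Z) Y₀`. -/
def observe {Ω 𝒳 : Type*} (X : Ω → 𝒳) (Z C : Ω → Bool) (Y1 Y0 : Ω → ℝ) (ω : Ω) : Obs 𝒳 :=
  (X ω, Z ω, Z ω && C ω, if Z ω then Y1 ω else Y0 ω)

/-- The number 1 if `b` is true and 0 otherwise. -/
def ind (b : Bool) : ℝ := if b then 1 else 0

/-- `f` is a version of the regression function `x ↦ E[W | X = x]` under the law `μ`. -/
def IsRegression {Ω 𝒳 : Type*} [MeasurableSpace Ω] [m𝒳 : MeasurableSpace 𝒳]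
    (μ : Measure Ω) (X : Ω → 𝒳) (W : Ω → ℝ) (f : 𝒳 → ℝ) : Prop :=
  Measurable f ∧ (fun ω => f (X ω)) =ᵐ[μ] condExp (m𝒳.comap X) μ W

/-- A quadruple of (true or estimated) nuisance functions: the propensity score `e₁` (with
`e₀ = 1 - e₁`), the principal score `π_c`, and the outcome means `μ_{1c}` and `μ₀`. -/
structure Nuisance (𝒳 : Type*) where
  e : 𝒳 → ℝ
  pi : 𝒳 → ℝ
  mu1 : 𝒳 → ℝ
  mu0 : 𝒳 → ℝ

/-- `η` consists of (versions of) the true nuisance functions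
`e₁(X) = P(Z = 1 | X)`, `π_c(X) = P(C = c | X)`, `μ_{1c}(X) = E[Y₁ | X, C = c]` and
`μ₀(X) = E[Y | X, Z = 0]`. -/
structure IsTrueNuisance {Ω 𝒳 : Type*} [MeasurableSpace Ω] [MeasurableSpace 𝒳]
    (P : Measure Ω) (c : Bool) (X : Ω → 𝒳) (Z C : Ω → Bool) (Y1 Y0 : Ω → ℝ)
    (η : Nuisance 𝒳) : Prop where
  e_eq : IsRegression P X (fun ω => ind (Z ω)) η.e
  pi_eq : IsRegression P X (fun ω => ind (C ω == c)) η.pi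
  mu1_eq : IsRegression (ProbabilityTheory.cond P {ω | C ω = c}) X Y1 η.mu1
  mu0_eq : IsRegression (ProbabilityTheory.cond P {ω | Z ω = false}) X
    (fun ω => if Z ω then Y1 ω else Y0 ω) η.mu0

/-- Principal ignorability `E[Y₀ | X, C = 1] = E[Y₀ | X, C = 0]`: one and the same function of the
covariates is a version of both regressions (the regression given `C = c` being determined only
where `P(C = c | X) > 0`). -/
def PrincipalIgnorability {Ω 𝒳 : Type*} [MeasurableSpace Ω] [MeasurableSpace 𝒳]
    (P : Measure Ω) (X : Ω → 𝒳) (C : Ω → Bool) (Y0 : Ω → ℝ) : Prop :=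
  ∃ g : 𝒳 → ℝ, IsRegression (ProbabilityTheory.cond P {ω | C ω = true}) X Y0 g ∧
    IsRegression (ProbabilityTheory.cond P {ω | C ω = false}) X Y0 g

/-- The principal causal effect `Δ_c = E[Y₁ - Y₀ | C = c]`. -/
noncomputable def delta {Ω : Type*} [MeasurableSpace Ω] (P : Measure Ω) (c : Bool)
    (C : Ω → Bool) (Y1 Y0 : Ω → ℝ) : ℝ :=
  ∫ ω, (Y1 ω - Y0 ω) ∂(ProbabilityTheory.cond P {ω | C ω = c})

/-- The observed-data functional `Δ_c^PI`, evaluated at a law `ρ` of `O = (X, Z, S, Y)`: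
`E[π_c(X) (μ_{1c}(X) - μ₀(X))] / E[π_c(X)]` with `π_c(X) = P(S = c | X, Z = 1)`,
`μ_{1c}(X) = E[Y | X, Z = 1, S = c]` and `μ₀(X) = E[Y | X, Z = 0]`, all computed under `ρ`. -/
noncomputable def deltaPI {𝒳 : Type*} [m𝒳 : MeasurableSpace 𝒳] (c : Bool)
    (ρ : Measure (Obs 𝒳)) : ℝ :=
  let p : Obs 𝒳 → ℝ := condExp (m𝒳.comap Prod.fst)
    (ProbabilityTheory.cond ρ {o | o.2.1 = true}) (fun o => ind (o.2.2.1 == c))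
  let m1 : Obs 𝒳 → ℝ := condExp (m𝒳.comap Prod.fst)
    (ProbabilityTheory.cond ρ {o | o.2.1 = true ∧ o.2.2.1 = c}) (fun o => o.2.2.2)
  let m0 : Obs 𝒳 → ℝ := condExp (m𝒳.comap Prod.fst)
    (ProbabilityTheory.cond ρ {o | o.2.1 = false}) (fun o => o.2.2.2)
  (∫ o, p o * (m1 o - m0 o) ∂ρ) / (∫ o, p o ∂ρ)

/-- Uncentered influence function of `π_c`. Note `Z I(C = c) = Z I(S = c)`. -/
noncomputable def phiPi {𝒳 : Type*} (c : Bool) (η : Nuisance 𝒳) : Obs 𝒳 → ℝ :=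
  fun (x, z, s, _) => ind z / η.e x * (ind (s == c) - η.pi x) + η.pi x

/-- Uncentered influence function of `ν_{1c} = E[π_c(X) μ_{1c}(X)]`. -/
noncomputable def phiNu1 {𝒳 : Type*} (c : Bool) (η : Nuisance 𝒳) : Obs 𝒳 → ℝ :=
  fun (x, z, s, y) => ind z / η.e x * ind (s == c) * (y - η.mu1 x)
    + ind z / η.e x * η.mu1 x * (ind (s == c) - η.pi x) + η.pi x * η.mu1 x

/-- Uncentered influence function of `ν_{0c}^PI = E[π_c(X) μ₀(X)]`. -/
noncomputable def phiNu0 {𝒳 : Type*} (c : Bool) (η : Nuisance 𝒳) : Obs 𝒳 → ℝ :=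
  fun (x, z, s, y) => (1 - ind z) / (1 - η.e x) * η.pi x * (y - η.mu0 x)
    + ind z / η.e x * η.mu0 x * (ind (s == c) - η.pi x) + η.pi x * η.mu0 x

/-- The influence function of `Δ_c^PI`, given the nuisance functions `η` and the values
`piBar = E[π_c(X)]` and `Δ = Δ_c^PI`. -/
noncomputable def phiDelta {𝒳 : Type*} (c : Bool) (η : Nuisance 𝒳) (piBar Δ : ℝ)
    (o : Obs 𝒳) : ℝ :=
  (phiNu1 c η o - phiNu0 c η o - Δ * phiPi c η o) / piBar

/-- `φ` is the nonparametric influence function of the functional `T` at the law `ρ`: it is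
centered and square integrable, and along every path `dρ_t = (1 + t s) dρ` with a bounded
centered score `s`, the derivative of `t ↦ T(ρ_t)` at 0 is `E_ρ[φ s]`. -/
def IsInfluenceFunction {𝒪 : Type*} [MeasurableSpace 𝒪] (T : Measure 𝒪 → ℝ)
    (ρ : Measure 𝒪) (φ : 𝒪 → ℝ) : Prop :=
  MemLp φ 2 ρ ∧ ∫ o, φ o ∂ρ = 0 ∧
    ∀ s : 𝒪 → ℝ, Measurable s → (∃ B : ℝ, ∀ o, |s o| ≤ B) → ∫ o, s o ∂ρ = 0 →
      HasDerivAt (fun t : ℝ => T (ρ.withDensity fun o => ENNReal.ofReal (1 + t * s o)))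
        (∫ o, φ o * s o ∂ρ) 0

/-- A `K`-fold scheme for cross-fitting. At stage `n` each of the observations `i < n` belongs to
one fold, and the nuisance functions used in fold `k` are computed by the learner from the
observations with indices in `train n k`, none of which lies in fold `k`. With
`train n k = {i < n | fold n i ≠ k}` this is ordinary cross-fitting; with one fold and
`train n k ⊆ {n, n + 1, …}` it is sample splitting. -/
structure CrossFit (𝒳 : Type*) [MeasurableSpace 𝒳] (K : ℕ) where
  fold : ℕ → ℕ → Fin K
  train : ℕ → Fin K → Finset ℕ
  learner : ∀ (n : ℕ) (k : Fin K), (train n k → Obs 𝒳) → Nuisance 𝒳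
  disjoint : ∀ n k i, i < n → fold n i = k → i ∉ train n k
  measurable_e : ∀ n k, Measurable fun p : (train n k → Obs 𝒳) × 𝒳 => (learner n k p.1).e p.2
  measurable_pi : ∀ n k, Measurable fun p : (train n k → Obs 𝒳) × 𝒳 => (learner n k p.1).pi p.2
  measurable_mu1 : ∀ n k, Measurable fun p : (train n k → Obs 𝒳) × 𝒳 => (learner n k p.1).mu1 p.2
  measurable_mu0 : ∀ n k, Measurable fun p : (train n k → Obs 𝒳) × 𝒳 => (learner n k p.1).mu0 p.2

/-- The nuisance estimates used in fold `k` at stage `n`, for the data sequence `o`. -/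
def CrossFit.estimate {𝒳 : Type*} [MeasurableSpace 𝒳] {K : ℕ} (S : CrossFit 𝒳 K)
    (n : ℕ) (k : Fin K) (o : ℕ → Obs 𝒳) : Nuisance 𝒳 :=
  S.learner n k fun j => o j

/-- The cross-fitted sample average of an estimating function that depends on nuisances. -/
noncomputable def CrossFit.average {𝒳 : Type*} [MeasurableSpace 𝒳] {K : ℕ} (S : CrossFit 𝒳 K)
    (φ : Nuisance 𝒳 → Obs 𝒳 → ℝ) (n : ℕ) (o : ℕ → Obs 𝒳) : ℝ :=
  (∑ i ∈ Finset.range n, φ (S.estimate n (S.fold n i) o) (o i)) / n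

/-- The cross-fitted influence-function-based estimator
`(ν̂_{1c} - ν̂_{0c}^PI) / π̂_c` of `Δ_c^PI`. -/
noncomputable def CrossFit.deltaIF {𝒳 : Type*} [MeasurableSpace 𝒳] {K : ℕ} (S : CrossFit 𝒳 K)
    (c : Bool) (n : ℕ) (o : ℕ → Obs 𝒳) : ℝ :=
  (S.average (phiNu1 c) n o - S.average (phiNu0 c) n o) / S.average (phiPi c) n o

/-- The `L²(ν)` distance `‖f̂(X) - f(X)‖₂` of two functions of the covariates. -/
noncomputable def l2err {𝒳 : Type*} [MeasurableSpace 𝒳] (ν : Measure 𝒳) (f g : 𝒳 → ℝ) : ℝ≥0∞ :=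
  eLpNorm (fun x => f x - g x) 2 ν

/-- The essential supremum of `1 / f`, with `1 / f = ∞` where `f ≤ 0`. -/
noncomputable def invSup {𝒳 : Type*} [MeasurableSpace 𝒳] (ν : Measure 𝒳) (f : 𝒳 → ℝ) : ℝ≥0∞ :=
  essSup (fun x => (ENNReal.ofReal (f x))⁻¹) ν

/-- `R_n = o_p(a_n)` for nonnegative random quantities `R_n`. -/
def IsLittleOP {Ω : Type*} [MeasurableSpace Ω] (Q : Measure Ω) (R : ℕ → Ω → ℝ≥0∞)
    (a : ℕ → ℝ) : Prop :=
  ∀ δ : ℝ, 0 < δ → Tendsto (fun n => Q {ω | ENNReal.ofReal (δ * a n) < R n ω}) atTop (𝓝 0)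

/-- `R_n = O_p(a_n)` for nonnegative random quantities `R_n`. -/
def IsBigOP {Ω : Type*} [MeasurableSpace Ω] (Q : Measure Ω) (R : ℕ → Ω → ℝ≥0∞)
    (a : ℕ → ℝ) : Prop :=
  ∀ δ : ℝ, 0 < δ → ∃ M : ℝ, ∀ᶠ n in atTop,
    Q {ω | ENNReal.ofReal (M * a n) < R n ω} ≤ ENNReal.ofReal δ

end PrincipalStrat

/-! Weighting an outcome by the inverse propensity score and adding the regression-based correction
gives, for each of `π_c`, `ν_{1c}` and `ν_{0c}`, a score whose conditional mean given the covariates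
is off by products of nuisance errors only: an error in one nuisance function alone does not bias
it. The rate conditions therefore make the bias of the estimated scores negligible at the rate
`√n`. Given the observations outside a fold, the scores in that fold are independent with estimated
nuisance functions held fixed, so Chebyshev's inequality bounds their centered sum by the `L²`
distance between the estimated and the true score, which tends to zero. Hence the cross-fitted
averages behave like the averages of the true scores, and the estimator, a ratio of such averages,
is asymptotically normal by the central limit theorem and Slutsky's theorem.

For the influence function, the nuisance functions of the tilted law `ρ_t` are within `O(t)` of the
true ones in `L²`, so by the same product structure the true scores, integrated against `ρ_t`,
compute the numerator and denominator of `Δ_c^PI(ρ_t)` up to `O(t²)`. -/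

namespace PrincipalStrat

lemma stronglyMeasurable_comap_comp {Ω 𝒳 : Type*} [m𝒳 : MeasurableSpace 𝒳] {X : Ω → 𝒳}
    {f : 𝒳 → ℝ} (hf : Measurable f) : StronglyMeasurable[m𝒳.comap X] fun ω => f (X ω) :=
  (hf.comp (comap_measurable X)).stronglyMeasurable

section Regression

variable {Ω 𝒳 : Type*} [MeasurableSpace Ω] [m𝒳 : MeasurableSpace 𝒳] {μ : Measure Ω}
  {X : Ω → 𝒳} {V W : Ω → ℝ} {f g : 𝒳 → ℝ}

namespace IsRegression

lemma measurable (h : IsRegression μ X W f) : Measurable f := h.1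

lemma ae_eq_condExp (h : IsRegression μ X W f) :
    (fun ω => f (X ω)) =ᵐ[μ] μ[W | m𝒳.comap X] := h.2

lemma integrable_comp (h : IsRegression μ X W f) : Integrable (fun ω => f (X ω)) μ :=
  integrable_condExp.congr h.ae_eq_condExp.symm

lemma integral_eq [IsFiniteMeasure μ] (hX : Measurable X) (h : IsRegression μ X W f) :
    ∫ ω, f (X ω) ∂μ = ∫ ω, W ω ∂μ := by
  rw [integral_congr_ae h.ae_eq_condExp, integral_condExp hX.comap_le]

lemma setIntegral_eq [IsFiniteMeasure μ] (hX : Measurable X) (hW : Integrable W μ)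
    (h : IsRegression μ X W f) {A : Set 𝒳} (hA : MeasurableSet A) :
    ∫ ω in X ⁻¹' A, f (X ω) ∂μ = ∫ ω in X ⁻¹' A, W ω ∂μ := by
  rw [← setIntegral_condExp hX.comap_le hW ⟨A, hA, rfl⟩]
  exact integral_congr_ae (ae_restrict_of_ae h.ae_eq_condExp)

lemma of_setIntegral_eq [IsFiniteMeasure μ] (hX : Measurable X) (hW : Integrable W μ)
    (hf : Measurable f) (hfX : Integrable (fun ω => f (X ω)) μ)
    (h : ∀ A : Set 𝒳, MeasurableSet A →
      ∫ ω in X ⁻¹' A, f (X ω) ∂μ = ∫ ω in X ⁻¹' A, W ω ∂μ) :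
    IsRegression μ X W f := by
  refine ⟨hf, ae_eq_condExp_of_forall_setIntegral_eq hX.comap_le hW
    (fun s _ _ => hfX.integrableOn) ?_ (stronglyMeasurable_comap_comp hf).aestronglyMeasurable⟩
  rintro _ ⟨A, hA, rfl⟩ -
  exact h A hA

lemma ae_eq (hf : IsRegression μ X W f) (hg : IsRegression μ X W g) :
    ∀ᵐ ω ∂μ, f (X ω) = g (X ω) :=
  hf.ae_eq_condExp.trans hg.ae_eq_condExp.symm

lemma congr (h : IsRegression μ X W f) (hWV : W =ᵐ[μ] V) : IsRegression μ X V f :=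
  ⟨h.measurable, h.ae_eq_condExp.trans (condExp_congr_ae hWV)⟩

lemma congr_fun (h : IsRegression μ X W f) (hg : Measurable g)
    (hfg : ∀ᵐ ω ∂μ, f (X ω) = g (X ω)) : IsRegression μ X W g :=
  ⟨hg, (show (fun ω => g (X ω)) =ᵐ[μ] fun ω => f (X ω) from hfg.mono fun _ h => h.symm).trans
    h.ae_eq_condExp⟩

lemma comp [IsFiniteMeasure μ] (hX : Measurable X) (hf : Measurable f)
    (hfX : Integrable (fun ω => f (X ω)) μ) : IsRegression μ X (fun ω => f (X ω)) f :=
  ⟨hf, by rw [condExp_of_stronglyMeasurable hX.comap_le (stronglyMeasurable_comap_comp hf) hfX]⟩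

lemma const [IsFiniteMeasure μ] (hX : Measurable X) (a : ℝ) :
    IsRegression μ X (fun _ => a) (fun _ => a) :=
  comp hX measurable_const (integrable_const a)

lemma add (hW : Integrable W μ) (hV : Integrable V μ) (hf : IsRegression μ X W f)
    (hg : IsRegression μ X V g) :
    IsRegression μ X (fun ω => W ω + V ω) (fun x => f x + g x) :=
  ⟨hf.measurable.add hg.measurable,
    (hf.ae_eq_condExp.add hg.ae_eq_condExp).trans (condExp_add hW hV _).symm⟩

lemma sub (hW : Integrable W μ) (hV : Integrable V μ) (hf : IsRegression μ X W f)
    (hg : IsRegression μ X V g) :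
    IsRegression μ X (fun ω => W ω - V ω) (fun x => f x - g x) :=
  ⟨hf.measurable.sub hg.measurable,
    (hf.ae_eq_condExp.sub hg.ae_eq_condExp).trans (condExp_sub hW hV _).symm⟩

lemma mul {w : 𝒳 → ℝ} (hw : Measurable w) (hW : Integrable W μ)
    (hwW : Integrable (fun ω => w (X ω) * W ω) μ) (h : IsRegression μ X W f) :
    IsRegression μ X (fun ω => w (X ω) * W ω) (fun x => w x * f x) :=
  ⟨hw.mul h.measurable, (EventuallyEq.rfl.mul h.ae_eq_condExp).trans
    (condExp_mul_of_stronglyMeasurable_left (stronglyMeasurable_comap_comp hw) hwW hW).symm⟩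

lemma div (h : IsRegression μ X W f) {w : 𝒳 → ℝ} (hw : Measurable w) (hW : Integrable W μ)
    (hWw : Integrable (fun ω => W ω / w (X ω)) μ) :
    IsRegression μ X (fun ω => W ω / w (X ω)) (fun x => f x / w x) := by
  simp only [div_eq_inv_mul] at hWw ⊢
  exact h.mul hw.inv hW hWw

lemma const_mul (a : ℝ) (h : IsRegression μ X W f) :
    IsRegression μ X (fun ω => a * W ω) (fun x => a * f x) :=
  ⟨h.measurable.const_mul a, (EventuallyEq.rfl.mul h.ae_eq_condExp).trans
    (condExp_smul a W _).symm⟩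

lemma ae_le (hW : Integrable W μ) (hV : Integrable V μ) (hf : IsRegression μ X W f)
    (hg : IsRegression μ X V g) (h : W ≤ᵐ[μ] V) : ∀ᵐ ω ∂μ, f (X ω) ≤ g (X ω) :=
  hf.ae_eq_condExp.trans_le ((condExp_mono hW hV h).trans hg.ae_eq_condExp.symm.le)

lemma ae_abs_le (hW : Integrable W μ) (hV : Integrable V μ) (hf : IsRegression μ X W f)
    (hg : IsRegression μ X V g) (h : ∀ᵐ ω ∂μ, |W ω| ≤ V ω) : ∀ᵐ ω ∂μ, |f (X ω)| ≤ g (X ω) := by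
  filter_upwards [hf.ae_le hW hV hg (h.mono fun _ hω => (le_abs_self _).trans hω),
    (hf.const_mul (-1)).ae_le (hW.const_mul _) hV hg
      (h.mono fun ω hω => by linarith [neg_abs_le (W ω)])] with ω hupper hlower
  exact abs_le.2 ⟨by linarith, hupper⟩

lemma smul_measure [IsFiniteMeasure μ] {a : ℝ≥0∞} (ha : a ≠ ∞) (hX : Measurable X)
    (hW : Integrable W μ) (h : IsRegression μ X W f) : IsRegression (a • μ) X W f := by
  have := Measure.smul_finite μ ha
  refine of_setIntegral_eq hX (hW.smul_measure ha) h.measurable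
    (h.integrable_comp.smul_measure ha) fun A hA => ?_
  simp only [Measure.restrict_smul, integral_smul_measure, h.setIntegral_eq hX hW hA]

lemma mul_restrict [IsFiniteMeasure μ] (hX : Measurable X) {T : Set Ω} (hT : MeasurableSet T)
    {r : 𝒳 → ℝ} (hr : IsRegression μ X (T.indicator fun _ => 1) r)
    (hW : Integrable W (μ.restrict T)) (hf : IsRegression (μ.restrict T) X W f) :
    IsRegression μ X (T.indicator W) (fun x => f x * r x) := by
  have hmul_indicator : (fun ω => f (X ω) * T.indicator (fun _ => (1 : ℝ)) ω)
      = T.indicator fun ω => f (X ω) := by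
    ext ω
    by_cases hω : ω ∈ T <;> simp [hω]
  have hint : Integrable (fun ω => f (X ω) * T.indicator (fun _ => (1 : ℝ)) ω) μ := by
    rw [hmul_indicator]
    exact (integrable_indicator_iff hT).2 hf.integrable_comp
  have hprod := hr.mul hf.measurable ((integrable_const (1 : ℝ)).indicator hT) hint
  refine of_setIntegral_eq hX ((integrable_indicator_iff hT).2 hW) hprod.measurable
    hprod.integrable_comp fun A hA => ?_
  have hA' := hf.setIntegral_eq hX hW hA
  rw [Measure.restrict_restrict (hX hA)] at hA'
  rw [hprod.setIntegral_eq hX hint hA, hmul_indicator, setIntegral_indicator hT,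
    setIntegral_indicator hT, hA']

lemma of_map [IsFiniteMeasure μ] {Ω' : Type*} [MeasurableSpace Ω'] {T : Ω → Ω'}
    {X' : Ω' → 𝒳} {W' : Ω' → ℝ} (hT : Measurable T) (hX' : Measurable X')
    (hW' : Integrable W' (μ.map T))
    (h : IsRegression μ (fun ω => X' (T ω)) (fun ω => W' (T ω)) f) :
    IsRegression (μ.map T) X' W' f := by
  have hfX : Measurable fun ω => f (X' ω) := h.measurable.comp hX'
  refine of_setIntegral_eq hX' hW' h.measurable
    ((integrable_map_measure hfX.aestronglyMeasurable hT.aemeasurable).2 h.integrable_comp)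
    fun A hA => ?_
  rw [setIntegral_map (hX' hA) hfX.aestronglyMeasurable hT.aemeasurable,
    setIntegral_map (hX' hA) hW'.aestronglyMeasurable hT.aemeasurable]
  exact h.setIntegral_eq (hX'.comp hT) (hW'.comp_measurable hT) hA

lemma restrict_of_map [IsFiniteMeasure μ] {Ω' : Type*} [MeasurableSpace Ω'] {T : Ω → Ω'}
    {X' : Ω' → 𝒳} {W' : Ω' → ℝ} {A : Set Ω'} (hT : Measurable T) (hX' : Measurable X')
    (hA : MeasurableSet A) (hW' : Integrable W' ((μ.map T).restrict A))
    (h : IsRegression (μ.restrict (T ⁻¹' A)) (fun ω => X' (T ω)) (fun ω => W' (T ω)) f) :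
    IsRegression ((μ.map T).restrict A) X' W' f := by
  rw [Measure.restrict_map hT hA] at hW' ⊢
  exact of_map hT hX' hW' h

lemma of_restrict_compl [IsFiniteMeasure μ] (hX : Measurable X) {T : Set Ω} (hT : MeasurableSet T)
    (hW : Integrable W μ) (hf : IsRegression (μ.restrict T) X W f)
    (hf' : IsRegression (μ.restrict Tᶜ) X W f) : IsRegression μ X W f := by
  have hfX : Integrable (fun ω => f (X ω)) μ := by
    rw [← integrableOn_univ, ← Set.union_compl_self T]
    exact IntegrableOn.union (μ := μ) hf.integrable_comp hf'.integrable_comp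
  refine of_setIntegral_eq hX hW hf.measurable hfX fun A hA => ?_
  have hset := hf.setIntegral_eq hX hW.restrict hA
  have hset' := hf'.setIntegral_eq hX hW.restrict hA
  rw [Measure.restrict_comm (hX hA)] at hset hset'
  rw [← integral_add_compl hT hfX.restrict, ← integral_add_compl hT hW.restrict, hset, hset']

end IsRegression

lemma exists_comp_eq_condExp (μ : Measure Ω) (X : Ω → 𝒳) (W : Ω → ℝ) :
    ∃ f : 𝒳 → ℝ, Measurable f ∧ (fun ω => f (X ω)) = μ[W | m𝒳.comap X] := by
  obtain ⟨f, hf, hfX⟩ := (stronglyMeasurable_condExp (m := m𝒳.comap X) (μ := μ)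
    (f := W)).measurable.exists_eq_measurable_comp
  exact ⟨f, hf, hfX.symm⟩

lemma exists_isRegression (μ : Measure Ω) (X : Ω → 𝒳) (W : Ω → ℝ) :
    ∃ f : 𝒳 → ℝ, IsRegression μ X W f :=
  let ⟨f, hf, hfX⟩ := exists_comp_eq_condExp μ X W
  ⟨f, hf, hfX.eventuallyEq⟩

lemma isRegression_smul_measure_iff [IsFiniteMeasure μ] {a : ℝ≥0∞} (ha0 : a ≠ 0) (ha : a ≠ ∞)
    (hX : Measurable X) (hW : Integrable W μ) :
    IsRegression (a • μ) X W f ↔ IsRegression μ X W f := by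
  refine ⟨fun h => ?_, IsRegression.smul_measure ha hX hW⟩
  have := Measure.smul_finite μ ha
  simpa [smul_smul, ENNReal.inv_mul_cancel ha0 ha] using
    h.smul_measure (ENNReal.inv_ne_top.2 ha0) hX (hW.smul_measure ha)

lemma isRegression_cond_iff [IsFiniteMeasure μ] (hX : Measurable X) {T : Set Ω}
    (hW : Integrable W (μ.restrict T)) :
    IsRegression (ProbabilityTheory.cond μ T) X W f ↔ IsRegression (μ.restrict T) X W f := by
  by_cases hT : μ T = 0
  · simp [IsRegression, ProbabilityTheory.cond, Measure.restrict_eq_zero.2 hT, EventuallyEq]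
  · exact isRegression_smul_measure_iff (ENNReal.inv_ne_zero.2 (measure_ne_top μ T))
      (ENNReal.inv_ne_top.2 hT) hX hW

end Regression

section Positivity

variable {Ω 𝒳 : Type*} [MeasurableSpace Ω] [m𝒳 : MeasurableSpace 𝒳] {μ : Measure Ω}
  [IsFiniteMeasure μ] {X : Ω → 𝒳} {T : Set Ω} {r : 𝒳 → ℝ} {ε : ℝ}

lemma map_le_smul_map_restrict (hX : Measurable X) (hT : MeasurableSet T)
    (hr : IsRegression μ X (T.indicator fun _ => 1) r) (hε : 0 < ε)
    (hrε : ∀ᵐ ω ∂μ, ε ≤ r (X ω)) :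
    μ.map X ≤ ENNReal.ofReal ε⁻¹ • (μ.restrict T).map X := by
  refine Measure.le_iff.2 fun A hA => ?_
  have hle : ε * μ.real (X ⁻¹' A) ≤ μ.real (X ⁻¹' A ∩ T) := calc
    ε * μ.real (X ⁻¹' A) = ∫ _ in X ⁻¹' A, ε ∂μ := by simp [mul_comm]
    _ ≤ ∫ ω in X ⁻¹' A, r (X ω) ∂μ :=
      integral_mono_ae (integrable_const _) hr.integrable_comp.integrableOn
        (ae_restrict_of_ae hrε)
    _ = ∫ ω in X ⁻¹' A, T.indicator (fun _ => (1 : ℝ)) ω ∂μ :=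
      hr.setIntegral_eq hX ((integrable_const _).indicator hT) hA
    _ = μ.real (X ⁻¹' A ∩ T) := by rw [setIntegral_indicator hT]; simp
  rw [Measure.smul_apply, Measure.map_apply hX hA, Measure.map_apply hX hA,
    Measure.restrict_apply (hX hA), smul_eq_mul, ← ofReal_measureReal, ← ofReal_measureReal,
    ← ENNReal.ofReal_mul (inv_nonneg.2 hε.le)]
  exact ENNReal.ofReal_le_ofReal ((le_inv_mul_iff₀ hε).2 hle)

lemma ae_of_ae_restrict (hX : Measurable X) (hT : MeasurableSet T)
    (hr : IsRegression μ X (T.indicator fun _ => 1) r) (hε : 0 < ε)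
    (hrε : ∀ᵐ ω ∂μ, ε ≤ r (X ω)) {p : 𝒳 → Prop} (hp : MeasurableSet {x | p x})
    (h : ∀ᵐ ω ∂μ.restrict T, p (X ω)) : ∀ᵐ ω ∂μ, p (X ω) := by
  rw [← ae_map_iff hX.aemeasurable hp] at h ⊢
  exact (Measure.absolutelyContinuous_of_le_smul
    (map_le_smul_map_restrict hX hT hr hε hrε)).ae_le h

lemma memLp_of_memLp_restrict (hX : Measurable X) (hT : MeasurableSet T)
    (hr : IsRegression μ X (T.indicator fun _ => 1) r) (hε : 0 < ε)
    (hrε : ∀ᵐ ω ∂μ, ε ≤ r (X ω)) {f : 𝒳 → ℝ} (hf : Measurable f) {q : ℝ≥0∞}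
    (h : MemLp (fun ω => f (X ω)) q (μ.restrict T)) : MemLp (fun ω => f (X ω)) q μ := by
  have hmap := memLp_map_measure_iff (μ := μ.restrict T) (f := X) (p := q)
    hf.aestronglyMeasurable hX.aemeasurable
  exact (memLp_map_measure_iff hf.aestronglyMeasurable hX.aemeasurable).1
    ((hmap.2 h).of_measure_le_smul ENNReal.ofReal_ne_top
      (map_le_smul_map_restrict hX hT hr hε hrε))

end Positivity

section ChangeOfDensity

variable {Ω 𝒳 : Type*} [MeasurableSpace Ω] [m𝒳 : MeasurableSpace 𝒳] {μ : Measure Ω}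
  {X : Ω → 𝒳} {W V : Ω → ℝ} {g : Ω → ℝ} {τ : ℝ}

lemma integral_withDensity_ofReal (hg : Measurable g) (hg0 : ∀ ω, 0 ≤ g ω) (F : Ω → ℝ) :
    ∫ ω, F ω ∂μ.withDensity (fun ω => ENNReal.ofReal (g ω)) = ∫ ω, g ω * F ω ∂μ := by
  rw [integral_withDensity_eq_integral_toReal_smul hg.ennreal_ofReal
    (Eventually.of_forall fun _ => ENNReal.ofReal_lt_top)]
  simp only [ENNReal.toReal_ofReal (hg0 _), smul_eq_mul]

lemma integrable_withDensity_ofReal_iff (hg : Measurable g) (hg0 : ∀ ω, 0 ≤ g ω) (F : Ω → ℝ) :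
    Integrable F (μ.withDensity fun ω => ENNReal.ofReal (g ω)) ↔
      Integrable (fun ω => g ω * F ω) μ := by
  rw [integrable_withDensity_iff_integrable_smul' hg.ennreal_ofReal
    (Eventually.of_forall fun _ => ENNReal.ofReal_lt_top)]
  simp only [ENNReal.toReal_ofReal (hg0 _), smul_eq_mul]

lemma withDensity_ofReal_le_two_smul (hτ : τ ≤ 1 / 2) (hgτ : ∀ ω, |g ω - 1| ≤ τ) :
    μ.withDensity (fun ω => ENNReal.ofReal (g ω)) ≤ (2 : ℝ≥0∞) • μ := by
  have htwo : (2 : ℝ≥0∞) • μ = μ.withDensity fun _ => 2 := (withDensity_const _).symm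
  rw [htwo]
  refine withDensity_mono (Eventually.of_forall fun ω => ?_)
  simp only
  rw [← ENNReal.ofReal_ofNat]
  exact ENNReal.ofReal_le_ofReal (by linarith [(abs_le.1 (hgτ ω)).2])

lemma integrable_mul_of_abs_sub_one_le (hg : Measurable g) (hgτ : ∀ ω, |g ω - 1| ≤ τ)
    (hW : Integrable W μ) : Integrable (fun ω => g ω * W ω) μ :=
  hW.bdd_mul hg.aestronglyMeasurable (c := τ + 1) (Eventually.of_forall fun ω => by
    simpa using (norm_add_le (g ω - 1) 1).trans (add_le_add (hgτ ω) norm_one.le))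

/-- Bayes' rule, with the denominator `E[g | X]` multiplied out because it may vanish. -/
lemma IsRegression.mul_of_withDensity [IsFiniteMeasure μ] (hX : Measurable X)
    (hg : Measurable g) (hg0 : ∀ ω, 0 ≤ g ω) (hgi : Integrable g μ)
    (hgW : Integrable (fun ω => g ω * W ω) μ) {f G : 𝒳 → ℝ}
    (hf : IsRegression (μ.withDensity fun ω => ENNReal.ofReal (g ω)) X W f)
    (hG : IsRegression μ X g G) :
    IsRegression μ X (fun ω => g ω * W ω) (fun x => f x * G x) := by
  have : IsFiniteMeasure (μ.withDensity fun ω => ENNReal.ofReal (g ω)) :=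
    isFiniteMeasure_withDensity_ofReal hgi.2
  have hfg : Integrable (fun ω => f (X ω) * g ω) μ := by
    simpa only [mul_comm] using (integrable_withDensity_ofReal_iff hg hg0 _).1 hf.integrable_comp
  have hfG := hG.mul hf.measurable hgi hfg
  refine of_setIntegral_eq hX hgW hfG.measurable hfG.integrable_comp fun A hA => ?_
  have hset := hf.setIntegral_eq hX ((integrable_withDensity_ofReal_iff hg hg0 W).2 hgW) hA
  rw [restrict_withDensity (hX hA), integral_withDensity_ofReal hg hg0,
    integral_withDensity_ofReal hg hg0] at hset
  rw [hfG.setIntegral_eq hX hfg hA, ← hset]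
  simp only [mul_comm]

lemma abs_sub_le_of_abs_mul_sub_le {a b G F : ℝ} (hτ : τ ≤ 1 / 2) (hG : |G - 1| ≤ τ)
    (hab : |a * G - b| ≤ τ * F) (hb : |b| ≤ F) : |a - b| ≤ 4 * τ * F := by
  have hGpos : 1 / 2 ≤ G := by linarith [(abs_le.1 hG).1]
  have hGab : G * |a - b| ≤ 2 * (τ * F) := calc
    G * |a - b| = |(a * G - b) + (1 - G) * b| := by
      rw [← abs_of_nonneg (by linarith : 0 ≤ G), ← abs_mul, abs_of_nonneg (by linarith : 0 ≤ G)]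
      ring_nf
    _ ≤ |a * G - b| + |1 - G| * |b| := (abs_add_le _ _).trans_eq (by rw [abs_mul])
    _ ≤ τ * F + τ * F := add_le_add hab
      (mul_le_mul (by rwa [abs_sub_comm]) hb (abs_nonneg _) ((abs_nonneg _).trans hG))
    _ = 2 * (τ * F) := by ring
  linarith [mul_le_mul_of_nonneg_right hGpos (abs_nonneg (a - b))]

lemma IsRegression.abs_sub_le_of_withDensity [IsFiniteMeasure μ] (hX : Measurable X)
    (hW : Integrable W μ) (hV : Integrable V μ) (hWV : ∀ᵐ ω ∂μ, |W ω| ≤ V ω) (hg : Measurable g)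
    (hτ : τ ≤ 1 / 2) (hgτ : ∀ ω, |g ω - 1| ≤ τ) {f f' F : 𝒳 → ℝ} (hf : IsRegression μ X W f)
    (hF : IsRegression μ X V F)
    (hf' : IsRegression (μ.withDensity fun ω => ENNReal.ofReal (g ω)) X W f') :
    ∀ᵐ ω ∂μ, |f' (X ω) - f (X ω)| ≤ 4 * τ * F (X ω) := by
  have hg0 : ∀ ω, 0 ≤ g ω := fun ω => by linarith [(abs_le.1 (hgτ ω)).1]
  have hgi : Integrable g μ := by
    simpa only [mul_one] using integrable_mul_of_abs_sub_one_le hg hgτ (integrable_const (1 : ℝ))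
  have hgW := integrable_mul_of_abs_sub_one_le hg hgτ hW
  obtain ⟨G, hG⟩ := exists_isRegression μ X g
  have hGτ : ∀ᵐ ω ∂μ, |G (X ω) - 1| ≤ τ :=
    (hG.sub hgi (integrable_const 1) (const hX 1)).ae_abs_le (hgi.sub (integrable_const 1))
      (integrable_const τ) (const hX τ) (Eventually.of_forall hgτ)
  have hf'G := hf'.mul_of_withDensity hX hg hg0 hgi hgW hG
  have hdiff : ∀ᵐ ω ∂μ, |f' (X ω) * G (X ω) - f (X ω)| ≤ τ * F (X ω) := by
    refine (hf'G.sub hgW hW hf).ae_abs_le (hgW.sub hW) (hV.const_mul τ) (hF.const_mul τ)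
      (hWV.mono fun ω hω => ?_)
    rw [Pi.sub_apply, ← sub_one_mul, abs_mul]
    exact mul_le_mul (hgτ ω) hω (abs_nonneg _) ((abs_nonneg _).trans (hgτ ω))
  filter_upwards [hGτ, hdiff, hf.ae_abs_le hW hV hF hWV] with ω hGω hdiffω hfω
  exact abs_sub_le_of_abs_mul_sub_le hτ hGω hdiffω hfω

end ChangeOfDensity

section Ignorability

variable {Ω : Type*} {m : MeasurableSpace Ω} [mΩ : MeasurableSpace Ω] [StandardBorelSpace Ω]
  {P : Measure Ω} [IsFiniteMeasure P]

lemma condExp_mul_of_condIndepFun {hm : m ≤ mΩ} {U V : Ω → ℝ}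
    (hU : Measurable U) (hV : Measurable V) (hind : CondIndepFun m hm U V P)
    (hUi : Integrable U P) (hVi : Integrable V P) (hUV : Integrable (fun ω => U ω * V ω) P) :
    P[fun ω => U ω * V ω | m] =ᵐ[P] fun ω => P[U | m] ω * P[V | m] ω := by
  have hprod := (condIndepFun_iff_map_prod_eq_prod_map_map hU hV).1 hind
  filter_upwards [condExp_ae_eq_integral_condExpKernel hm hUV,
    condExp_ae_eq_integral_condExpKernel hm hUi, condExp_ae_eq_integral_condExpKernel hm hVi,
    ae_of_ae_trim hm hprod] with ω hω hUω hVω hprodω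
  have hindω : IndepFun U V (condExpKernel P m ω) := by
    rw [indepFun_iff_map_prod_eq_prod_map_map hU.aemeasurable hV.aemeasurable,
      ← Kernel.map_apply _ (hU.prodMk hV), ← Kernel.map_apply _ hU, ← Kernel.map_apply _ hV,
      hprodω, Kernel.prod_apply]
  rw [hω, hUω, hVω]
  exact hindω.integral_fun_mul_eq_mul_integral hU.aestronglyMeasurable hV.aestronglyMeasurable

lemma IsRegression.restrict_of_condIndepFun {𝒳 𝒰 𝒵 : Type*} [m𝒳 : MeasurableSpace 𝒳]
    [MeasurableSpace 𝒰] [MeasurableSpace 𝒵] {X : Ω → 𝒳} {U : Ω → 𝒰} {Z : Ω → 𝒵} {G : 𝒰 → ℝ}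
    {f : 𝒳 → ℝ} (hX : Measurable X) (hU : Measurable U) (hZ : Measurable Z) (hG : Measurable G)
    (hind : CondIndepFun (m𝒳.comap X) hX.comap_le Z U P)
    (hGi : Integrable (fun ω => G (U ω)) P) (hf : IsRegression P X (fun ω => G (U ω)) f)
    {s : Set 𝒵} (hs : MeasurableSet s) :
    IsRegression (P.restrict (Z ⁻¹' s)) X (fun ω => G (U ω)) f := by
  set T := Z ⁻¹' s
  have hT : MeasurableSet T := hZ hs
  have hindicator : ∀ F : Ω → ℝ, (fun ω => F ω * T.indicator (fun _ => (1 : ℝ)) ω)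
      = T.indicator F := fun F => by
    ext ω
    by_cases hω : ω ∈ T <;> simp [hω]
  have hone : Integrable (T.indicator fun _ => (1 : ℝ)) P := (integrable_const 1).indicator hT
  have hGT := hGi.indicator hT
  have hfT := hf.integrable_comp.indicator hT
  rw [← hindicator] at hGT hfT
  have hcond : CondIndepFun (m𝒳.comap X) hX.comap_le (fun ω => G (U ω))
      (T.indicator fun _ => (1 : ℝ)) P :=
    hind.symm.comp hG (ψ := s.indicator fun _ => (1 : ℝ)) (measurable_const.indicator hs)
  obtain ⟨r, hr⟩ := exists_isRegression P X (T.indicator fun _ => (1 : ℝ))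
  have hfr := hr.mul hf.measurable hone hfT
  have hGr : IsRegression P X (fun ω => G (U ω) * T.indicator (fun _ => (1 : ℝ)) ω)
      (fun x => f x * r x) :=
    ⟨hfr.measurable, (hf.ae_eq_condExp.mul hr.ae_eq_condExp).trans
      (condExp_mul_of_condIndepFun (hG.comp hU) (measurable_const.indicator hT) hcond hGi hone
        hGT).symm⟩
  refine of_setIntegral_eq hX hGi.restrict hf.measurable hf.integrable_comp.restrict fun A hA => ?_
  rw [Measure.restrict_restrict (hX hA), ← setIntegral_indicator hT, ← setIntegral_indicator hT,
    ← hindicator fun ω => f (X ω), ← hindicator fun ω => G (U ω), ← hfr.setIntegral_eq hX hfT hA,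
    hGr.setIntegral_eq hX hGT hA]

end Ignorability

lemma ind_nonneg (b : Bool) : 0 ≤ ind b := by cases b <;> simp [ind]

lemma ind_le_one (b : Bool) : ind b ≤ 1 := by cases b <;> simp [ind]

lemma norm_ind_le_one (b : Bool) : ‖ind b‖ ≤ 1 := by
  rw [Real.norm_of_nonneg (ind_nonneg b)]
  exact ind_le_one b

lemma measurable_ind_beq {Ω : Type*} [MeasurableSpace Ω] {S : Ω → Bool} (hS : Measurable S)
    (b : Bool) : Measurable fun ω => ind (S ω == b) :=
  (measurable_of_countable fun s : Bool => ind (s == b)).comp hS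

lemma integrable_ind_beq_mul {Ω : Type*} [MeasurableSpace Ω] {μ : Measure Ω} {S : Ω → Bool}
    (hS : Measurable S) (b : Bool) {W : Ω → ℝ} (hW : Integrable W μ) :
    Integrable (fun ω => ind (S ω == b) * W ω) μ :=
  hW.bdd_mul (measurable_ind_beq hS b).aestronglyMeasurable
    (Eventually.of_forall fun _ => norm_ind_le_one _)

lemma integrable_ind_beq {Ω : Type*} [MeasurableSpace Ω] {μ : Measure Ω} [IsFiniteMeasure μ]
    {S : Ω → Bool} (hS : Measurable S) (b : Bool) : Integrable (fun ω => ind (S ω == b)) μ := by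
  simpa only [mul_one] using integrable_ind_beq_mul hS b (integrable_const (μ := μ) (1 : ℝ))

lemma indicator_setOf_eq {Ω : Type*} (S : Ω → Bool) (b : Bool) (W : Ω → ℝ) :
    {ω | S ω = b}.indicator W = fun ω => ind (S ω == b) * W ω := by
  ext ω
  by_cases h : S ω = b <;> simp [ind, h]

/-- The four nuisance functions are measurable. -/
structure Nuisance.IsMeasurable {𝒳 : Type*} [MeasurableSpace 𝒳] (ξ : Nuisance 𝒳) : Prop where
  measurable_e : Measurable ξ.e
  measurable_pi : Measurable ξ.pi
  measurable_mu1 : Measurable ξ.mu1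
  measurable_mu0 : Measurable ξ.mu0

/-- The nuisance functions `ξ` are usable for covariates with law `ν`: the propensity score stays
`κ` away from 0 and 1, the principal score is a probability and the outcome means are square
integrable. -/
structure IsAdmissible {𝒳 : Type*} [MeasurableSpace 𝒳] (ν : Measure 𝒳) (ξ : Nuisance 𝒳)
    (κ : ℝ) : Prop extends ξ.IsMeasurable where
  pos : 0 < κ
  e_mem : ∀ᵐ x ∂ν, κ ≤ ξ.e x ∧ ξ.e x ≤ 1 - κ
  pi_mem : ∀ᵐ x ∂ν, 0 ≤ ξ.pi x ∧ ξ.pi x ≤ 1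
  memLp_mu1 : MemLp ξ.mu1 2 ν
  memLp_mu0 : MemLp ξ.mu0 2 ν

section Observed

variable {𝒳 : Type*}

/-- The factor `I(S = c)`, which among the treated coincides with `I(C = c)`. -/
def stratum (c : Bool) (o : Obs 𝒳) : ℝ := ind (o.2.2.1 == c)

/-- The outcome `Y` of an observation. -/
def outcome (o : Obs 𝒳) : ℝ := o.2.2.2

/-- The observations of treated individuals. -/
def treated (𝒳 : Type*) : Set (Obs 𝒳) := {o | o.2.1 = true}

/-- The observations of untreated individuals. -/
def control (𝒳 : Type*) : Set (Obs 𝒳) := {o | o.2.1 = false}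

lemma control_eq_compl_treated : control 𝒳 = (treated 𝒳)ᶜ := by
  ext o
  simp [control, treated]

variable [MeasurableSpace 𝒳]

lemma measurableSet_treated : MeasurableSet (treated 𝒳) :=
  measurable_snd.fst (measurableSet_singleton true)

lemma measurableSet_control : MeasurableSet (control 𝒳) :=
  measurable_snd.fst (measurableSet_singleton false)

lemma measurable_stratum (c : Bool) : Measurable (stratum (𝒳 := 𝒳) c) :=
  measurable_ind_beq measurable_snd.snd.fst c

lemma measurable_outcome : Measurable (outcome (𝒳 := 𝒳)) := measurable_snd.snd.snd

lemma integrable_stratum {ρ : Measure (Obs 𝒳)} [IsFiniteMeasure ρ] (c : Bool) :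
    Integrable (stratum c) ρ :=
  integrable_ind_beq measurable_snd.snd.fst c

lemma memLp_top_stratum {ρ : Measure (Obs 𝒳)} (c : Bool) : MemLp (stratum c) ∞ ρ :=
  memLp_top_of_bound (measurable_stratum c).aestronglyMeasurable 1
    (Eventually.of_forall fun _ => norm_ind_le_one _)

lemma integrable_stratum_mul_outcome {ρ : Measure (Obs 𝒳)} (c : Bool)
    (hY : Integrable outcome ρ) : Integrable (fun o => stratum c o * outcome o) ρ :=
  integrable_ind_beq_mul measurable_snd.snd.fst c hY

/-- `e`, `p`, `q` and `m` are the regression functions that the law `ρ` of the observed data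
determines: `P(Z = 1 | X)`, `P(S = c | X, Z = 1)`, `E[I(S = c) Y | X, Z = 1]` and
`E[Y | X, Z = 0]`. Working with `q` instead of `E[Y | X, Z = 1, S = c] = q / p` avoids the division
by `p`, which may vanish. -/
structure ObservedRegressions (ρ : Measure (Obs 𝒳)) (c : Bool) (e p q m : 𝒳 → ℝ) : Prop where
  reg_treated : IsRegression ρ Prod.fst ((treated 𝒳).indicator fun _ => 1) e
  reg_stratum : IsRegression (ρ.restrict (treated 𝒳)) Prod.fst (stratum c) p
  reg_stratum_mul_outcome :
    IsRegression (ρ.restrict (treated 𝒳)) Prod.fst (fun o => stratum c o * outcome o) q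
  reg_outcome : IsRegression (ρ.restrict (control 𝒳)) Prod.fst outcome m

lemma isRegression_indicator_control {ρ : Measure (Obs 𝒳)} [IsFiniteMeasure ρ] {e : 𝒳 → ℝ}
    (he : IsRegression ρ Prod.fst ((treated 𝒳).indicator fun _ => 1) e) :
    IsRegression ρ Prod.fst ((control 𝒳).indicator fun _ => 1) (fun x => 1 - e x) := by
  refine ((IsRegression.const measurable_fst 1).sub (integrable_const 1)
    ((integrable_const 1).indicator measurableSet_treated) he).congr
    (Eventually.of_forall fun o => ?_)
  rw [control_eq_compl_treated]
  by_cases ho : o ∈ treated 𝒳 <;> simp [ho]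

/-- The observed data have the law `ρ`, with square integrable outcomes, and `η` consists of its
nuisance functions, which are admissible. -/
structure Identified (ρ : Measure (Obs 𝒳)) (c : Bool) (η : Nuisance 𝒳) (ε : ℝ) : Prop where
  admissible : IsAdmissible (ρ.map Prod.fst) η ε
  memLp_outcome : MemLp outcome 2 ρ
  regressions : ObservedRegressions ρ c η.e η.pi (fun x => η.pi x * η.mu1 x) η.mu0

end Observed

section FullData

variable {Ω 𝒳 : Type*} [MeasurableSpace Ω] [m𝒳 : MeasurableSpace 𝒳]
  {P : Measure Ω} {X : Ω → 𝒳} {Z C : Ω → Bool} {Y1 Y0 : Ω → ℝ}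
  {c : Bool} {η : Nuisance 𝒳} {ε : ℝ}

/-- The full data consist of measurable variables with square integrable potential outcomes, and
treatment assignment is ignorable given the covariates. -/
structure IsIgnorableStudy [StandardBorelSpace Ω] (P : Measure Ω) [IsFiniteMeasure P] (X : Ω → 𝒳)
    (Z C : Ω → Bool) (Y1 Y0 : Ω → ℝ) : Prop where
  measurable_X : Measurable X
  measurable_Z : Measurable Z
  measurable_C : Measurable C
  measurable_Y1 : Measurable Y1
  measurable_Y0 : Measurable Y0
  memLp_Y1 : MemLp Y1 2 P
  memLp_Y0 : MemLp Y0 2 P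
  ignorable : CondIndepFun (m𝒳.comap X) measurable_X.comap_le Z (fun ω => (C ω, Y1 ω, Y0 ω)) P

/-- The propensity score `e` is bounded away from 0 and 1 by `ε`. -/
structure IsPositive (P : Measure Ω) (X : Ω → 𝒳) (e : 𝒳 → ℝ) (ε : ℝ) : Prop where
  pos : 0 < ε
  e_mem : ∀ᵐ ω ∂P, ε ≤ e (X ω) ∧ e (X ω) ≤ 1 - ε

lemma measurable_observe (hX : Measurable X) (hZ : Measurable Z) (hC : Measurable C)
    (hY1 : Measurable Y1) (hY0 : Measurable Y0) : Measurable (observe X Z C Y1 Y0) :=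
  hX.prodMk (hZ.prodMk (((measurable_of_countable fun s : Bool × Bool => s.1 && s.2).comp
    (hZ.prodMk hC)).prodMk (Measurable.ite (hZ (measurableSet_singleton true)) hY1 hY0)))

lemma IsTrueNuisance.isRegression_indicator_treated (hη : IsTrueNuisance P c X Z C Y1 Y0 η) :
    IsRegression P X ({ω | Z ω = true}.indicator fun _ => 1) η.e := by
  simpa only [indicator_setOf_eq, mul_one, beq_true] using hη.e_eq

lemma IsTrueNuisance.isRegression_indicator_stratum (hη : IsTrueNuisance P c X Z C Y1 Y0 η) :
    IsRegression P X ({ω | C ω = c}.indicator fun _ => 1) η.pi := by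
  simpa only [indicator_setOf_eq, mul_one] using hη.pi_eq

namespace IsIgnorableStudy

variable [StandardBorelSpace Ω] [IsFiniteMeasure P]

lemma measurable_observe (h : IsIgnorableStudy P X Z C Y1 Y0) :
    Measurable (observe X Z C Y1 Y0) :=
  PrincipalStrat.measurable_observe h.measurable_X h.measurable_Z h.measurable_C h.measurable_Y1
    h.measurable_Y0

lemma measurableSet_treatment (h : IsIgnorableStudy P X Z C Y1 Y0) (z : Bool) :
    MeasurableSet {ω | Z ω = z} :=
  h.measurable_Z (measurableSet_singleton z)

lemma measurableSet_stratum (h : IsIgnorableStudy P X Z C Y1 Y0) (c : Bool) :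
    MeasurableSet {ω | C ω = c} :=
  h.measurable_C (measurableSet_singleton c)

lemma integrable_Y1 (h : IsIgnorableStudy P X Z C Y1 Y0) : Integrable Y1 P :=
  h.memLp_Y1.integrable one_le_two

lemma integrable_Y0 (h : IsIgnorableStudy P X Z C Y1 Y0) : Integrable Y0 P :=
  h.memLp_Y0.integrable one_le_two

lemma memLp_observed (h : IsIgnorableStudy P X Z C Y1 Y0) :
    MemLp (fun ω => if Z ω then Y1 ω else Y0 ω) 2 P := by
  refine MemLp.of_le (h.memLp_Y1.norm.add h.memLp_Y0.norm)
    (Measurable.ite (h.measurableSet_treatment true) h.measurable_Y1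
      h.measurable_Y0).aestronglyMeasurable (Eventually.of_forall fun ω => ?_)
  rw [Pi.add_apply, Real.norm_of_nonneg (add_nonneg (norm_nonneg _) (norm_nonneg _))]
  split <;> simp

lemma isRegression_restrict_treatment (h : IsIgnorableStudy P X Z C Y1 Y0)
    {G : Bool × ℝ × ℝ → ℝ} (hG : Measurable G)
    (hGi : Integrable (fun ω => G (C ω, Y1 ω, Y0 ω)) P) {f : 𝒳 → ℝ}
    (hf : IsRegression P X (fun ω => G (C ω, Y1 ω, Y0 ω)) f) (z : Bool) :
    IsRegression (P.restrict {ω | Z ω = z}) X (fun ω => G (C ω, Y1 ω, Y0 ω)) f :=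
  hf.restrict_of_condIndepFun h.measurable_X
    (h.measurable_C.prodMk (h.measurable_Y1.prodMk h.measurable_Y0)) h.measurable_Z hG h.ignorable
    hGi (measurableSet_singleton z)

lemma isRegression_indicator_control (h : IsIgnorableStudy P X Z C Y1 Y0)
    (hη : IsTrueNuisance P c X Z C Y1 Y0 η) :
    IsRegression P X ({ω | Z ω = false}.indicator fun _ => 1) (fun x => 1 - η.e x) := by
  refine ((IsRegression.const h.measurable_X 1).sub (integrable_const 1)
    ((integrable_const 1).indicator (h.measurableSet_treatment true))
    hη.isRegression_indicator_treated).congr (Eventually.of_forall fun ω => ?_)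
  cases hω : Z ω <;> simp [hω]

lemma isRegression_mu0 (h : IsIgnorableStudy P X Z C Y1 Y0)
    (hη : IsTrueNuisance P c X Z C Y1 Y0 η) :
    IsRegression (P.restrict {ω | Z ω = false}) X (fun ω => if Z ω then Y1 ω else Y0 ω) η.mu0 :=
  (isRegression_cond_iff h.measurable_X (h.memLp_observed.integrable one_le_two).restrict).1
    hη.mu0_eq

lemma isRegression_pi_mul_mu1 (h : IsIgnorableStudy P X Z C Y1 Y0)
    (hη : IsTrueNuisance P c X Z C Y1 Y0 η) :
    IsRegression P X (fun ω => ind (C ω == c) * Y1 ω) (fun x => η.pi x * η.mu1 x) := by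
  have hprod := hη.isRegression_indicator_stratum.mul_restrict h.measurable_X
    (h.measurableSet_stratum c) h.integrable_Y1.restrict
    ((isRegression_cond_iff h.measurable_X h.integrable_Y1.restrict).1 hη.mu1_eq)
  simpa only [indicator_setOf_eq, mul_comm (η.mu1 _)] using hprod

lemma memLp_mu0 (h : IsIgnorableStudy P X Z C Y1 Y0) (hη : IsTrueNuisance P c X Z C Y1 Y0 η)
    (hpos : IsPositive P X η.e ε) : MemLp (fun ω => η.mu0 (X ω)) 2 P :=
  memLp_of_memLp_restrict h.measurable_X (h.measurableSet_treatment false)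
    (h.isRegression_indicator_control hη) hpos.pos
    (hpos.e_mem.mono fun _ hω => by linarith [hω.2]) (h.isRegression_mu0 hη).measurable
    (((h.memLp_observed.restrict _).condExp one_le_two).ae_eq
      (h.isRegression_mu0 hη).ae_eq_condExp.symm)

lemma memLp_mu1 (h : IsIgnorableStudy P X Z C Y1 Y0) (hη : IsTrueNuisance P c X Z C Y1 Y0 η)
    (hpos : IsPositive P X η.e ε) {B : ℝ}
    (hbdd : ∀ᵐ ω ∂P, |η.mu1 (X ω) - η.mu0 (X ω)| ≤ B) : MemLp (fun ω => η.mu1 (X ω)) 2 P := by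
  have hdiff : MemLp (fun ω => η.mu1 (X ω) - η.mu0 (X ω)) 2 P :=
    MemLp.of_bound ((hη.mu1_eq.measurable.sub hη.mu0_eq.measurable).comp
      h.measurable_X).aestronglyMeasurable B hbdd
  exact (hdiff.add (h.memLp_mu0 hη hpos)).ae_eq (Eventually.of_forall fun _ => sub_add_cancel _ _)

lemma ae_pi_mem (h : IsIgnorableStudy P X Z C Y1 Y0) (hη : IsTrueNuisance P c X Z C Y1 Y0 η) :
    ∀ᵐ ω ∂P, 0 ≤ η.pi (X ω) ∧ η.pi (X ω) ≤ 1 := by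
  have hC : Integrable (fun ω => ind (C ω == c)) P := integrable_ind_beq h.measurable_C c
  exact ((IsRegression.const h.measurable_X 0).ae_le (integrable_const 0) hC hη.pi_eq
    (Eventually.of_forall fun _ => ind_nonneg _)).and
    (hη.pi_eq.ae_le hC (integrable_const 1) (IsRegression.const h.measurable_X 1)
      (Eventually.of_forall fun _ => ind_le_one _))

lemma isAdmissible (h : IsIgnorableStudy P X Z C Y1 Y0) (hη : IsTrueNuisance P c X Z C Y1 Y0 η)
    (hpos : IsPositive P X η.e ε) {B : ℝ}
    (hbdd : ∀ᵐ ω ∂P, |η.mu1 (X ω) - η.mu0 (X ω)| ≤ B) : IsAdmissible (P.map X) η ε where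
  pos := hpos.pos
  measurable_e := hη.e_eq.measurable
  measurable_pi := hη.pi_eq.measurable
  measurable_mu1 := hη.mu1_eq.measurable
  measurable_mu0 := hη.mu0_eq.measurable
  e_mem := (ae_map_iff h.measurable_X.aemeasurable ((measurableSet_le measurable_const
    hη.e_eq.measurable).inter (measurableSet_le hη.e_eq.measurable measurable_const))).2 hpos.e_mem
  pi_mem := (ae_map_iff h.measurable_X.aemeasurable ((measurableSet_le measurable_const
    hη.pi_eq.measurable).inter (measurableSet_le hη.pi_eq.measurable measurable_const))).2
    (h.ae_pi_mem hη)
  memLp_mu1 := (memLp_map_measure_iff hη.mu1_eq.measurable.aestronglyMeasurable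
    h.measurable_X.aemeasurable).2 (h.memLp_mu1 hη hpos hbdd)
  memLp_mu0 := (memLp_map_measure_iff hη.mu0_eq.measurable.aestronglyMeasurable
    h.measurable_X.aemeasurable).2 (h.memLp_mu0 hη hpos)

lemma map_fst_map_observe (h : IsIgnorableStudy P X Z C Y1 Y0) :
    (P.map (observe X Z C Y1 Y0)).map Prod.fst = P.map X :=
  Measure.map_map measurable_fst h.measurable_observe

lemma memLp_outcome (h : IsIgnorableStudy P X Z C Y1 Y0) :
    MemLp outcome 2 (P.map (observe X Z C Y1 Y0)) :=
  (memLp_map_measure_iff measurable_outcome.aestronglyMeasurable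
    h.measurable_observe.aemeasurable).2 h.memLp_observed

lemma observedRegressions (h : IsIgnorableStudy P X Z C Y1 Y0)
    (hη : IsTrueNuisance P c X Z C Y1 Y0 η) :
    ObservedRegressions (P.map (observe X Z C Y1 Y0)) c η.e η.pi
      (fun x => η.pi x * η.mu1 x) η.mu0 := by
  have hO := h.measurable_observe
  have hY := h.memLp_outcome.integrable one_le_two
  have htreated : ∀ᵐ ω ∂P.restrict {ω | Z ω = true}, Z ω = true :=
    ae_restrict_mem (h.measurableSet_treatment true)
  have hstratum := measurable_ind_beq (measurable_fst (α := Bool) (β := ℝ × ℝ)) c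
  have hC : Integrable (fun ω => ind (C ω == c)) P := integrable_ind_beq h.measurable_C c
  refine ⟨?_, ?_, ?_, ?_⟩
  · exact .of_map hO measurable_fst ((integrable_const 1).indicator measurableSet_treated)
      hη.isRegression_indicator_treated
  · refine .restrict_of_map hO measurable_fst measurableSet_treated (integrable_stratum c)
      ((h.isRegression_restrict_treatment hstratum hC hη.pi_eq true).congr ?_)
    filter_upwards [htreated] with ω hω
    simp [observe, stratum, hω]
  · refine .restrict_of_map hO measurable_fst measurableSet_treated
      (integrable_stratum_mul_outcome c hY.restrict)
      ((h.isRegression_restrict_treatment (hstratum.mul measurable_snd.fst)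
        (integrable_ind_beq_mul h.measurable_C c h.integrable_Y1)
        (h.isRegression_pi_mul_mu1 hη) true).congr ?_)
    filter_upwards [htreated] with ω hω
    simp [observe, stratum, outcome, hω]
  · exact .restrict_of_map hO measurable_fst measurableSet_control hY.restrict
      (h.isRegression_mu0 hη)

lemma identified (h : IsIgnorableStudy P X Z C Y1 Y0) (hη : IsTrueNuisance P c X Z C Y1 Y0 η)
    (hpos : IsPositive P X η.e ε) {B : ℝ}
    (hbdd : ∀ᵐ ω ∂P, |η.mu1 (X ω) - η.mu0 (X ω)| ≤ B) :
    Identified (P.map (observe X Z C Y1 Y0)) c η ε :=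
  ⟨h.map_fst_map_observe ▸ h.isAdmissible hη hpos hbdd, h.memLp_outcome,
    h.observedRegressions hη⟩

end IsIgnorableStudy

end FullData

section Identification

variable {Ω 𝒳 : Type*} [MeasurableSpace Ω] [MeasurableSpace 𝒳] {P : Measure Ω}
  [IsFiniteMeasure P] {X : Ω → 𝒳} {Z C : Ω → Bool} {Y1 Y0 : Ω → ℝ} {c : Bool} {η : Nuisance 𝒳}
  {ε : ℝ}

lemma PrincipalIgnorability.exists_isRegression (hPI : PrincipalIgnorability P X C Y0)
    (hX : Measurable X) (hC : Measurable C) (hY0 : Integrable Y0 P) :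
    ∃ g, IsRegression P X Y0 g ∧ ∀ b, IsRegression (P.restrict {ω | C ω = b}) X Y0 g := by
  obtain ⟨g, hg_true, hg_false⟩ := hPI
  rw [isRegression_cond_iff hX hY0.restrict] at hg_true hg_false
  have hcompl : {ω | C ω = false} = {ω | C ω = true}ᶜ := by ext ω; simp
  exact ⟨g, .of_restrict_compl hX (hC (measurableSet_singleton true)) hY0 hg_true
    (hcompl ▸ hg_false), Bool.forall_bool.2 ⟨hg_false, hg_true⟩⟩

lemma IsTrueNuisance.integral_pi (hη : IsTrueNuisance P c X Z C Y1 Y0 η) (hX : Measurable X)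
    (hC : Measurable C) : ∫ ω, η.pi (X ω) ∂P = P.real {ω | C ω = c} := by
  rw [hη.isRegression_indicator_stratum.integral_eq hX]
  exact integral_indicator_one (hC (measurableSet_singleton c))

namespace IsIgnorableStudy

variable [StandardBorelSpace Ω]

lemma isRegression_Y0_mu0 (h : IsIgnorableStudy P X Z C Y1 Y0)
    (hη : IsTrueNuisance P c X Z C Y1 Y0 η) (hpos : IsPositive P X η.e ε) :
    IsRegression P X Y0 η.mu0 := by
  obtain ⟨g, hg⟩ := PrincipalStrat.exists_isRegression P X Y0
  have hg_control := h.isRegression_restrict_treatment measurable_snd.snd h.integrable_Y0 hg false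
  have hmu0 : IsRegression (P.restrict {ω | Z ω = false}) X Y0 η.mu0 := by
    refine (h.isRegression_mu0 hη).congr ?_
    filter_upwards [ae_restrict_mem (h.measurableSet_treatment false)] with ω (hω : Z ω = false)
    simp [hω]
  exact hg.congr_fun hη.mu0_eq.measurable (ae_of_ae_restrict h.measurable_X
    (h.measurableSet_treatment false) (h.isRegression_indicator_control hη) hpos.pos
    (hpos.e_mem.mono fun _ hω => by linarith [hω.2])
    (measurableSet_eq_fun hg.measurable hη.mu0_eq.measurable) (hg_control.ae_eq hmu0))

lemma integral_pi_mul_mu1 (h : IsIgnorableStudy P X Z C Y1 Y0)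
    (hη : IsTrueNuisance P c X Z C Y1 Y0 η) :
    ∫ ω, η.pi (X ω) * η.mu1 (X ω) ∂P = ∫ ω in {ω | C ω = c}, Y1 ω ∂P := by
  rw [(h.isRegression_pi_mul_mu1 hη).integral_eq h.measurable_X,
    ← integral_indicator (h.measurableSet_stratum c), indicator_setOf_eq]

lemma isRegression_pi_mul_mu0 (h : IsIgnorableStudy P X Z C Y1 Y0)
    (hη : IsTrueNuisance P c X Z C Y1 Y0 η) (hpos : IsPositive P X η.e ε)
    (hPI : PrincipalIgnorability P X C Y0) :
    IsRegression P X ({ω | C ω = c}.indicator Y0) (fun x => η.mu0 x * η.pi x) := by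
  obtain ⟨g, hg, hgC⟩ := hPI.exists_isRegression h.measurable_X h.measurable_C h.integrable_Y0
  refine (IsRegression.mul_restrict h.measurable_X (h.measurableSet_stratum c)
    hη.isRegression_indicator_stratum h.integrable_Y0.restrict (hgC c)).congr_fun
    (hη.mu0_eq.measurable.mul hη.pi_eq.measurable) ?_
  filter_upwards [hg.ae_eq (h.isRegression_Y0_mu0 hη hpos)] with ω hω
  rw [hω]

theorem delta_eq_of_principalIgnorability (h : IsIgnorableStudy P X Z C Y1 Y0)
    (hη : IsTrueNuisance P c X Z C Y1 Y0 η) (hpos : IsPositive P X η.e ε)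
    (hPI : PrincipalIgnorability P X C Y0) :
    delta P c C Y1 Y0 =
      (∫ ω, η.pi (X ω) * (η.mu1 (X ω) - η.mu0 (X ω)) ∂P) / ∫ ω, η.pi (X ω) ∂P := by
  have hmu1 := (h.isRegression_pi_mul_mu1 hη).integrable_comp
  have hmu0 := h.isRegression_pi_mul_mu0 hη hpos hPI
  have hnum : ∫ ω, η.pi (X ω) * (η.mu1 (X ω) - η.mu0 (X ω)) ∂P
      = ∫ ω in {ω | C ω = c}, (Y1 ω - Y0 ω) ∂P := by
    rw [integral_sub h.integrable_Y1.restrict h.integrable_Y0.restrict,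
      ← integral_indicator (h.measurableSet_stratum c) (f := Y0),
      ← hmu0.integral_eq h.measurable_X, ← h.integral_pi_mul_mu1 hη,
      ← integral_sub hmu1 hmu0.integrable_comp]
    exact integral_congr_ae (Eventually.of_forall fun ω => by ring)
  rw [hnum, hη.integral_pi h.measurable_X h.measurable_C, delta, ProbabilityTheory.cond,
    integral_smul_measure, smul_eq_mul, ENNReal.toReal_inv, div_eq_inv_mul, Measure.real]

end IsIgnorableStudy

end Identification

section AugmentedInverseProbabilityWeighting

variable {Ω 𝒳 : Type*}

/-- The augmented inverse probability weighted variable for the mean of `W` given the subgroup `T`,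
with outcome model `f` and with model `r` for the conditional probability of `T` given `X`. -/
noncomputable def aipw (T : Set Ω) (X : Ω → 𝒳) (r f : 𝒳 → ℝ) (W : Ω → ℝ) (ω : Ω) : ℝ :=
  T.indicator (fun ω => (W ω - f (X ω)) / r (X ω)) ω + f (X ω)

variable [MeasurableSpace Ω] [MeasurableSpace 𝒳] {μ : Measure Ω} {T : Set Ω} {X : Ω → 𝒳}
  {r r' f f' : 𝒳 → ℝ} {W : Ω → ℝ} {κ : ℝ}

lemma memLp_sub_div {q : ℝ≥0∞} (hX : Measurable X) (hr : Measurable r) (hκ : 0 < κ)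
    (hrκ : ∀ᵐ ω ∂μ, κ ≤ r (X ω)) (hW : MemLp W q μ) (hf : MemLp (fun ω => f (X ω)) q μ) :
    MemLp (fun ω => (W ω - f (X ω)) / r (X ω)) q μ := by
  refine (hW.sub hf).of_le_mul (c := κ⁻¹) ((hW.1.sub hf.1).div₀
    (hr.comp hX).aestronglyMeasurable) (hrκ.mono fun ω hω => ?_)
  rw [norm_div, div_eq_inv_mul, Real.norm_of_nonneg (hκ.le.trans hω)]
  exact mul_le_mul_of_nonneg_right (inv_anti₀ hκ hω) (norm_nonneg _)

lemma memLp_aipw {q : ℝ≥0∞} (hX : Measurable X) (hT : MeasurableSet T) (hr : Measurable r)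
    (hκ : 0 < κ) (hrκ : ∀ᵐ ω ∂μ, κ ≤ r (X ω)) (hW : MemLp W q μ)
    (hf : MemLp (fun ω => f (X ω)) q μ) : MemLp (aipw T X r f W) q μ :=
  ((memLp_sub_div hX hr hκ hrκ hW hf).indicator hT).add hf

lemma isRegression_aipw [IsFiniteMeasure μ] (hX : Measurable X) (hT : MeasurableSet T)
    (hr' : Measurable r') (hκ : 0 < κ) (hrκ : ∀ᵐ ω ∂μ, κ ≤ r' (X ω)) (hW : Integrable W μ)
    (hf' : Measurable f') (hf'i : Integrable (fun ω => f' (X ω)) μ)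
    (hr : IsRegression μ X (T.indicator fun _ => 1) r) (hf : IsRegression (μ.restrict T) X W f) :
    IsRegression μ X (aipw T X r' f' W)
      (fun x => f x + (r x - r' x) / r' x * (f x - f' x)) := by
  have hdiv : Integrable (fun ω => (W ω - f' (X ω)) / r' (X ω)) μ :=
    memLp_one_iff_integrable.1 (memLp_sub_div hX hr' hκ hrκ (memLp_one_iff_integrable.2 hW)
      (memLp_one_iff_integrable.2 hf'i))
  have hsub := hf.sub hW.restrict hf'i.restrict (.comp hX hf' hf'i.restrict)
  have hsum := (IsRegression.mul_restrict hX hT hr hdiv.restrict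
    (hsub.div hr' (hW.sub hf'i).restrict hdiv.restrict)).add (hdiv.indicator hT) hf'i
    (.comp hX hf' hf'i)
  refine hsum.congr_fun (hf.measurable.add (((hr.measurable.sub hr').div hr').mul
    (hf.measurable.sub hf'))) (hrκ.mono fun ω hω => ?_)
  have hr'0 : r' (X ω) ≠ 0 := (hκ.trans_le hω).ne'
  field_simp
  ring

end AugmentedInverseProbabilityWeighting

section Scores

variable {𝒳 : Type*} {c : Bool} {a b : ℝ} {η ξ : Nuisance 𝒳}

/-- The linear combination `a (φ₁ - φ₀) + b φ_π` of the estimating functions. -/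
noncomputable def score (c : Bool) (a b : ℝ) (η : Nuisance 𝒳) (o : Obs 𝒳) : ℝ :=
  a * (phiNu1 c η o - phiNu0 c η o) + b * phiPi c η o

lemma phiDelta_eq_score (c : Bool) (η : Nuisance 𝒳) (piBar Δ : ℝ) :
    phiDelta c η piBar Δ = score c piBar⁻¹ (-Δ * piBar⁻¹) η := by
  ext o
  simp only [phiDelta, score]
  ring

lemma indicator_treated (F : Obs 𝒳 → ℝ) (o : Obs 𝒳) :
    (treated 𝒳).indicator F o = ind o.2.1 * F o := by
  by_cases h : o.2.1 = true <;> simp [treated, Set.indicator, h, ind]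

lemma indicator_control (F : Obs 𝒳 → ℝ) (o : Obs 𝒳) :
    (control 𝒳).indicator F o = (1 - ind o.2.1) * F o := by
  by_cases h : o.2.1 = true <;> simp [control, Set.indicator, h, ind]

lemma phiPi_eq_aipw (c : Bool) (η : Nuisance 𝒳) (o : Obs 𝒳) :
    phiPi c η o = aipw (treated 𝒳) Prod.fst η.e η.pi (stratum c) o := by
  simp only [phiPi, aipw, indicator_treated, stratum]
  ring

lemma phiNu1_eq_aipw (c : Bool) (η : Nuisance 𝒳) (o : Obs 𝒳) :
    phiNu1 c η o = aipw (treated 𝒳) Prod.fst η.e (fun x => η.pi x * η.mu1 x)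
      (fun o => stratum c o * outcome o) o := by
  simp only [phiNu1, aipw, indicator_treated, stratum, outcome]
  ring

lemma phiNu0_eq_aipw (c : Bool) (η : Nuisance 𝒳) (o : Obs 𝒳) :
    phiNu0 c η o
      = η.pi o.1 * aipw (control 𝒳) Prod.fst (fun x => 1 - η.e x) η.mu0 outcome o
        + η.mu0 o.1 * aipw (treated 𝒳) Prod.fst η.e η.pi (stratum c) o
        - η.pi o.1 * η.mu0 o.1 := by
  simp only [phiNu0, aipw, indicator_treated, indicator_control, stratum, outcome]
  ring

/-- The difference between the regressions of `score c a b ξ` and of the true score, in terms of the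
regression functions `e`, `p`, `q` and `m` of the observed data. Every term is a product of two
errors. -/
noncomputable def scoreBias (a b : ℝ) (e p q m : 𝒳 → ℝ) (ξ : Nuisance 𝒳) (x : 𝒳) : ℝ :=
  (e x - ξ.e x) / ξ.e x
      * (a * (q x - ξ.pi x * ξ.mu1 x - ξ.mu0 x * (p x - ξ.pi x)) + b * (p x - ξ.pi x))
    + a * (ξ.pi x * ((e x - ξ.e x) / (1 - ξ.e x)) * (m x - ξ.mu0 x)
      + (p x - ξ.pi x) * (m x - ξ.mu0 x))

lemma scoreBias_self (a b : ℝ) (η : Nuisance 𝒳) (x : 𝒳) :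
    scoreBias a b η.e η.pi (fun x => η.pi x * η.mu1 x) η.mu0 η x = 0 := by
  simp [scoreBias]

variable [MeasurableSpace 𝒳] {ρ : Measure (Obs 𝒳)} {κ : ℝ}

namespace IsAdmissible

lemma ae_le_e (hξ : IsAdmissible (ρ.map Prod.fst) ξ κ) : ∀ᵐ o ∂ρ, κ ≤ ξ.e o.1 :=
  ae_of_ae_map measurable_fst.aemeasurable (hξ.e_mem.mono fun _ hx => hx.1)

lemma ae_le_one_sub_e (hξ : IsAdmissible (ρ.map Prod.fst) ξ κ) : ∀ᵐ o ∂ρ, κ ≤ 1 - ξ.e o.1 :=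
  (ae_of_ae_map measurable_fst.aemeasurable hξ.e_mem).mono fun _ ho => by linarith [ho.2]

lemma memLp_top_pi (hξ : IsAdmissible (ρ.map Prod.fst) ξ κ) :
    MemLp (fun o : Obs 𝒳 => ξ.pi o.1) ∞ ρ :=
  memLp_top_of_bound (hξ.measurable_pi.comp measurable_fst).aestronglyMeasurable 1
    ((ae_of_ae_map measurable_fst.aemeasurable hξ.pi_mem).mono fun o ho => by
      rw [Real.norm_of_nonneg ho.1]
      exact ho.2)

lemma memLp_mu1_comp (hξ : IsAdmissible (ρ.map Prod.fst) ξ κ) :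
    MemLp (fun o : Obs 𝒳 => ξ.mu1 o.1) 2 ρ :=
  hξ.memLp_mu1.comp_of_map measurable_fst.aemeasurable

lemma memLp_mu0_comp (hξ : IsAdmissible (ρ.map Prod.fst) ξ κ) :
    MemLp (fun o : Obs 𝒳 => ξ.mu0 o.1) 2 ρ :=
  hξ.memLp_mu0.comp_of_map measurable_fst.aemeasurable

lemma memLp_pi_mul_mu1 (hξ : IsAdmissible (ρ.map Prod.fst) ξ κ) :
    MemLp (fun o : Obs 𝒳 => ξ.pi o.1 * ξ.mu1 o.1) 2 ρ :=
  hξ.memLp_mu1_comp.mul hξ.memLp_top_pi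

lemma memLp_pi_mul_mu0 (hξ : IsAdmissible (ρ.map Prod.fst) ξ κ) :
    MemLp (fun o : Obs 𝒳 => ξ.pi o.1 * ξ.mu0 o.1) 2 ρ :=
  hξ.memLp_mu0_comp.mul hξ.memLp_top_pi

lemma memLp_top_aipw_stratum (hξ : IsAdmissible (ρ.map Prod.fst) ξ κ) (c : Bool) :
    MemLp (aipw (treated 𝒳) Prod.fst ξ.e ξ.pi (stratum c)) ∞ ρ :=
  memLp_aipw measurable_fst measurableSet_treated hξ.measurable_e hξ.pos hξ.ae_le_e
    (memLp_top_stratum c) hξ.memLp_top_pi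

lemma memLp_aipw_stratum_mul_outcome (hξ : IsAdmissible (ρ.map Prod.fst) ξ κ) (c : Bool)
    (hY : MemLp outcome 2 ρ) :
    MemLp (aipw (treated 𝒳) Prod.fst ξ.e (fun x => ξ.pi x * ξ.mu1 x)
      fun o => stratum c o * outcome o) 2 ρ :=
  memLp_aipw measurable_fst measurableSet_treated hξ.measurable_e hξ.pos hξ.ae_le_e
    (hY.mul (memLp_top_stratum c)) hξ.memLp_pi_mul_mu1

lemma memLp_aipw_outcome (hξ : IsAdmissible (ρ.map Prod.fst) ξ κ) (hY : MemLp outcome 2 ρ) :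
    MemLp (aipw (control 𝒳) Prod.fst (fun x => 1 - ξ.e x) ξ.mu0 outcome) 2 ρ :=
  memLp_aipw measurable_fst measurableSet_control (hξ.measurable_e.const_sub 1) hξ.pos
    hξ.ae_le_one_sub_e hY hξ.memLp_mu0_comp

lemma memLp_phiNu1 (hξ : IsAdmissible (ρ.map Prod.fst) ξ κ) (c : Bool) (hY : MemLp outcome 2 ρ) :
    MemLp (phiNu1 c ξ) 2 ρ := by
  rw [funext (phiNu1_eq_aipw c ξ)]
  exact hξ.memLp_aipw_stratum_mul_outcome c hY

lemma memLp_phiNu0 (hξ : IsAdmissible (ρ.map Prod.fst) ξ κ) (c : Bool) (hY : MemLp outcome 2 ρ) :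
    MemLp (phiNu0 c ξ) 2 ρ := by
  rw [funext (phiNu0_eq_aipw c ξ)]
  exact (((hξ.memLp_aipw_outcome hY).mul hξ.memLp_top_pi).add
    ((hξ.memLp_top_aipw_stratum c).mul hξ.memLp_mu0_comp)).sub hξ.memLp_pi_mul_mu0

variable [IsFiniteMeasure ρ]

lemma memLp_phiPi (hξ : IsAdmissible (ρ.map Prod.fst) ξ κ) (c : Bool) : MemLp (phiPi c ξ) 2 ρ := by
  rw [funext (phiPi_eq_aipw c ξ)]
  exact (hξ.memLp_top_aipw_stratum c).mono_exponent le_top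

lemma memLp_score (hξ : IsAdmissible (ρ.map Prod.fst) ξ κ) (c : Bool) (a b : ℝ)
    (hY : MemLp outcome 2 ρ) : MemLp (score c a b ξ) 2 ρ :=
  (((hξ.memLp_phiNu1 c hY).sub (hξ.memLp_phiNu0 c hY)).const_mul a).add
    ((hξ.memLp_phiPi c).const_mul b)

variable {e p q m : 𝒳 → ℝ}

lemma isRegression_phiPi (hξ : IsAdmissible (ρ.map Prod.fst) ξ κ)
    (h : ObservedRegressions ρ c e p q m) :
    IsRegression ρ Prod.fst (phiPi c ξ)
      (fun x => p x + (e x - ξ.e x) / ξ.e x * (p x - ξ.pi x)) := by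
  rw [funext (phiPi_eq_aipw c ξ)]
  exact isRegression_aipw measurable_fst measurableSet_treated hξ.measurable_e hξ.pos hξ.ae_le_e
    (integrable_stratum c) hξ.measurable_pi (hξ.memLp_top_pi.integrable le_top) h.reg_treated
    h.reg_stratum

lemma isRegression_phiNu1 (hξ : IsAdmissible (ρ.map Prod.fst) ξ κ) (hY : MemLp outcome 2 ρ)
    (h : ObservedRegressions ρ c e p q m) :
    IsRegression ρ Prod.fst (phiNu1 c ξ)
      (fun x => q x + (e x - ξ.e x) / ξ.e x * (q x - ξ.pi x * ξ.mu1 x)) := by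
  rw [funext (phiNu1_eq_aipw c ξ)]
  exact isRegression_aipw measurable_fst measurableSet_treated hξ.measurable_e hξ.pos hξ.ae_le_e
    (integrable_stratum_mul_outcome c (hY.integrable one_le_two))
    (hξ.measurable_pi.mul hξ.measurable_mu1) (hξ.memLp_pi_mul_mu1.integrable one_le_two)
    h.reg_treated h.reg_stratum_mul_outcome

lemma isRegression_phiNu0 (hξ : IsAdmissible (ρ.map Prod.fst) ξ κ) (hY : MemLp outcome 2 ρ)
    (h : ObservedRegressions ρ c e p q m) :
    IsRegression ρ Prod.fst (phiNu0 c ξ) (fun x =>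
      ξ.pi x * (m x + ((1 - e x) - (1 - ξ.e x)) / (1 - ξ.e x) * (m x - ξ.mu0 x))
        + ξ.mu0 x * (p x + (e x - ξ.e x) / ξ.e x * (p x - ξ.pi x)) - ξ.pi x * ξ.mu0 x) := by
  have hreg_outcome := isRegression_aipw measurable_fst measurableSet_control
    (hξ.measurable_e.const_sub 1) hξ.pos hξ.ae_le_one_sub_e (hY.integrable one_le_two)
    hξ.measurable_mu0 (hξ.memLp_mu0_comp.integrable one_le_two)
    (isRegression_indicator_control h.reg_treated) h.reg_outcome
  have hreg_stratum := hξ.isRegression_phiPi h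
  rw [funext (phiPi_eq_aipw c ξ)] at hreg_stratum
  have hpiY := ((hξ.memLp_aipw_outcome hY).mul hξ.memLp_top_pi).integrable one_le_two
  have hmuS := ((hξ.memLp_top_aipw_stratum c).mul hξ.memLp_mu0_comp (r := 2)).integrable one_le_two
  have hpimu := hξ.memLp_pi_mul_mu0.integrable one_le_two
  rw [funext (phiNu0_eq_aipw c ξ)]
  exact ((hreg_outcome.mul hξ.measurable_pi ((hξ.memLp_aipw_outcome hY).integrable one_le_two)
    hpiY).add hpiY hmuS (hreg_stratum.mul hξ.measurable_mu0
      ((hξ.memLp_top_aipw_stratum c).integrable le_top) hmuS)).sub (hpiY.add hmuS) hpimu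
    (.comp measurable_fst (hξ.measurable_pi.mul hξ.measurable_mu0) hpimu)

theorem isRegression_score (hξ : IsAdmissible (ρ.map Prod.fst) ξ κ) (hY : MemLp outcome 2 ρ)
    (h : ObservedRegressions ρ c e p q m) (a b : ℝ) :
    IsRegression ρ Prod.fst (score c a b ξ)
      (fun x => a * (q x - p x * m x) + b * p x + scoreBias a b e p q m ξ x) := by
  have hphi1 := (hξ.memLp_phiNu1 c hY).integrable one_le_two
  have hphi0 := (hξ.memLp_phiNu0 c hY).integrable one_le_two
  have hphiPi := (hξ.memLp_phiPi c).integrable one_le_two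
  have hreg := (((hξ.isRegression_phiNu1 hY h).sub hphi1 hphi0
    (hξ.isRegression_phiNu0 hY h)).const_mul a).add ((hphi1.sub hphi0).const_mul a)
    (hphiPi.const_mul b) ((hξ.isRegression_phiPi h).const_mul b)
  convert hreg using 1
  · rfl
  · ext x
    simp only [scoreBias]
    ring

end IsAdmissible

end Scores

section PathDerivative

lemma hasDerivAt_of_abs_sub_le_sq {N : ℝ → ℝ} {a b K δ : ℝ} (hδ : 0 < δ)
    (h : ∀ t, |t| ≤ δ → |N t - (a + t * b)| ≤ K * t ^ 2) : HasDerivAt N b 0 := by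
  have hzero : N 0 = a := by
    simpa [sub_eq_zero] using h 0 (by simpa using hδ.le)
  have hnear : ∀ᶠ t : ℝ in 𝓝 0, |t| ≤ δ := by
    simpa [Metric.closedBall, Real.dist_eq, Filter.Eventually] using
      Metric.closedBall_mem_nhds (0 : ℝ) hδ
  have hbigO : (fun t => N t - N 0 - (t - 0) • b) =O[𝓝 0] fun t : ℝ => t ^ 2 := by
    refine Asymptotics.IsBigO.of_bound K (hnear.mono fun t ht => ?_)
    rw [hzero, sub_zero, smul_eq_mul, sub_sub, Real.norm_eq_abs, Real.norm_of_nonneg (sq_nonneg t)]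
    exact h t ht
  refine hasDerivAt_iff_isLittleO.2 (hbigO.trans_isLittleO ?_)
  simpa only [sub_zero, pow_one] using Asymptotics.isLittleO_pow_pow (𝕜 := ℝ) one_lt_two

lemma abs_scoreBias_le {𝒳 : Type*} {a b κ δ F₁ F₀ : ℝ} {e p q m : 𝒳 → ℝ} {ξ : Nuisance 𝒳} {x : 𝒳}
    (hκ : 0 < κ) (he : κ ≤ ξ.e x ∧ ξ.e x ≤ 1 - κ) (hpi : 0 ≤ ξ.pi x ∧ ξ.pi x ≤ 1)
    (hδe : |e x - ξ.e x| ≤ δ) (hδp : |p x - ξ.pi x| ≤ δ)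
    (hδq : |q x - ξ.pi x * ξ.mu1 x| ≤ δ * F₁) (hδm : |m x - ξ.mu0 x| ≤ δ * F₀) :
    |scoreBias a b e p q m ξ x|
      ≤ δ ^ 2 * (κ⁻¹ * (|a| * (F₁ + |ξ.mu0 x|) + |b|) + |a| * ((κ⁻¹ + 1) * F₀)) := by
  have hδ : 0 ≤ δ := (abs_nonneg _).trans hδe
  have hdiv : ∀ r, κ ≤ r → |(e x - ξ.e x) / r| ≤ δ * κ⁻¹ := fun r hr => by
    rw [abs_div, abs_of_pos (hκ.trans_le hr), div_eq_mul_inv]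
    exact mul_le_mul hδe (inv_anti₀ hκ hr) (inv_nonneg.2 (hκ.le.trans hr)) hδ
  have hcontrast : |a * (q x - ξ.pi x * ξ.mu1 x - ξ.mu0 x * (p x - ξ.pi x)) + b * (p x - ξ.pi x)|
      ≤ δ * (|a| * (F₁ + |ξ.mu0 x|) + |b|) := calc
    _ ≤ |a| * (|q x - ξ.pi x * ξ.mu1 x| + |ξ.mu0 x| * |p x - ξ.pi x|)
        + |b| * |p x - ξ.pi x| := by
      refine (abs_add_le _ _).trans ?_
      rw [abs_mul, abs_mul b, ← abs_mul (ξ.mu0 x)]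
      gcongr
      exact abs_sub _ _
    _ ≤ |a| * (δ * F₁ + |ξ.mu0 x| * δ) + |b| * δ := by gcongr
    _ = _ := by ring
  have hoverlap : |ξ.pi x * ((e x - ξ.e x) / (1 - ξ.e x)) * (m x - ξ.mu0 x)
      + (p x - ξ.pi x) * (m x - ξ.mu0 x)| ≤ δ * (κ⁻¹ + 1) * (δ * F₀) := by
    rw [← add_mul, abs_mul]
    refine mul_le_mul ?_ hδm (abs_nonneg _) (by positivity)
    calc |ξ.pi x * ((e x - ξ.e x) / (1 - ξ.e x)) + (p x - ξ.pi x)|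
        ≤ |ξ.pi x| * |(e x - ξ.e x) / (1 - ξ.e x)| + |p x - ξ.pi x| :=
          (abs_add_le _ _).trans_eq (by rw [abs_mul])
      _ ≤ 1 * (δ * κ⁻¹) + δ := by
          rw [abs_of_nonneg hpi.1]
          gcongr
          exacts [hpi.2, hdiv _ (by linarith [he.2])]
      _ = δ * (κ⁻¹ + 1) := by ring
  calc |scoreBias a b e p q m ξ x|
      ≤ δ * κ⁻¹ * (δ * (|a| * (F₁ + |ξ.mu0 x|) + |b|)) + |a| * (δ * (κ⁻¹ + 1) * (δ * F₀)) := by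
        refine (abs_add_le _ _).trans (add_le_add ?_ ?_)
        · rw [abs_mul]
          exact mul_le_mul (hdiv _ he.1) hcontrast (abs_nonneg _) (by positivity)
        · rw [abs_mul]
          exact mul_le_mul_of_nonneg_left hoverlap (abs_nonneg a)
    _ = _ := by ring

end PathDerivative

section Functional

variable {𝒳 : Type*} [m𝒳 : MeasurableSpace 𝒳] {ρ : Measure (Obs 𝒳)}

lemma exists_observedRegressions_deltaPI_eq [IsFiniteMeasure ρ] (c : Bool)
    (hY : Integrable outcome ρ) : ∃ e p q m : 𝒳 → ℝ, ObservedRegressions ρ c e p q m ∧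
      deltaPI c ρ = (∫ o, (q o.1 - p o.1 * m o.1) ∂ρ) / ∫ o, p o.1 ∂ρ := by
  obtain ⟨e, he⟩ := exists_isRegression ρ Prod.fst ((treated 𝒳).indicator fun _ => 1)
  obtain ⟨p, hp, hp_eq⟩ := exists_comp_eq_condExp (ProbabilityTheory.cond ρ (treated 𝒳)) Prod.fst
    (stratum c)
  obtain ⟨m1, hm1, hm1_eq⟩ := exists_comp_eq_condExp
    (ProbabilityTheory.cond ρ {o | o.2.1 = true ∧ o.2.2.1 = c}) Prod.fst (outcome (𝒳 := 𝒳))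
  obtain ⟨m, hm, hm_eq⟩ := exists_comp_eq_condExp (ProbabilityTheory.cond ρ (control 𝒳)) Prod.fst
    (outcome (𝒳 := 𝒳))
  have hstratum : MeasurableSet {o : Obs 𝒳 | o.2.2.1 = c} :=
    measurable_snd.snd.fst (measurableSet_singleton c)
  have hp_reg := (isRegression_cond_iff measurable_fst (integrable_stratum c).restrict).1
    ⟨hp, hp_eq.eventuallyEq⟩
  have hm_reg := (isRegression_cond_iff measurable_fst hY.restrict).1 ⟨hm, hm_eq.eventuallyEq⟩
  have hm1_reg := (isRegression_cond_iff measurable_fst hY.restrict).1 ⟨hm1, hm1_eq.eventuallyEq⟩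
  have hset : {o : Obs 𝒳 | o.2.1 = true ∧ o.2.2.1 = c} = {o | o.2.2.1 = c} ∩ treated 𝒳 :=
    Set.inter_comm _ _
  rw [hset, ← Measure.restrict_restrict hstratum] at hm1_reg
  have hp_ind : IsRegression (ρ.restrict (treated 𝒳)) Prod.fst
      ({o | o.2.2.1 = c}.indicator fun _ => 1) p := by
    rw [indicator_setOf_eq]
    simp only [mul_one]
    exact hp_reg
  have hq_reg := hp_ind.mul_restrict measurable_fst hstratum hY.restrict.restrict hm1_reg
  rw [indicator_setOf_eq] at hq_reg
  refine ⟨e, p, _, m, ⟨he, hp_reg, hq_reg, hm_reg⟩, ?_⟩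
  change (∫ o, (ρ[|treated 𝒳])[stratum c | m𝒳.comap Prod.fst] o
      * ((ρ[|{o | o.2.1 = true ∧ o.2.2.1 = c}])[outcome | m𝒳.comap Prod.fst] o
        - (ρ[|control 𝒳])[outcome | m𝒳.comap Prod.fst] o) ∂ρ)
    / ∫ o, (ρ[|treated 𝒳])[stratum c | m𝒳.comap Prod.fst] o ∂ρ = _
  simp only [← hp_eq, ← hm1_eq, ← hm_eq, mul_sub, mul_comm]

end Functional

section Perturbation

variable {Ω 𝒳 : Type*} [MeasurableSpace Ω] [MeasurableSpace 𝒳] {μ : Measure Ω} {X : Ω → 𝒳}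
  {W V g : Ω → ℝ} {τ κ : ℝ}

lemma IsRegression.abs_sub_le_of_restrict_withDensity [IsFiniteMeasure μ] (hX : Measurable X)
    {T : Set Ω} (hT : MeasurableSet T) {r : 𝒳 → ℝ}
    (hr : IsRegression μ X (T.indicator fun _ => 1) r) (hκ : 0 < κ)
    (hrκ : ∀ᵐ ω ∂μ, κ ≤ r (X ω)) (hW : Integrable W μ) (hV : Integrable V μ)
    (hWV : ∀ᵐ ω ∂μ, |W ω| ≤ V ω) (hg : Measurable g) (hτ : τ ≤ 1 / 2)
    (hgτ : ∀ ω, |g ω - 1| ≤ τ) {f f' F : 𝒳 → ℝ} (hf : IsRegression (μ.restrict T) X W f)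
    (hF : IsRegression (μ.restrict T) X V F)
    (hf' : IsRegression ((μ.withDensity fun ω => ENNReal.ofReal (g ω)).restrict T) X W f') :
    ∀ᵐ ω ∂μ, |f' (X ω) - f (X ω)| ≤ 4 * τ * F (X ω) := by
  rw [restrict_withDensity hT] at hf'
  exact ae_of_ae_restrict hX hT hr hκ hrκ (measurableSet_le (hf'.measurable.sub hf.measurable).abs
    (hF.measurable.const_mul _)) (hf.abs_sub_le_of_withDensity hX hW.restrict hV.restrict
      (ae_restrict_of_ae hWV) hg hτ hgτ hF hf')

lemma exists_isRegression_restrict_abs [IsFiniteMeasure μ] (hX : Measurable X) {T : Set Ω}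
    (hT : MeasurableSet T) {r : 𝒳 → ℝ} (hr : IsRegression μ X (T.indicator fun _ => 1) r)
    (hκ : 0 < κ) (hrκ : ∀ᵐ ω ∂μ, κ ≤ r (X ω)) (W : Ω → ℝ) :
    ∃ F : 𝒳 → ℝ, IsRegression (μ.restrict T) X (fun ω => |W ω|) F ∧
      Integrable (fun ω => F (X ω)) μ := by
  obtain ⟨F, hF⟩ := exists_isRegression (μ.restrict T) X fun ω => |W ω|
  exact ⟨F, hF, memLp_one_iff_integrable.1 (memLp_of_memLp_restrict hX hT hr hκ hrκ hF.measurable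
    (memLp_one_iff_integrable.2 hF.integrable_comp))⟩

lemma IsAdmissible.of_le_smul {ν ν' : Measure 𝒳} {ξ : Nuisance 𝒳} (h : IsAdmissible ν ξ κ)
    {a : ℝ≥0∞} (ha : a ≠ ∞) (hν : ν' ≤ a • ν) : IsAdmissible ν' ξ κ where
  pos := h.pos
  measurable_e := h.measurable_e
  measurable_pi := h.measurable_pi
  measurable_mu1 := h.measurable_mu1
  measurable_mu0 := h.measurable_mu0
  e_mem := (Measure.absolutelyContinuous_of_le_smul hν).ae_le h.e_mem
  pi_mem := (Measure.absolutelyContinuous_of_le_smul hν).ae_le h.pi_mem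
  memLp_mu1 := h.memLp_mu1.of_measure_le_smul ha hν
  memLp_mu0 := h.memLp_mu0.of_measure_le_smul ha hν

end Perturbation

section Expansion

variable {𝒳 : Type*} [MeasurableSpace 𝒳] {ρ : Measure (Obs 𝒳)} [IsFiniteMeasure ρ] {c : Bool}
  {η : Nuisance 𝒳} {ε : ℝ}

lemma Identified.exists_abs_scoreBias_le (h : Identified ρ c η ε) (a b : ℝ) :
    ∃ H : 𝒳 → ℝ, Integrable (fun o => H o.1) ρ ∧
      ∀ (g : Obs 𝒳 → ℝ) (τ : ℝ), Measurable g → τ ≤ 1 / 2 → (∀ o, |g o - 1| ≤ τ) →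
      ∀ e p q m : 𝒳 → ℝ,
      ObservedRegressions (ρ.withDensity fun o => ENNReal.ofReal (g o)) c e p q m →
      ∀ᵐ o ∂ρ, |scoreBias a b e p q m η o.1| ≤ τ ^ 2 * H o.1 := by
  obtain ⟨hη, hY_sq, he, hp, hq, hm⟩ := h
  have hY := hY_sq.integrable one_le_two
  have hSY := integrable_stratum_mul_outcome c hY
  have hcontrol := isRegression_indicator_control he
  obtain ⟨F₁, hF₁, hF₁i⟩ := exists_isRegression_restrict_abs measurable_fst measurableSet_treated
    he hη.pos hη.ae_le_e fun o => stratum c o * outcome o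
  obtain ⟨F₀, hF₀, hF₀i⟩ := exists_isRegression_restrict_abs measurable_fst measurableSet_control
    hcontrol hη.pos hη.ae_le_one_sub_e outcome
  refine ⟨fun x => 4 ^ 2 * (ε⁻¹ * (|a| * (F₁ x + |η.mu0 x|) + |b|) + |a| * ((ε⁻¹ + 1) * F₀ x)),
    ?_, fun g τ hg hτ hgτ e p q m h' => ?_⟩
  · have hmu0 := (hη.memLp_mu0_comp.integrable one_le_two).abs
    exact (((((hF₁i.add hmu0).const_mul |a|).add (integrable_const |b|)).const_mul ε⁻¹).add
      ((hF₀i.const_mul (ε⁻¹ + 1)).const_mul |a|)).const_mul (4 ^ 2)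
  have hδe := he.abs_sub_le_of_withDensity measurable_fst
    ((integrable_const 1).indicator measurableSet_treated) (integrable_const 1)
    (Eventually.of_forall fun o => by by_cases ho : o ∈ treated 𝒳 <;> simp [ho]) hg hτ hgτ
    (.const measurable_fst 1) h'.reg_treated
  have hδp := he.abs_sub_le_of_restrict_withDensity measurable_fst measurableSet_treated hη.pos
    hη.ae_le_e (integrable_stratum c) (integrable_const 1)
    (Eventually.of_forall fun _ => norm_ind_le_one _) hg hτ hgτ hp (.const measurable_fst 1)
    h'.reg_stratum
  have hδq := he.abs_sub_le_of_restrict_withDensity measurable_fst measurableSet_treated hη.pos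
    hη.ae_le_e hSY hSY.abs (Eventually.of_forall fun _ => le_rfl) hg hτ hgτ hq hF₁
    h'.reg_stratum_mul_outcome
  have hδm := hcontrol.abs_sub_le_of_restrict_withDensity measurable_fst measurableSet_control
    hη.pos hη.ae_le_one_sub_e hY hY.abs (Eventually.of_forall fun _ => le_rfl) hg hτ hgτ hm hF₀
    h'.reg_outcome
  filter_upwards [ae_of_ae_map measurable_fst.aemeasurable hη.e_mem,
    ae_of_ae_map measurable_fst.aemeasurable hη.pi_mem, hδe, hδp, hδq, hδm]
    with o he_mem hpi_mem hδe hδp hδq hδm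
  refine (abs_scoreBias_le hη.pos he_mem hpi_mem (by simpa using hδe) (by simpa using hδp) hδq
    hδm).trans_eq ?_
  ring

lemma IsAdmissible.abs_integral_sub_integral_score_le {κ : ℝ}
    (hη : IsAdmissible (ρ.map Prod.fst) η κ) (hY : MemLp outcome 2 ρ) {e p q m : 𝒳 → ℝ}
    (h : ObservedRegressions ρ c e p q m) {a b : ℝ} {G : Obs 𝒳 → ℝ} (hG : Integrable G ρ)
    (hbias : ∀ᵐ o ∂ρ, |scoreBias a b e p q m η o.1| ≤ G o) :
    |∫ o, (a * (q o.1 - p o.1 * m o.1) + b * p o.1) ∂ρ - ∫ o, score c a b η o ∂ρ|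
      ≤ ∫ o, G o ∂ρ := by
  have hscore := hη.isRegression_score hY h a b
  have hmain : Measurable fun o : Obs 𝒳 => a * (q o.1 - p o.1 * m o.1) + b * p o.1 :=
    (((h.reg_stratum_mul_outcome.measurable.sub (h.reg_stratum.measurable.mul
      h.reg_outcome.measurable)).const_mul a).add
        (h.reg_stratum.measurable.const_mul b)).comp measurable_fst
  have hbias_meas : Measurable fun o : Obs 𝒳 => scoreBias a b e p q m η o.1 := by
    have hdiff := (hscore.measurable.comp measurable_fst).sub hmain
    simpa only [Function.comp_def, Pi.sub_def, add_sub_cancel_left] using hdiff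
  have hbiasi : Integrable (fun o => scoreBias a b e p q m η o.1) ρ :=
    hG.mono' hbias_meas.aestronglyMeasurable hbias
  have hint : ∫ o, (a * (q o.1 - p o.1 * m o.1) + b * p o.1) ∂ρ
      = ∫ o, score c a b η o ∂ρ - ∫ o, scoreBias a b e p q m η o.1 ∂ρ := by
    rw [← hscore.integral_eq measurable_fst, ← integral_sub hscore.integrable_comp hbiasi]
    simp only [add_sub_cancel_right]
  rw [hint, sub_sub_cancel_left, abs_neg]
  exact abs_integral_le_integral_abs.trans (integral_mono_ae hbiasi.abs hG hbias)

theorem Identified.exists_abs_integral_sub_le_sq (h : Identified ρ c η ε) (a b : ℝ) :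
    ∃ K : ℝ, ∀ (g : Obs 𝒳 → ℝ) (τ : ℝ), Measurable g → τ ≤ 1 / 2 → (∀ o, |g o - 1| ≤ τ) →
      ∀ e p q m : 𝒳 → ℝ,
      ObservedRegressions (ρ.withDensity fun o => ENNReal.ofReal (g o)) c e p q m →
      |∫ o, (a * (q o.1 - p o.1 * m o.1) + b * p o.1)
          ∂ρ.withDensity (fun o => ENNReal.ofReal (g o)) - ∫ o, g o * score c a b η o ∂ρ|
        ≤ K * τ ^ 2 := by
  obtain ⟨H, hH, hbias⟩ := h.exists_abs_scoreBias_le a b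
  refine ⟨2 * ∫ o, |H o.1| ∂ρ, fun g τ hg hτ hgτ e p q m h' => ?_⟩
  set ρ' := ρ.withDensity fun o => ENNReal.ofReal (g o)
  have hle : ρ' ≤ (2 : ℝ≥0∞) • ρ := withDensity_ofReal_le_two_smul hτ hgτ
  have hfin : IsFiniteMeasure ρ' :=
    have := ρ.smul_finite (c := 2) ENNReal.ofNat_ne_top
    isFiniteMeasure_of_le _ hle
  have hη' := h.admissible.of_le_smul (ν' := ρ'.map Prod.fst) ENNReal.ofNat_ne_top <| by
    rw [← Measure.map_smul]
    exact Measure.map_mono hle measurable_fst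
  have hbias' : ∀ᵐ o ∂ρ', |scoreBias a b e p q m η o.1| ≤ τ ^ 2 * |H o.1| :=
    (Measure.absolutelyContinuous_of_le_smul hle).ae_le ((hbias g τ hg hτ hgτ e p q m h').mono
      fun o ho => ho.trans (mul_le_mul_of_nonneg_left (le_abs_self _) (sq_nonneg τ)))
  rw [← integral_withDensity_ofReal hg fun o => by linarith [(abs_le.1 (hgτ o)).1]]
  calc |∫ o, (a * (q o.1 - p o.1 * m o.1) + b * p o.1) ∂ρ' - ∫ o, score c a b η o ∂ρ'|
      ≤ ∫ o, τ ^ 2 * |H o.1| ∂ρ' :=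
        hη'.abs_integral_sub_integral_score_le
          (h.memLp_outcome.of_measure_le_smul ENNReal.ofNat_ne_top hle) h'
          ((hH.abs.of_measure_le_smul ENNReal.ofNat_ne_top hle).const_mul _) hbias'
    _ ≤ ∫ o, τ ^ 2 * |H o.1| ∂((2 : ℝ≥0∞) • ρ) :=
        integral_mono_measure hle (Eventually.of_forall fun _ => by positivity)
          ((hH.abs.smul_measure ENNReal.ofNat_ne_top).const_mul _)
    _ = 2 * (∫ o, |H o.1| ∂ρ) * τ ^ 2 := by
        rw [integral_smul_measure, integral_const_mul]
        simp only [ENNReal.toReal_ofNat, smul_eq_mul]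
        ring

end Expansion

section InfluenceFunction

variable {𝒳 : Type*} [MeasurableSpace 𝒳] {ρ : Measure (Obs 𝒳)} {c : Bool} {η : Nuisance 𝒳}
  {ε B : ℝ} {s : Obs 𝒳 → ℝ}

lemma integral_score_mul {a b : ℝ} (hnum : Integrable (fun o => score c 1 0 η o * s o) ρ)
    (hden : Integrable (fun o => score c 0 1 η o * s o) ρ) :
    ∫ o, score c a b η o * s o ∂ρ
      = a * ∫ o, score c 1 0 η o * s o ∂ρ + b * ∫ o, score c 0 1 η o * s o ∂ρ := by
  rw [← integral_const_mul, ← integral_const_mul,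
    ← integral_add (hnum.const_mul a) (hden.const_mul b)]
  congr 1 with o
  simp only [score]
  ring

namespace Identified

variable [IsFiniteMeasure ρ]

lemma integrable_score (h : Identified ρ c η ε) (a b : ℝ) : Integrable (score c a b η) ρ :=
  (h.admissible.memLp_score c a b h.memLp_outcome).integrable one_le_two

lemma integrable_score_mul (h : Identified ρ c η ε) (a b : ℝ) (hs : Measurable s)
    (hB : ∀ o, |s o| ≤ B) : Integrable (fun o => score c a b η o * s o) ρ :=
  (h.integrable_score a b).mul_bdd hs.aestronglyMeasurable (Eventually.of_forall hB)

lemma integral_score (h : Identified ρ c η ε) (a b : ℝ) : ∫ o, score c a b η o ∂ρ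
    = ∫ o, (a * (η.pi o.1 * η.mu1 o.1 - η.pi o.1 * η.mu0 o.1) + b * η.pi o.1) ∂ρ := by
  rw [← (h.admissible.isRegression_score h.memLp_outcome h.regressions a b).integral_eq
    measurable_fst]
  simp only [scoreBias_self, add_zero]

lemma integral_one_add_mul_score (h : Identified ρ c η ε) (a b : ℝ) (hs : Measurable s)
    (hB : ∀ o, |s o| ≤ B) (t : ℝ) : ∫ o, (1 + t * s o) * score c a b η o ∂ρ
      = ∫ o, score c a b η o ∂ρ + t * ∫ o, score c a b η o * s o ∂ρ := by
  rw [← integral_const_mul,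
    ← integral_add (h.integrable_score a b) ((h.integrable_score_mul a b hs hB).const_mul t)]
  congr 1 with o
  ring

lemma exists_deltaPI_withDensity_eq_div (h : Identified ρ c η ε) (hs : Measurable s)
    (hB : ∀ o, |s o| ≤ B) :
    ∃ K : ℝ, ∀ t : ℝ, |t| * B ≤ 1 / 2 → ∃ n d : ℝ,
      deltaPI c (ρ.withDensity fun o => ENNReal.ofReal (1 + t * s o)) = n / d ∧
      |n - (∫ o, score c 1 0 η o ∂ρ + t * ∫ o, score c 1 0 η o * s o ∂ρ)| ≤ K * t ^ 2 ∧
      |d - (∫ o, score c 0 1 η o ∂ρ + t * ∫ o, score c 0 1 η o * s o ∂ρ)| ≤ K * t ^ 2 := by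
  obtain ⟨K₁, hK₁⟩ := h.exists_abs_integral_sub_le_sq 1 0
  obtain ⟨K₂, hK₂⟩ := h.exists_abs_integral_sub_le_sq 0 1
  refine ⟨max K₁ K₂ * B ^ 2, fun t ht => ?_⟩
  have hg : Measurable fun o => 1 + t * s o := (hs.const_mul t).const_add 1
  have hgτ : ∀ o, |1 + t * s o - 1| ≤ |t| * B := fun o => by
    rw [add_sub_cancel_left, abs_mul]
    exact mul_le_mul_of_nonneg_left (hB o) (abs_nonneg t)
  have hg0 : ∀ o, 0 ≤ 1 + t * s o := fun o => by linarith [(abs_le.1 (hgτ o)).1]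
  have hfin : IsFiniteMeasure (ρ.withDensity fun o => ENNReal.ofReal (1 + t * s o)) :=
    isFiniteMeasure_withDensity_ofReal
      (by simpa only [mul_one] using
        (integrable_mul_of_abs_sub_one_le hg hgτ (integrable_const (μ := ρ) (1 : ℝ))).2)
  obtain ⟨e, p, q, m, hreg, hdelta⟩ := exists_observedRegressions_deltaPI_eq
    (ρ := ρ.withDensity fun o => ENNReal.ofReal (1 + t * s o)) c
    ((integrable_withDensity_ofReal_iff hg hg0 _).2 (integrable_mul_of_abs_sub_one_le hg hgτ
      (h.memLp_outcome.integrable one_le_two)))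
  have hnum := hK₁ _ _ hg ht hgτ e p q m hreg
  have hden := hK₂ _ _ hg ht hgτ e p q m hreg
  simp only [h.integral_one_add_mul_score _ _ hs hB, mul_pow, sq_abs, one_mul, zero_mul, zero_add,
    add_zero] at hnum hden
  have hmax : ∀ K, K ≤ max K₁ K₂ → K * (t ^ 2 * B ^ 2) ≤ max K₁ K₂ * B ^ 2 * t ^ 2 :=
    fun K hK => (mul_le_mul_of_nonneg_right hK (by positivity)).trans_eq (by ring)
  exact ⟨_, _, hdelta, hnum.trans (hmax _ (le_max_left _ _)),
    hden.trans (hmax _ (le_max_right _ _))⟩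

lemma deltaPI_eq (h : Identified ρ c η ε) :
    deltaPI c ρ = (∫ o, score c 1 0 η o ∂ρ) / ∫ o, score c 0 1 η o ∂ρ := by
  obtain ⟨K, hK⟩ := h.exists_deltaPI_withDensity_eq_div (s := 0) (B := 0) measurable_zero (by simp)
  obtain ⟨n, d, hdelta, hn, hd⟩ := hK 0 (by simp)
  have hρ : (ρ.withDensity fun o => ENNReal.ofReal (1 + 0 * (0 : Obs 𝒳 → ℝ) o)) = ρ := by
    simp only [zero_mul, add_zero, ENNReal.ofReal_one]
    exact withDensity_one
  simp only [zero_mul, add_zero, ne_eq, OfNat.ofNat_ne_zero, not_false_eq_true, zero_pow,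
    mul_zero, abs_nonpos_iff, sub_eq_zero] at hn hd
  rw [← hn, ← hd, ← hdelta, hρ]

lemma hasDerivAt_deltaPI (h : Identified ρ c η ε) (hpi : ∫ o, score c 0 1 η o ∂ρ ≠ 0)
    (hs : Measurable s) (hB0 : 0 < B) (hB : ∀ o, |s o| ≤ B) :
    HasDerivAt (fun t : ℝ => deltaPI c (ρ.withDensity fun o => ENNReal.ofReal (1 + t * s o)))
      (((∫ o, score c 1 0 η o * s o ∂ρ) * (∫ o, score c 0 1 η o ∂ρ)
        - (∫ o, score c 1 0 η o ∂ρ) * ∫ o, score c 0 1 η o * s o ∂ρ)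
        / (∫ o, score c 0 1 η o ∂ρ) ^ 2) 0 := by
  obtain ⟨K, hK⟩ := h.exists_deltaPI_withDensity_eq_div hs hB
  choose! N D hdelta hN hD using hK
  have hδ : 0 < (2 * B)⁻¹ := by positivity
  have hsmall : ∀ t, |t| ≤ (2 * B)⁻¹ → |t| * B ≤ 1 / 2 := fun t ht =>
    (mul_le_mul_of_nonneg_right ht hB0.le).trans_eq (by field_simp)
  have hN' := hasDerivAt_of_abs_sub_le_sq hδ fun t ht => hN t (hsmall t ht)
  have hD' := hasDerivAt_of_abs_sub_le_sq hδ fun t ht => hD t (hsmall t ht)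
  have hN0 : N 0 = ∫ o, score c 1 0 η o ∂ρ := by simpa [sub_eq_zero] using hN 0 (by simp)
  have hD0 : D 0 = ∫ o, score c 0 1 η o ∂ρ := by simpa [sub_eq_zero] using hD 0 (by simp)
  have hdiv := hN'.div hD' (by rwa [hD0])
  rw [hN0, hD0] at hdiv
  refine hdiv.congr_of_eventuallyEq ?_
  filter_upwards [Metric.closedBall_mem_nhds (0 : ℝ) hδ] with t ht
  exact hdelta t (hsmall t (by simpa using ht))

theorem isInfluenceFunction (h : Identified ρ c η ε) (hpi : ∫ o, η.pi o.1 ∂ρ ≠ 0) :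
    IsInfluenceFunction (deltaPI c) ρ (phiDelta c η (∫ o, η.pi o.1 ∂ρ) (deltaPI c ρ)) := by
  have hpi_eq : ∫ o, η.pi o.1 ∂ρ = ∫ o, score c 0 1 η o ∂ρ := by
    simp only [h.integral_score, zero_mul, zero_add, one_mul]
  rw [hpi_eq] at hpi ⊢
  rw [phiDelta_eq_score, h.deltaPI_eq]
  refine ⟨h.admissible.memLp_score c _ _ h.memLp_outcome, ?_, ?_⟩
  · have hlin := integral_score_mul (s := fun _ => 1)
      (a := (∫ o, score c 0 1 η o ∂ρ)⁻¹)
      (b := -((∫ o, score c 1 0 η o ∂ρ) / ∫ o, score c 0 1 η o ∂ρ) * (∫ o, score c 0 1 η o ∂ρ)⁻¹)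
      ((h.integrable_score 1 0).mul_const 1) ((h.integrable_score 0 1).mul_const 1)
    simp only [mul_one] at hlin
    rw [hlin]
    field_simp
    ring
  · rintro s hs ⟨B, hB⟩ -
    have hB' : ∀ o, |s o| ≤ max B 1 := fun o => (hB o).trans (le_max_left _ _)
    convert h.hasDerivAt_deltaPI hpi hs (lt_max_of_lt_right one_pos) hB' using 1
    rw [integral_score_mul (h.integrable_score_mul 1 0 hs hB) (h.integrable_score_mul 0 1 hs hB)]
    field_simp
    ring

end Identified

end InfluenceFunction

section StochasticOrder

variable {Ω : Type*} [MeasurableSpace Ω] {Q : Measure Ω} {A R R' D : ℕ → Ω → ℝ≥0∞} {a b : ℕ → ℝ}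

lemma IsLittleOP.add (hR : IsLittleOP Q R a) (hR' : IsLittleOP Q R' a) :
    IsLittleOP Q (fun n ω => R n ω + R' n ω) a := fun δ hδ => by
  have hsum := (hR (δ / 2) (half_pos hδ)).add (hR' (δ / 2) (half_pos hδ))
  rw [add_zero] at hsum
  refine tendsto_of_tendsto_of_tendsto_of_le_of_le tendsto_const_nhds hsum
    (fun n => zero_le) fun n => (measure_mono fun ω hω => ?_).trans (measure_union_le _ _)
  by_contra hle
  simp only [Set.mem_union, Set.mem_ofPred_eq, not_or, not_lt] at hω hle
  refine hω.not_ge ((add_le_add hle.1 hle.2).trans ?_)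
  rcases le_or_gt 0 (a n) with ha | ha
  · rw [← ENNReal.ofReal_add (by positivity) (by positivity)]
    exact ENNReal.ofReal_le_ofReal (by linarith)
  · simp [ENNReal.ofReal_of_nonpos (mul_nonpos_of_nonneg_of_nonpos (half_pos hδ).le ha.le)]

lemma IsLittleOP.isBigOP (hR : IsLittleOP Q R a) : IsBigOP Q R a := fun _δ hδ =>
  ⟨1, (ENNReal.tendsto_nhds_zero.1 (hR 1 one_pos)) _ (ENNReal.ofReal_pos.2 hδ)⟩

lemma IsBigOP.max (ha : ∀ n, 0 ≤ a n) (hR : IsBigOP Q R a) (hR' : IsBigOP Q R' a) :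
    IsBigOP Q (fun n ω => max (R n ω) (R' n ω)) a := fun δ hδ => by
  obtain ⟨M, hM⟩ := hR (δ / 2) (half_pos hδ)
  obtain ⟨M', hM'⟩ := hR' (δ / 2) (half_pos hδ)
  refine ⟨Max.max M M', (hM.and hM').mono fun n hn => ?_⟩
  have hmono {x y : ℝ} (hxy : x ≤ y) : ENNReal.ofReal (x * a n) ≤ ENNReal.ofReal (y * a n) :=
    ENNReal.ofReal_le_ofReal (mul_le_mul_of_nonneg_right hxy (ha n))
  calc Q {ω | ENNReal.ofReal (Max.max M M' * a n) < Max.max (R n ω) (R' n ω)}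
      ≤ Q ({ω | ENNReal.ofReal (M * a n) < R n ω} ∪ {ω | ENNReal.ofReal (M' * a n) < R' n ω}) :=
        measure_mono fun ω hω => (lt_max_iff.1 hω).imp
          (hmono (le_max_left M M')).trans_lt (hmono (le_max_right M M')).trans_lt
    _ ≤ ENNReal.ofReal (δ / 2) + ENNReal.ofReal (δ / 2) :=
        (measure_union_le _ _).trans (add_le_add hn.1 hn.2)
    _ = ENNReal.ofReal δ := by
        rw [← ENNReal.ofReal_add (half_pos hδ).le (half_pos hδ).le, add_halves]

lemma IsBigOP.exists_measure_lt_le (hA : IsBigOP Q A a) {ε : ℝ≥0∞} (hε : 0 < ε) :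
    ∃ M : ℝ, ∀ᶠ n in atTop, Q {ω | ENNReal.ofReal (M * a n) < A n ω} ≤ ε := by
  obtain ⟨r, hr, hrε⟩ := ENNReal.lt_iff_exists_nnreal_btwn.1 hε
  obtain ⟨M, hM⟩ := hA r (by exact_mod_cast hr)
  exact ⟨M, hM.mono fun n hn => hn.trans (by rw [ENNReal.ofReal_coe_nnreal]; exact hrε.le)⟩

theorem isLittleOP_of_forall_bounded (hA : IsBigOP Q A fun _ => 1) (hR : IsLittleOP Q R a)
    (hD : ∀ M κ : ℝ, 0 < κ → ∃ δ : ℝ, 0 < δ ∧ ∀ n ω, A n ω ≤ ENNReal.ofReal M →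
      R n ω ≤ ENNReal.ofReal (δ * a n) → D n ω ≤ ENNReal.ofReal (κ * b n)) :
    IsLittleOP Q D b := fun κ hκ => by
  refine ENNReal.tendsto_nhds_zero.2 fun ε hε => ?_
  have hε2 : 0 < ε / 2 := ENNReal.half_pos hε.ne'
  obtain ⟨M, hM⟩ := hA.exists_measure_lt_le hε2
  obtain ⟨δ, hδ, hle⟩ := hD M κ hκ
  filter_upwards [hM, ENNReal.tendsto_nhds_zero.1 (hR δ hδ) _ hε2] with n hAn hRn
  calc Q {ω | ENNReal.ofReal (κ * b n) < D n ω}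
      ≤ Q ({ω | ENNReal.ofReal (M * 1) < A n ω} ∪ {ω | ENNReal.ofReal (δ * a n) < R n ω}) :=
        measure_mono fun ω hω => by
          by_contra hbounded
          simp only [Set.mem_union, Set.mem_ofPred_eq, not_or, not_lt, mul_one] at hω hbounded
          exact hω.not_ge (hle n ω hbounded.1 hbounded.2)
    _ ≤ ε / 2 + ε / 2 := (measure_union_le _ _).trans (add_le_add hAn hRn)
    _ = ε := ENNReal.add_halves ε

end StochasticOrder

section MeanSquareContinuity

lemma exists_eLpNorm_mul_le {α : Type*} [MeasurableSpace α] {μ : Measure α} {p : ℝ≥0∞}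
    (hp : 1 ≤ p) {H : α → ℝ} (hH : StronglyMeasurable H) (hHp : MemLp H p μ) {κ : ℝ}
    (hκ : 0 < κ) :
    ∃ δ : ℝ, 0 < δ ∧ ∀ d : α → ℝ, AEStronglyMeasurable d μ → (∀ᵐ x ∂μ, |d x| ≤ 1) →
      eLpNorm d p μ ≤ ENNReal.ofReal δ →
      eLpNorm (fun x => d x * H x) p μ ≤ ENNReal.ofReal κ := by
  obtain ⟨N, hN, htail⟩ := hHp.eLpNorm_indicator_norm_ge_pos_le hH (half_pos hκ)
  set T : α → ℝ := {x | N ≤ ‖H x‖₊}.indicator H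
  have hTm : AEStronglyMeasurable (fun x => ‖T x‖) μ :=
    (hH.indicator (measurableSet_le measurable_const hH.measurable.norm)).norm.aestronglyMeasurable
  refine ⟨κ / 2 / N, by positivity, fun d hd hd1 hdδ => ?_⟩
  have htruncate : ∀ᵐ x ∂μ, ‖d x * H x‖ ≤ ‖N * d x‖ + ‖T x‖ := hd1.mono fun x hx => by
    rw [norm_mul, norm_mul, Real.norm_of_nonneg hN.le]
    by_cases hxN : N ≤ ‖H x‖
    · have hTx : T x = H x := Set.indicator_of_mem (s := {x | N ≤ ‖H x‖₊}) hxN H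
      rw [hTx]
      have := mul_le_mul_of_nonneg_right hx (norm_nonneg (H x))
      rw [← Real.norm_eq_abs, one_mul] at this
      linarith [mul_nonneg hN.le (norm_nonneg (d x))]
    · linarith [mul_le_mul_of_nonneg_left (not_le.1 hxN).le (norm_nonneg (d x)),
        norm_nonneg (T x)]
  calc eLpNorm (fun x => d x * H x) p μ
      ≤ eLpNorm (fun x => ‖N * d x‖ + ‖T x‖) p μ := eLpNorm_mono_ae_real htruncate
    _ ≤ eLpNorm (fun x => ‖N * d x‖) p μ + eLpNorm (fun x => ‖T x‖) p μ :=
        eLpNorm_add_le (hd.const_mul N).norm hTm hp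
    _ = ENNReal.ofReal N * eLpNorm d p μ + eLpNorm T p μ := by
        rw [eLpNorm_norm, eLpNorm_norm, ← Real.enorm_eq_ofReal hN.le, ← eLpNorm_const_smul]
        rfl
    _ ≤ ENNReal.ofReal N * ENNReal.ofReal (κ / 2 / N) + ENNReal.ofReal (κ / 2) := by gcongr
    _ = ENNReal.ofReal κ := by
        rw [← ENNReal.ofReal_mul hN.le, mul_div_cancel₀ _ hN.ne',
          ← ENNReal.ofReal_add (half_pos hκ).le (half_pos hκ).le, add_halves]

lemma abs_aipw_sub_le {Ω 𝒳 : Type*} (T : Set Ω) (X : Ω → 𝒳) (r f r' f' : 𝒳 → ℝ) (W : Ω → ℝ)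
    (ω : Ω) {κ : ℝ} (hκ : 0 < κ) (hr : κ ≤ r (X ω)) (hr' : κ ≤ r' (X ω)) :
    |aipw T X r' f' W ω - aipw T X r f W ω| ≤
      κ⁻¹ ^ 2 * |r' (X ω) - r (X ω)| * |W ω - f (X ω)|
        + (1 + κ⁻¹) * |f' (X ω) - f (X ω)| := by
  have hinv : ∀ {s : ℝ}, κ ≤ s → |s⁻¹| ≤ κ⁻¹ := fun hs => by
    rw [abs_of_pos (inv_pos.2 (hκ.trans_le hs))]
    exact inv_anti₀ hκ hs
  have hd := abs_nonneg (f' (X ω) - f (X ω))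
  by_cases hω : ω ∈ T
  · have hr0 := (hκ.trans_le hr).ne'
    have hr0' := (hκ.trans_le hr').ne'
    calc |aipw T X r' f' W ω - aipw T X r f W ω|
        = |-((r' (X ω))⁻¹ * (r (X ω))⁻¹ * (r' (X ω) - r (X ω)) * (W ω - f (X ω)))
            + (1 - (r' (X ω))⁻¹) * (f' (X ω) - f (X ω))| := by
          simp only [aipw, Set.indicator_of_mem hω]
          congr 1
          field_simp
          ring
      _ ≤ |(r' (X ω))⁻¹| * |(r (X ω))⁻¹| * |r' (X ω) - r (X ω)| * |W ω - f (X ω)|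
            + |1 - (r' (X ω))⁻¹| * |f' (X ω) - f (X ω)| := by
          refine (abs_add_le _ _).trans_eq ?_
          rw [abs_neg, abs_mul, abs_mul, abs_mul, abs_mul]
      _ ≤ κ⁻¹ * κ⁻¹ * |r' (X ω) - r (X ω)| * |W ω - f (X ω)|
            + (1 + κ⁻¹) * |f' (X ω) - f (X ω)| := by
          have h1 : |1 - (r' (X ω))⁻¹| ≤ 1 + κ⁻¹ :=
            (abs_sub _ _).trans (by rw [abs_one]; exact add_le_add_right (hinv hr') 1)
          gcongr
          exacts [hinv hr', hinv hr]
      _ = _ := by rw [sq]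
  · simp only [aipw, Set.indicator_of_notMem hω, zero_add]
    have : 0 ≤ κ⁻¹ ^ 2 * |r' (X ω) - r (X ω)| * |W ω - f (X ω)| := by positivity
    linarith [mul_nonneg (inv_pos.2 hκ).le hd]

end MeanSquareContinuity

section ScoreContinuity

variable {𝒳 : Type*} {η ξ : Nuisance 𝒳} {κ : ℝ} {o : Obs 𝒳}

/-- The square integrable weight of the errors of the propensity and principal scores in the mean
square error of `score`. -/
def envelope (η : Nuisance 𝒳) (o : Obs 𝒳) : ℝ :=
  1 + |outcome o| + |η.mu1 o.1| + |η.mu0 o.1|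

/-- The pointwise bound, up to a constant, of the error of `score` when the nuisance functions `η`
are replaced by `ξ`. -/
def nuisanceGap (ξ η : Nuisance 𝒳) (o : Obs 𝒳) : ℝ :=
  |(ξ.e o.1 - η.e o.1) * envelope η o| + |(ξ.pi o.1 - η.pi o.1) * envelope η o|
    + |ξ.mu1 o.1 - η.mu1 o.1| + |ξ.mu0 o.1 - η.mu0 o.1|

lemma envelope_nonneg (η : Nuisance 𝒳) (o : Obs 𝒳) : 0 ≤ envelope η o := by
  unfold envelope
  positivity

lemma nuisanceGap_nonneg (ξ η : Nuisance 𝒳) (o : Obs 𝒳) : 0 ≤ nuisanceGap ξ η o := by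
  unfold nuisanceGap
  positivity

lemma nuisanceGap_eq (ξ η : Nuisance 𝒳) (o : Obs 𝒳) :
    nuisanceGap ξ η o = (|ξ.e o.1 - η.e o.1| + |ξ.pi o.1 - η.pi o.1|) * envelope η o
      + |ξ.mu1 o.1 - η.mu1 o.1| + |ξ.mu0 o.1 - η.mu0 o.1| := by
  rw [nuisanceGap, abs_mul, abs_mul, abs_of_nonneg (envelope_nonneg η o), ← add_mul]

lemma abs_stratum_sub_le_one (c : Bool) {t : ℝ} (ht : 0 ≤ t ∧ t ≤ 1) : |stratum c o - t| ≤ 1 := by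
  have h0 : 0 ≤ stratum c o := ind_nonneg _
  have h1 : stratum c o ≤ 1 := ind_le_one _
  exact abs_le.2 ⟨by linarith [ht.2], by linarith [ht.1]⟩

lemma abs_phiPi_sub_le (c : Bool) (hκ : 0 < κ) (hη : κ ≤ η.e o.1) (hξ : κ ≤ ξ.e o.1)
    (hp : 0 ≤ η.pi o.1 ∧ η.pi o.1 ≤ 1) :
    |phiPi c ξ o - phiPi c η o|
      ≤ (1 + κ⁻¹) ^ 2 * (|ξ.e o.1 - η.e o.1| + |ξ.pi o.1 - η.pi o.1|) := by
  have hκi := inv_pos.2 hκ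
  rw [phiPi_eq_aipw, phiPi_eq_aipw, mul_add]
  refine (abs_aipw_sub_le _ _ _ _ _ _ _ o hκ hη hξ).trans ?_
  calc κ⁻¹ ^ 2 * |ξ.e o.1 - η.e o.1| * |stratum c o - η.pi o.1|
        + (1 + κ⁻¹) * |ξ.pi o.1 - η.pi o.1|
      ≤ (1 + κ⁻¹) ^ 2 * |ξ.e o.1 - η.e o.1| * 1 + (1 + κ⁻¹) ^ 2 * |ξ.pi o.1 - η.pi o.1| := by
        gcongr
        · linarith
        · exact abs_stratum_sub_le_one c hp
        · nlinarith
    _ = _ := by rw [mul_one]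

lemma abs_stratum_mul_outcome_sub_le (c : Bool) (hp : 0 ≤ η.pi o.1 ∧ η.pi o.1 ≤ 1) :
    |stratum c o * outcome o - η.pi o.1 * η.mu1 o.1| ≤ envelope η o := by
  have hstratum : |stratum c o| ≤ 1 := norm_ind_le_one _
  calc |stratum c o * outcome o - η.pi o.1 * η.mu1 o.1|
      ≤ |stratum c o| * |outcome o| + η.pi o.1 * |η.mu1 o.1| := by
        refine (abs_sub _ _).trans_eq ?_
        rw [abs_mul, abs_mul, abs_of_nonneg hp.1]
    _ ≤ 1 * |outcome o| + 1 * |η.mu1 o.1| := by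
        gcongr
        exact hp.2
    _ ≤ envelope η o := by
        unfold envelope
        linarith [abs_nonneg (η.mu0 o.1)]

lemma abs_pi_mul_mu1_sub_le (hp : 0 ≤ ξ.pi o.1 ∧ ξ.pi o.1 ≤ 1) :
    |ξ.pi o.1 * ξ.mu1 o.1 - η.pi o.1 * η.mu1 o.1|
      ≤ |ξ.pi o.1 - η.pi o.1| * envelope η o + |ξ.mu1 o.1 - η.mu1 o.1| :=
  calc |ξ.pi o.1 * ξ.mu1 o.1 - η.pi o.1 * η.mu1 o.1|
      = |(ξ.pi o.1 - η.pi o.1) * η.mu1 o.1 + ξ.pi o.1 * (ξ.mu1 o.1 - η.mu1 o.1)| := by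
        congr 1
        ring
    _ ≤ |ξ.pi o.1 - η.pi o.1| * |η.mu1 o.1| + ξ.pi o.1 * |ξ.mu1 o.1 - η.mu1 o.1| := by
        refine (abs_add_le _ _).trans_eq ?_
        rw [abs_mul, abs_mul, abs_of_nonneg hp.1]
    _ ≤ |ξ.pi o.1 - η.pi o.1| * envelope η o + 1 * |ξ.mu1 o.1 - η.mu1 o.1| := by
        gcongr
        · unfold envelope
          linarith [abs_nonneg (outcome o), abs_nonneg (η.mu0 o.1)]
        · exact hp.2
    _ = _ := by rw [one_mul]

lemma abs_phiNu1_sub_le (c : Bool) (hκ : 0 < κ) (hη : κ ≤ η.e o.1) (hξ : κ ≤ ξ.e o.1)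
    (hp : 0 ≤ η.pi o.1 ∧ η.pi o.1 ≤ 1) (hp' : 0 ≤ ξ.pi o.1 ∧ ξ.pi o.1 ≤ 1) :
    |phiNu1 c ξ o - phiNu1 c η o| ≤ (1 + κ⁻¹) ^ 2 * nuisanceGap ξ η o := by
  have hκi := inv_pos.2 hκ
  rw [phiNu1_eq_aipw, phiNu1_eq_aipw, nuisanceGap_eq]
  refine (abs_aipw_sub_le _ _ _ _ _ _ _ o hκ hη hξ).trans ?_
  calc κ⁻¹ ^ 2 * |ξ.e o.1 - η.e o.1| * |stratum c o * outcome o - η.pi o.1 * η.mu1 o.1|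
        + (1 + κ⁻¹) * |ξ.pi o.1 * ξ.mu1 o.1 - η.pi o.1 * η.mu1 o.1|
      ≤ (1 + κ⁻¹) ^ 2 * |ξ.e o.1 - η.e o.1| * envelope η o
        + (1 + κ⁻¹) ^ 2
          * (|ξ.pi o.1 - η.pi o.1| * envelope η o + |ξ.mu1 o.1 - η.mu1 o.1|) := by
        gcongr
        · linarith
        · exact abs_stratum_mul_outcome_sub_le c hp
        · nlinarith
        · exact abs_pi_mul_mu1_sub_le hp'
    _ = (1 + κ⁻¹) ^ 2 * ((|ξ.e o.1 - η.e o.1| + |ξ.pi o.1 - η.pi o.1|) * envelope η o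
          + |ξ.mu1 o.1 - η.mu1 o.1|) := by ring
    _ ≤ _ := mul_le_mul_of_nonneg_left (le_add_of_nonneg_right (abs_nonneg _)) (sq_nonneg _)

lemma abs_aipw_sub_model_le {Ω : Type*} (T : Set Ω) (X : Ω → 𝒳) (r f : 𝒳 → ℝ) (W : Ω → ℝ)
    (ω : Ω) (hκ : 0 < κ) (hr : κ ≤ r (X ω)) :
    |aipw T X r f W ω - f (X ω)| ≤ κ⁻¹ * |W ω - f (X ω)| := by
  rw [aipw, add_sub_cancel_right, ← Real.norm_eq_abs]
  refine (norm_indicator_le_norm_self _ ω).trans ?_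
  rw [Real.norm_eq_abs, abs_div, abs_of_pos (hκ.trans_le hr), div_eq_inv_mul]
  exact mul_le_mul_of_nonneg_right (inv_anti₀ hκ hr) (abs_nonneg _)

lemma abs_phiPi_sub_pi_le (c : Bool) (hκ : 0 < κ) (hξ : κ ≤ ξ.e o.1)
    (hp : 0 ≤ ξ.pi o.1 ∧ ξ.pi o.1 ≤ 1) : |phiPi c ξ o - ξ.pi o.1| ≤ (1 + κ⁻¹) ^ 2 := by
  have hκi := inv_pos.2 hκ
  rw [phiPi_eq_aipw]
  refine (abs_aipw_sub_model_le _ _ _ _ _ o hκ hξ).trans ?_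
  exact (mul_le_of_le_one_right hκi.le (abs_stratum_sub_le_one c hp)).trans (by nlinarith)

lemma abs_outcome_sub_le : |outcome o - η.mu0 o.1| ≤ envelope η o := by
  unfold envelope
  linarith [abs_sub (outcome o) (η.mu0 o.1), abs_nonneg (η.mu1 o.1)]

lemma abs_aipw_outcome_sub_mu0_le (hκ : 0 < κ) (hη : η.e o.1 ≤ 1 - κ) :
    |aipw (control 𝒳) Prod.fst (fun x => 1 - η.e x) η.mu0 outcome o - η.mu0 o.1|
      ≤ (1 + κ⁻¹) ^ 2 * envelope η o := by
  have hκi := inv_pos.2 hκ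
  have hle : κ⁻¹ ≤ (1 + κ⁻¹) ^ 2 := by nlinarith
  refine (abs_aipw_sub_model_le _ Prod.fst (fun x => 1 - η.e x) _ _ o hκ
    (le_sub_comm.1 hη)).trans ?_
  exact mul_le_mul hle abs_outcome_sub_le (abs_nonneg _) (sq_nonneg _)

lemma abs_aipw_outcome_sub_le (hκ : 0 < κ) (hη : η.e o.1 ≤ 1 - κ) (hξ : ξ.e o.1 ≤ 1 - κ) :
    |aipw (control 𝒳) Prod.fst (fun x => 1 - ξ.e x) ξ.mu0 outcome o
        - aipw (control 𝒳) Prod.fst (fun x => 1 - η.e x) η.mu0 outcome o|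
      ≤ (1 + κ⁻¹) ^ 2 * (|ξ.e o.1 - η.e o.1| * envelope η o + |ξ.mu0 o.1 - η.mu0 o.1|) := by
  have hκi := inv_pos.2 hκ
  have h := abs_aipw_sub_le (control 𝒳) Prod.fst (fun x => 1 - η.e x) η.mu0
    (fun x => 1 - ξ.e x) ξ.mu0 outcome o hκ (le_sub_comm.1 hη) (le_sub_comm.1 hξ)
  rw [sub_sub_sub_cancel_left, abs_sub_comm (η.e o.1)] at h
  rw [mul_add, ← mul_assoc]
  refine h.trans ?_
  gcongr
  · linarith
  · exact abs_outcome_sub_le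
  · nlinarith

lemma phiNu0_sub (c : Bool) (ξ η : Nuisance 𝒳) (o : Obs 𝒳) :
    phiNu0 c ξ o - phiNu0 c η o
      = ξ.pi o.1 * (aipw (control 𝒳) Prod.fst (fun x => 1 - ξ.e x) ξ.mu0 outcome o
          - aipw (control 𝒳) Prod.fst (fun x => 1 - η.e x) η.mu0 outcome o)
        + (ξ.pi o.1 - η.pi o.1)
          * (aipw (control 𝒳) Prod.fst (fun x => 1 - η.e x) η.mu0 outcome o - η.mu0 o.1)
        + η.mu0 o.1 * (phiPi c ξ o - phiPi c η o)
        + (ξ.mu0 o.1 - η.mu0 o.1) * (phiPi c ξ o - ξ.pi o.1) := by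
  rw [phiNu0_eq_aipw, phiNu0_eq_aipw, ← phiPi_eq_aipw, ← phiPi_eq_aipw]
  ring

lemma abs_phiNu0_sub_le (c : Bool) (hκ : 0 < κ) (hη : κ ≤ η.e o.1 ∧ η.e o.1 ≤ 1 - κ)
    (hξ : κ ≤ ξ.e o.1 ∧ ξ.e o.1 ≤ 1 - κ) (hp : 0 ≤ η.pi o.1 ∧ η.pi o.1 ≤ 1)
    (hp' : 0 ≤ ξ.pi o.1 ∧ ξ.pi o.1 ≤ 1) :
    |phiNu0 c ξ o - phiNu0 c η o| ≤ 2 * (1 + κ⁻¹) ^ 2 * nuisanceGap ξ η o := by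
  set C := (1 + κ⁻¹) ^ 2
  have : 0 ≤ C := sq_nonneg _
  have hH := envelope_nonneg η o
  have hmu0 : |η.mu0 o.1| ≤ envelope η o := by
    unfold envelope
    linarith [abs_nonneg (outcome o), abs_nonneg (η.mu1 o.1)]
  calc |phiNu0 c ξ o - phiNu0 c η o|
      ≤ 1 * (C * (|ξ.e o.1 - η.e o.1| * envelope η o + |ξ.mu0 o.1 - η.mu0 o.1|))
        + |ξ.pi o.1 - η.pi o.1| * (C * envelope η o)
        + envelope η o * (C * (|ξ.e o.1 - η.e o.1| + |ξ.pi o.1 - η.pi o.1|))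
        + |ξ.mu0 o.1 - η.mu0 o.1| * C := by
        rw [phiNu0_sub]
        refine (abs_add_le _ _).trans (add_le_add ((abs_add_le _ _).trans (add_le_add
          ((abs_add_le _ _).trans (add_le_add ?_ ?_)) ?_)) ?_) <;> rw [abs_mul]
        · rw [abs_of_nonneg hp'.1]
          exact mul_le_mul hp'.2 (abs_aipw_outcome_sub_le hκ hη.2 hξ.2) (abs_nonneg _) zero_le_one
        · exact mul_le_mul_of_nonneg_left (abs_aipw_outcome_sub_mu0_le hκ hη.2) (abs_nonneg _)
        · exact mul_le_mul hmu0 (abs_phiPi_sub_le c hκ hη.1 hξ.1 hp) (abs_nonneg _) hH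
        · exact mul_le_mul_of_nonneg_left (abs_phiPi_sub_pi_le c hκ hξ.1 hp') (abs_nonneg _)
    _ = 2 * C * ((|ξ.e o.1 - η.e o.1| + |ξ.pi o.1 - η.pi o.1|) * envelope η o
          + |ξ.mu0 o.1 - η.mu0 o.1|) := by ring
    _ ≤ 2 * C * nuisanceGap ξ η o := by
        rw [nuisanceGap_eq]
        exact mul_le_mul_of_nonneg_left
          (add_le_add_left (le_add_of_nonneg_right (abs_nonneg _)) _) (by positivity)

lemma abs_score_sub_le (c : Bool) (a b : ℝ) (hκ : 0 < κ) (hη : κ ≤ η.e o.1 ∧ η.e o.1 ≤ 1 - κ)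
    (hξ : κ ≤ ξ.e o.1 ∧ ξ.e o.1 ≤ 1 - κ) (hp : 0 ≤ η.pi o.1 ∧ η.pi o.1 ≤ 1)
    (hp' : 0 ≤ ξ.pi o.1 ∧ ξ.pi o.1 ≤ 1) :
    |score c a b ξ o - score c a b η o|
      ≤ (3 * |a| + |b|) * (1 + κ⁻¹) ^ 2 * nuisanceGap ξ η o := by
  have hPi : |phiPi c ξ o - phiPi c η o| ≤ (1 + κ⁻¹) ^ 2 * nuisanceGap ξ η o := by
    refine (abs_phiPi_sub_le c hκ hη.1 hξ.1 hp).trans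
      (mul_le_mul_of_nonneg_left ?_ (sq_nonneg _))
    have hone : 1 ≤ envelope η o := by
      unfold envelope
      linarith [abs_nonneg (outcome o), abs_nonneg (η.mu1 o.1), abs_nonneg (η.mu0 o.1)]
    rw [nuisanceGap_eq]
    exact (le_mul_of_one_le_right (by positivity) hone).trans
      ((le_add_of_nonneg_right (abs_nonneg _)).trans (le_add_of_nonneg_right (abs_nonneg _)))
  calc |score c a b ξ o - score c a b η o|
      = |a * (phiNu1 c ξ o - phiNu1 c η o - (phiNu0 c ξ o - phiNu0 c η o))
          + b * (phiPi c ξ o - phiPi c η o)| := by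
        congr 1
        simp only [score]
        ring
    _ ≤ |a| * (|phiNu1 c ξ o - phiNu1 c η o| + |phiNu0 c ξ o - phiNu0 c η o|)
          + |b| * |phiPi c ξ o - phiPi c η o| := by
        refine (abs_add_le _ _).trans ?_
        rw [abs_mul, abs_mul]
        gcongr
        exact abs_sub _ _
    _ ≤ |a| * ((1 + κ⁻¹) ^ 2 * nuisanceGap ξ η o + 2 * (1 + κ⁻¹) ^ 2 * nuisanceGap ξ η o)
          + |b| * ((1 + κ⁻¹) ^ 2 * nuisanceGap ξ η o) := by
        gcongr
        · exact abs_phiNu1_sub_le c hκ hη.1 hξ.1 hp hp'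
        · exact abs_phiNu0_sub_le c hκ hη hξ hp hp'
    _ = _ := by ring

end ScoreContinuity

section MeanSquareError

/-- The total `L²(ν)` error of the nuisance estimates `ξ` of `η`. -/
noncomputable def nuisanceErr {𝒳 : Type*} [MeasurableSpace 𝒳] (ν : Measure 𝒳)
    (ξ η : Nuisance 𝒳) : ℝ≥0∞ :=
  l2err ν ξ.e η.e + l2err ν ξ.pi η.pi + l2err ν ξ.mu1 η.mu1 + l2err ν ξ.mu0 η.mu0

variable {𝒳 : Type*} [MeasurableSpace 𝒳] {ν : Measure 𝒳} {ρ : Measure (Obs 𝒳)} {c : Bool}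
  {η ξ : Nuisance 𝒳} {κ : ℝ}

lemma l2err_map_fst {f g : 𝒳 → ℝ} (hf : Measurable f) (hg : Measurable g) :
    l2err (ρ.map Prod.fst) f g = eLpNorm (fun o => f o.1 - g o.1) 2 ρ :=
  eLpNorm_map_measure (hf.sub hg).aestronglyMeasurable measurable_fst.aemeasurable

lemma measurable_envelope (h1 : Measurable η.mu1) (h0 : Measurable η.mu0) :
    Measurable (envelope η) :=
  ((measurable_outcome.abs.const_add 1).add (h1.comp measurable_fst).abs).add
    (h0.comp measurable_fst).abs

namespace IsAdmissible

lemma mono (hξ : IsAdmissible ν ξ κ) {κ' : ℝ} (hκ' : 0 < κ') (hle : κ' ≤ κ) :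
    IsAdmissible ν ξ κ' where
  __ := hξ
  pos := hκ'
  e_mem := hξ.e_mem.mono fun _ hx => ⟨hle.trans hx.1, hx.2.trans (sub_le_sub_left hle 1)⟩

lemma memLp_envelope [IsFiniteMeasure ρ] (hη : IsAdmissible (ρ.map Prod.fst) η κ)
    (hY : MemLp outcome 2 ρ) : MemLp (envelope η) 2 ρ :=
  (((memLp_const (1 : ℝ)).add hY.abs).add hη.memLp_mu1_comp.abs).add hη.memLp_mu0_comp.abs

lemma eLpNorm_nuisanceGap_le (hη : IsAdmissible (ρ.map Prod.fst) η κ)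
    (hξ : IsAdmissible (ρ.map Prod.fst) ξ κ) :
    eLpNorm (nuisanceGap ξ η) 2 ρ ≤
      eLpNorm (fun o => (ξ.e o.1 - η.e o.1) * envelope η o) 2 ρ
        + eLpNorm (fun o => (ξ.pi o.1 - η.pi o.1) * envelope η o) 2 ρ
        + l2err (ρ.map Prod.fst) ξ.mu1 η.mu1 + l2err (ρ.map Prod.fst) ξ.mu0 η.mu0 := by
  have hH := measurable_envelope hη.measurable_mu1 hη.measurable_mu0
  have he : Measurable fun o : Obs 𝒳 => ‖(ξ.e o.1 - η.e o.1) * envelope η o‖ :=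
    (((hξ.measurable_e.sub hη.measurable_e).comp measurable_fst).mul hH).norm
  have hpi : Measurable fun o : Obs 𝒳 => ‖(ξ.pi o.1 - η.pi o.1) * envelope η o‖ :=
    (((hξ.measurable_pi.sub hη.measurable_pi).comp measurable_fst).mul hH).norm
  have h1 : Measurable fun o : Obs 𝒳 => ‖ξ.mu1 o.1 - η.mu1 o.1‖ :=
    ((hξ.measurable_mu1.sub hη.measurable_mu1).comp measurable_fst).norm
  have h0 : Measurable fun o : Obs 𝒳 => ‖ξ.mu0 o.1 - η.mu0 o.1‖ :=
    ((hξ.measurable_mu0.sub hη.measurable_mu0).comp measurable_fst).norm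
  rw [l2err_map_fst hξ.measurable_mu1 hη.measurable_mu1,
    l2err_map_fst hξ.measurable_mu0 hη.measurable_mu0,
    ← eLpNorm_norm fun o : Obs 𝒳 => (ξ.pi o.1 - η.pi o.1) * envelope η o,
    ← eLpNorm_norm fun o : Obs 𝒳 => (ξ.e o.1 - η.e o.1) * envelope η o,
    ← eLpNorm_norm fun o : Obs 𝒳 => ξ.mu1 o.1 - η.mu1 o.1,
    ← eLpNorm_norm fun o : Obs 𝒳 => ξ.mu0 o.1 - η.mu0 o.1]
  exact (eLpNorm_add_le ((he.add hpi).add h1).aestronglyMeasurable h0.aestronglyMeasurable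
    one_le_two).trans (add_le_add_left ((eLpNorm_add_le (he.add hpi).aestronglyMeasurable
      h1.aestronglyMeasurable one_le_two).trans (add_le_add_left (eLpNorm_add_le
        he.aestronglyMeasurable hpi.aestronglyMeasurable one_le_two) _)) _)

lemma ae_abs_e_sub_le_one {κ' : ℝ} (hη : IsAdmissible ν η κ) (hξ : IsAdmissible ν ξ κ') :
    ∀ᵐ x ∂ν, |ξ.e x - η.e x| ≤ 1 := by
  filter_upwards [hη.e_mem, hξ.e_mem] with x hx hx'
  have hκ := hη.pos
  have hκ' := hξ.pos
  exact abs_le.2 ⟨by linarith [hx.2, hx'.1], by linarith [hx.1, hx'.2]⟩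

lemma ae_abs_pi_sub_le_one {κ' : ℝ} (hη : IsAdmissible ν η κ) (hξ : IsAdmissible ν ξ κ') :
    ∀ᵐ x ∂ν, |ξ.pi x - η.pi x| ≤ 1 := by
  filter_upwards [hη.pi_mem, hξ.pi_mem] with x hx hx'
  exact abs_le.2 ⟨by linarith [hx.2, hx'.1], by linarith [hx.1, hx'.2]⟩

lemma exists_eLpNorm_nuisanceGap_le [IsFiniteMeasure ρ] (hη : IsAdmissible (ρ.map Prod.fst) η κ)
    (hY : MemLp outcome 2 ρ) {γ : ℝ} (hγ : 0 < γ) :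
    ∃ δ : ℝ, 0 < δ ∧ ∀ ξ, IsAdmissible (ρ.map Prod.fst) ξ κ →
      nuisanceErr (ρ.map Prod.fst) ξ η ≤ ENNReal.ofReal δ →
      eLpNorm (nuisanceGap ξ η) 2 ρ ≤ ENNReal.ofReal γ := by
  have hH := measurable_envelope hη.measurable_mu1 hη.measurable_mu0
  have hγ4 : 0 < γ / 4 := by positivity
  obtain ⟨δ, hδ, hmul⟩ := exists_eLpNorm_mul_le one_le_two hH.stronglyMeasurable
    (hη.memLp_envelope hY) hγ4
  refine ⟨min δ (γ / 4), lt_min hδ hγ4, fun ξ hξ herr => ?_⟩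
  have hle : ∀ {t : ℝ≥0∞}, t ≤ nuisanceErr (ρ.map Prod.fst) ξ η →
      t ≤ ENNReal.ofReal δ ∧ t ≤ ENNReal.ofReal (γ / 4) := fun ht =>
    ⟨(ht.trans herr).trans (ENNReal.ofReal_le_ofReal (min_le_left _ _)),
      (ht.trans herr).trans (ENNReal.ofReal_le_ofReal (min_le_right _ _))⟩
  have he : l2err (ρ.map Prod.fst) ξ.e η.e ≤ nuisanceErr (ρ.map Prod.fst) ξ η :=
    (le_self_add.trans le_self_add).trans le_self_add
  have hpi : l2err (ρ.map Prod.fst) ξ.pi η.pi ≤ nuisanceErr (ρ.map Prod.fst) ξ η :=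
    (le_add_self.trans le_self_add).trans le_self_add
  have h1 : l2err (ρ.map Prod.fst) ξ.mu1 η.mu1 ≤ nuisanceErr (ρ.map Prod.fst) ξ η :=
    le_add_self.trans le_self_add
  have h0 : l2err (ρ.map Prod.fst) ξ.mu0 η.mu0 ≤ nuisanceErr (ρ.map Prod.fst) ξ η := le_add_self
  calc eLpNorm (nuisanceGap ξ η) 2 ρ
      ≤ ENNReal.ofReal (γ / 4) + ENNReal.ofReal (γ / 4) + ENNReal.ofReal (γ / 4)
        + ENNReal.ofReal (γ / 4) := by
        refine (hη.eLpNorm_nuisanceGap_le hξ).trans (add_le_add (add_le_add (add_le_add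
          (hmul _ ?_ ?_ ?_) (hmul _ ?_ ?_ ?_)) (hle h1).2) (hle h0).2)
        · exact ((hξ.measurable_e.sub hη.measurable_e).comp measurable_fst).aestronglyMeasurable
        · exact ae_of_ae_map measurable_fst.aemeasurable (hη.ae_abs_e_sub_le_one hξ)
        · exact (l2err_map_fst hξ.measurable_e hη.measurable_e).ge.trans (hle he).1
        · exact ((hξ.measurable_pi.sub hη.measurable_pi).comp measurable_fst).aestronglyMeasurable
        · exact ae_of_ae_map measurable_fst.aemeasurable (hη.ae_abs_pi_sub_le_one hξ)
        · exact (l2err_map_fst hξ.measurable_pi hη.measurable_pi).ge.trans (hle hpi).1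
    _ = ENNReal.ofReal γ := by
        rw [← ENNReal.ofReal_add, ← ENNReal.ofReal_add, ← ENNReal.ofReal_add] <;> try positivity
        congr 1
        ring

theorem exists_eLpNorm_score_sub_le [IsFiniteMeasure ρ] (hη : IsAdmissible (ρ.map Prod.fst) η κ)
    (hY : MemLp outcome 2 ρ) (c : Bool) (a b : ℝ) {γ : ℝ} (hγ : 0 < γ) :
    ∃ δ : ℝ, 0 < δ ∧ ∀ ξ, IsAdmissible (ρ.map Prod.fst) ξ κ →
      nuisanceErr (ρ.map Prod.fst) ξ η ≤ ENNReal.ofReal δ →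
      eLpNorm (fun o => score c a b ξ o - score c a b η o) 2 ρ ≤ ENNReal.ofReal γ := by
  set L := (3 * |a| + |b|) * (1 + κ⁻¹) ^ 2
  have hL : 0 ≤ L := by positivity
  have hγL : 0 < γ / (L + 1) := by positivity
  obtain ⟨δ, hδ, hgap⟩ := hη.exists_eLpNorm_nuisanceGap_le hY hγL
  refine ⟨δ, hδ, fun ξ hξ herr => ?_⟩
  have hpointwise : ∀ᵐ o ∂ρ, ‖score c a b ξ o - score c a b η o‖ ≤ L * ‖nuisanceGap ξ η o‖ := by
    filter_upwards [ae_of_ae_map measurable_fst.aemeasurable hη.e_mem,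
      ae_of_ae_map measurable_fst.aemeasurable hξ.e_mem,
      ae_of_ae_map measurable_fst.aemeasurable hη.pi_mem,
      ae_of_ae_map measurable_fst.aemeasurable hξ.pi_mem] with o he he' hpi hpi'
    rw [Real.norm_of_nonneg (nuisanceGap_nonneg ξ η o)]
    exact abs_score_sub_le c a b hη.pos he he' hpi hpi'
  calc eLpNorm (fun o => score c a b ξ o - score c a b η o) 2 ρ
      ≤ ENNReal.ofReal L * ENNReal.ofReal (γ / (L + 1)) :=
        (eLpNorm_le_mul_eLpNorm_of_ae_le_mul hpointwise 2).trans
          (mul_le_mul_right (hgap ξ hξ herr) _)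
    _ ≤ ENNReal.ofReal γ := by
        rw [← ENNReal.ofReal_mul hL]
        refine ENNReal.ofReal_le_ofReal ?_
        rw [← mul_div_assoc, div_le_iff₀ (by positivity)]
        nlinarith

end IsAdmissible

end MeanSquareError

section SecondOrderBias

/-- The sum of the products of `L²(ν)` errors which bound the bias of `score`. -/
noncomputable def productErr {𝒳 : Type*} [MeasurableSpace 𝒳] (ν : Measure 𝒳)
    (ξ η : Nuisance 𝒳) : ℝ≥0∞ :=
  l2err ν ξ.e η.e * l2err ν ξ.pi η.pi + l2err ν ξ.e η.e * l2err ν ξ.mu1 η.mu1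
    + l2err ν ξ.e η.e * l2err ν ξ.mu0 η.mu0 + l2err ν ξ.pi η.pi * l2err ν ξ.mu0 η.mu0

/-- The pointwise counterpart of `productErr`. -/
def productGap {𝒳 : Type*} (ξ η : Nuisance 𝒳) (x : 𝒳) : ℝ :=
  |ξ.e x - η.e x| * |ξ.pi x - η.pi x| + |ξ.e x - η.e x| * |ξ.mu1 x - η.mu1 x|
    + |ξ.e x - η.e x| * |ξ.mu0 x - η.mu0 x| + |ξ.pi x - η.pi x| * |ξ.mu0 x - η.mu0 x|

variable {𝒳 : Type*} {η ξ : Nuisance 𝒳} {κ ε a b B : ℝ}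

lemma productGap_nonneg {𝒳 : Type*} (ξ η : Nuisance 𝒳) (x : 𝒳) : 0 ≤ productGap ξ η x := by
  unfold productGap
  positivity

lemma abs_add_le_of_le {r s u v : ℝ} (hr : |r| ≤ u) (hs : |s| ≤ v) : |r + s| ≤ u + v :=
  (abs_add_le r s).trans (add_le_add hr hs)

lemma abs_mul_le_of_le {r s u v : ℝ} (hr : |r| ≤ u) (hs : |s| ≤ v) : |r * s| ≤ u * v :=
  (abs_mul r s).trans_le (mul_le_mul hr hs (abs_nonneg s) ((abs_nonneg r).trans hr))

lemma mul_add_mul_le_mul_add_mul_add {k α β B u v w z : ℝ} (hk : 0 ≤ k) (hα : 0 ≤ α)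
    (hβ : 0 ≤ β) (hB : 0 ≤ B) (hu : 0 ≤ u) (hv : 0 ≤ v) (hw : 0 ≤ w) (hz : 0 ≤ z) :
    k * u * (α * (w + B * v + z) + β * v) + α * (k * u * z + v * z)
      ≤ (α * (k * (B + 2) + 1) + β * k) * (u * v + u * w + u * z + v * z) := by
  rw [← sub_nonneg]
  ring_nf
  positivity

lemma abs_scoreBias_le_productGap {x : 𝒳} (hκ : 0 < κ) (hξ : κ ≤ ξ.e x ∧ ξ.e x ≤ 1 - κ)
    (hp : 0 ≤ η.pi x ∧ η.pi x ≤ 1) (hp' : 0 ≤ ξ.pi x ∧ ξ.pi x ≤ 1)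
    (hB : |η.mu1 x - η.mu0 x| ≤ B) :
    |scoreBias a b η.e η.pi (fun x => η.pi x * η.mu1 x) η.mu0 ξ x|
      ≤ (|a| * (κ⁻¹ * (B + 2) + 1) + |b| * κ⁻¹) * productGap ξ η x := by
  have hratio : ∀ {t : ℝ}, κ ≤ t → |(η.e x - ξ.e x) / t| ≤ κ⁻¹ * |ξ.e x - η.e x| := fun ht => by
    rw [abs_div, abs_of_pos (hκ.trans_le ht), div_eq_inv_mul, abs_sub_comm]
    exact mul_le_mul_of_nonneg_right (inv_anti₀ hκ ht) (abs_nonneg _)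
  have hpi1 : |η.pi x - ξ.pi x| ≤ 1 := abs_le.2 ⟨by linarith, by linarith⟩
  calc |scoreBias a b η.e η.pi (fun x => η.pi x * η.mu1 x) η.mu0 ξ x|
      = |(η.e x - ξ.e x) / ξ.e x * (a * (ξ.pi x * (η.mu1 x - ξ.mu1 x)
            + (η.mu1 x - η.mu0 x) * (η.pi x - ξ.pi x)
            + (η.pi x - ξ.pi x) * (η.mu0 x - ξ.mu0 x)) + b * (η.pi x - ξ.pi x))
          + a * (ξ.pi x * ((η.e x - ξ.e x) / (1 - ξ.e x) * (η.mu0 x - ξ.mu0 x))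
            + (η.pi x - ξ.pi x) * (η.mu0 x - ξ.mu0 x))| := by
        congr 1
        unfold scoreBias
        ring
    _ ≤ κ⁻¹ * |ξ.e x - η.e x| * (|a| * (1 * |ξ.mu1 x - η.mu1 x| + B * |ξ.pi x - η.pi x|
            + 1 * |ξ.mu0 x - η.mu0 x|) + |b| * |ξ.pi x - η.pi x|)
          + |a| * (1 * (κ⁻¹ * |ξ.e x - η.e x| * |ξ.mu0 x - η.mu0 x|)
            + |ξ.pi x - η.pi x| * |ξ.mu0 x - η.mu0 x|) := by
        have hξpi : |ξ.pi x| ≤ 1 := abs_le.2 ⟨by linarith, hp'.2⟩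
        simp only [abs_sub_comm (ξ.mu1 x), abs_sub_comm (ξ.mu0 x), abs_sub_comm (ξ.pi x)]
        exact abs_add_le_of_le (abs_mul_le_of_le (hratio hξ.1) (abs_add_le_of_le
          (abs_mul_le_of_le le_rfl (abs_add_le_of_le (abs_add_le_of_le
            (abs_mul_le_of_le hξpi le_rfl) (abs_mul_le_of_le hB le_rfl))
              (abs_mul_le_of_le hpi1 le_rfl)))
          (abs_mul_le_of_le le_rfl le_rfl))) (abs_mul_le_of_le le_rfl (abs_add_le_of_le
            (abs_mul_le_of_le hξpi (abs_mul_le_of_le (hratio (by linarith)) le_rfl))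
            (abs_mul_le_of_le le_rfl le_rfl)))
    _ ≤ _ := by
        simp only [one_mul]
        exact mul_add_mul_le_mul_add_mul_add (inv_nonneg.2 hκ.le) (abs_nonneg a) (abs_nonneg b)
          ((abs_nonneg _).trans hB) (abs_nonneg _) (abs_nonneg _) (abs_nonneg _) (abs_nonneg _)

lemma integrable_abs_mul_abs {α : Type*} [MeasurableSpace α] {μ : Measure α} {f g : α → ℝ}
    (hf : MemLp f 2 μ) (hg : MemLp g 2 μ) : Integrable (fun x => |f x| * |g x|) μ :=
  hf.abs.integrable_mul hg.abs

lemma ofReal_integral_abs_mul_abs_le {α : Type*} [MeasurableSpace α] {μ : Measure α} {f g : α → ℝ}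
    (hf : MemLp f 2 μ) (hg : MemLp g 2 μ) :
    ENNReal.ofReal (∫ x, |f x| * |g x| ∂μ) ≤ eLpNorm f 2 μ * eLpNorm g 2 μ := by
  calc ENNReal.ofReal (∫ x, |f x| * |g x| ∂μ)
      = eLpNorm (f • g) 1 μ := by
        simp only [← abs_mul]
        rw [eLpNorm_one_eq_lintegral_enorm]
        exact ofReal_integral_norm_eq_lintegral_enorm (hf.integrable_mul hg)
    _ ≤ eLpNorm f 2 μ * eLpNorm g 2 μ :=
        eLpNorm_smul_le_mul_eLpNorm hg.aestronglyMeasurable hf.aestronglyMeasurable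

variable [MeasurableSpace 𝒳] {ρ : Measure (Obs 𝒳)} {c : Bool}

namespace IsAdmissible

variable [IsFiniteMeasure ρ] (hξ : IsAdmissible (ρ.map Prod.fst) ξ κ)
  (hη : IsAdmissible (ρ.map Prod.fst) η ε)

include hξ hη

lemma memLp_nuisance_sub : MemLp (fun o : Obs 𝒳 => ξ.e o.1 - η.e o.1) 2 ρ ∧
    MemLp (fun o : Obs 𝒳 => ξ.pi o.1 - η.pi o.1) 2 ρ ∧
    MemLp (fun o : Obs 𝒳 => ξ.mu1 o.1 - η.mu1 o.1) 2 ρ ∧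
    MemLp (fun o : Obs 𝒳 => ξ.mu0 o.1 - η.mu0 o.1) 2 ρ := by
  refine ⟨?_, ?_, hξ.memLp_mu1_comp.sub hη.memLp_mu1_comp, hξ.memLp_mu0_comp.sub hη.memLp_mu0_comp⟩
  · exact .of_bound ((hξ.measurable_e.sub hη.measurable_e).comp measurable_fst).aestronglyMeasurable
      1 (ae_of_ae_map measurable_fst.aemeasurable (hη.ae_abs_e_sub_le_one hξ))
  · exact .of_bound
      ((hξ.measurable_pi.sub hη.measurable_pi).comp measurable_fst).aestronglyMeasurable
      1 (ae_of_ae_map measurable_fst.aemeasurable (hη.ae_abs_pi_sub_le_one hξ))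

lemma integrable_productGap : Integrable (fun o => productGap ξ η o.1) ρ := by
  obtain ⟨he, hpi, h1, h0⟩ := hξ.memLp_nuisance_sub hη
  exact (((integrable_abs_mul_abs he hpi).add (integrable_abs_mul_abs he h1)).add
    (integrable_abs_mul_abs he h0)).add (integrable_abs_mul_abs hpi h0)

lemma ofReal_integral_productGap_le : ENNReal.ofReal (∫ o, productGap ξ η o.1 ∂ρ)
    ≤ productErr (ρ.map Prod.fst) ξ η := by
  obtain ⟨he, hpi, h1, h0⟩ := hξ.memLp_nuisance_sub hη
  have hepi := integrable_abs_mul_abs he hpi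
  have he1 := integrable_abs_mul_abs he h1
  have he0 := integrable_abs_mul_abs he h0
  have hpi0 := integrable_abs_mul_abs hpi h0
  unfold productGap productErr
  rw [integral_add ((hepi.fun_add he1).fun_add he0) hpi0,
    integral_add (hepi.fun_add he1) he0, integral_add hepi he1,
    l2err_map_fst hξ.measurable_e hη.measurable_e,
    l2err_map_fst hξ.measurable_pi hη.measurable_pi,
    l2err_map_fst hξ.measurable_mu1 hη.measurable_mu1,
    l2err_map_fst hξ.measurable_mu0 hη.measurable_mu0]
  refine ENNReal.ofReal_add_le.trans (add_le_add (ENNReal.ofReal_add_le.trans (add_le_add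
    (ENNReal.ofReal_add_le.trans (add_le_add ?_ ?_)) ?_)) ?_)
  · exact ofReal_integral_abs_mul_abs_le he hpi
  · exact ofReal_integral_abs_mul_abs_le he h1
  · exact ofReal_integral_abs_mul_abs_le he h0
  · exact ofReal_integral_abs_mul_abs_le hpi h0

end IsAdmissible

theorem Identified.ofReal_abs_integral_score_sub_le [IsFiniteMeasure ρ] (h : Identified ρ c η ε)
    (hξ : IsAdmissible (ρ.map Prod.fst) ξ κ)
    (hB : ∀ᵐ x ∂ρ.map Prod.fst, |η.mu1 x - η.mu0 x| ≤ B) :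
    ENNReal.ofReal |∫ o, score c a b ξ o - score c a b η o ∂ρ|
      ≤ ENNReal.ofReal (|a| * (κ⁻¹ * (B + 2) + 1) + |b| * κ⁻¹)
        * productErr (ρ.map Prod.fst) ξ η := by
  set L := |a| * (κ⁻¹ * (B + 2) + 1) + |b| * κ⁻¹
  have hbias : ∀ᵐ o ∂ρ, |scoreBias a b η.e η.pi (fun x => η.pi x * η.mu1 x) η.mu0 ξ o.1|
      ≤ L * productGap ξ η o.1 := by
    refine ae_of_ae_map (p := fun x => |scoreBias a b η.e η.pi (fun x => η.pi x * η.mu1 x) η.mu0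
      ξ x| ≤ L * productGap ξ η x) measurable_fst.aemeasurable ?_
    filter_upwards [hξ.e_mem, h.admissible.pi_mem, hξ.pi_mem, hB] with x he hp hp' hBx
    exact abs_scoreBias_le_productGap hξ.pos he hp hp' hBx
  have hgap := hξ.integrable_productGap h.admissible
  have hdiff : |∫ o, score c a b ξ o - score c a b η o ∂ρ| ≤ L * ∫ o, productGap ξ η o.1 ∂ρ := by
    rw [integral_sub ((hξ.memLp_score c a b h.memLp_outcome).integrable one_le_two)
      (h.integrable_score a b), h.integral_score, abs_sub_comm, ← integral_const_mul]
    exact hξ.abs_integral_sub_integral_score_le h.memLp_outcome h.regressions (hgap.const_mul L)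
      hbias
  calc ENNReal.ofReal |∫ o, score c a b ξ o - score c a b η o ∂ρ|
      ≤ ENNReal.ofReal (L * ∫ o, productGap ξ η o.1 ∂ρ) := ENNReal.ofReal_le_ofReal hdiff
    _ = ENNReal.ofReal L * ENNReal.ofReal (∫ o, productGap ξ η o.1 ∂ρ) :=
        ENNReal.ofReal_mul' (integral_nonneg fun o => productGap_nonneg ξ η o.1)
    _ ≤ ENNReal.ofReal L * productErr (ρ.map Prod.fst) ξ η :=
        mul_le_mul_right (hξ.ofReal_integral_productGap_le h.admissible) _

end SecondOrderBias

section ConsistentEstimates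

lemma ae_inv_le_of_invSup_le {𝒳 : Type*} [MeasurableSpace 𝒳] {ν : Measure 𝒳} {f : 𝒳 → ℝ} {M : ℝ}
    (hM : 0 < M) (h : invSup ν f ≤ ENNReal.ofReal M) : ∀ᵐ x ∂ν, M⁻¹ ≤ f x := by
  filter_upwards [ENNReal.ae_le_essSup fun x => (ENNReal.ofReal (f x))⁻¹] with x hx
  have hinv : (ENNReal.ofReal (f x))⁻¹ ≤ ENNReal.ofReal M := hx.trans h
  rw [ENNReal.inv_le_iff_inv_le, ← ENNReal.ofReal_inv_of_pos hM,
    ENNReal.ofReal_le_ofReal_iff'] at hinv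
  exact hinv.resolve_right (inv_pos.2 hM).not_ge

lemma memLp_of_l2err_ne_top {𝒳 : Type*} [MeasurableSpace 𝒳] {ν : Measure 𝒳} {f g : 𝒳 → ℝ}
    (hf : Measurable f) (hg : MemLp g 2 ν) (h : l2err ν f g ≠ ∞) : MemLp f 2 ν := by
  have hsub : MemLp (fun x => f x - g x) 2 ν :=
    ⟨hf.aestronglyMeasurable.sub hg.aestronglyMeasurable, h.lt_top⟩
  simpa only [Pi.add_def, sub_add_cancel] using hsub.add hg

/-- Random nuisance estimates `ξ n` of `η` which, in `L²(ν)`, are consistent, have bounded inverse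
propensity scores in probability, and have products of errors negligible at the rate `√n`. -/
structure ConsistentEstimates {Ω 𝒳 : Type*} [MeasurableSpace Ω] [MeasurableSpace 𝒳]
    (Q : Measure Ω) (ν : Measure 𝒳) (η : Nuisance 𝒳) (ξ : ℕ → Ω → Nuisance 𝒳) : Prop where
  isMeasurable : ∀ n ω, (ξ n ω).IsMeasurable
  pi_mem : ∀ n ω x, 0 ≤ (ξ n ω).pi x ∧ (ξ n ω).pi x ≤ 1
  e : IsLittleOP Q (fun n ω => l2err ν (ξ n ω).e η.e) fun _ => 1
  pi : IsLittleOP Q (fun n ω => l2err ν (ξ n ω).pi η.pi) fun _ => 1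
  mu1 : IsLittleOP Q (fun n ω => l2err ν (ξ n ω).mu1 η.mu1) fun _ => 1
  mu0 : IsLittleOP Q (fun n ω => l2err ν (ξ n ω).mu0 η.mu0) fun _ => 1
  inv1 : IsBigOP Q (fun n ω => invSup ν (ξ n ω).e) fun _ => 1
  inv0 : IsBigOP Q (fun n ω => invSup ν fun x => 1 - (ξ n ω).e x) fun _ => 1
  e_pi : IsLittleOP Q (fun n ω => l2err ν (ξ n ω).e η.e * l2err ν (ξ n ω).pi η.pi)
    fun n => (n : ℝ) ^ (-(1 / 2) : ℝ)
  e_mu1 : IsLittleOP Q (fun n ω => l2err ν (ξ n ω).e η.e * l2err ν (ξ n ω).mu1 η.mu1)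
    fun n => (n : ℝ) ^ (-(1 / 2) : ℝ)
  e_mu0 : IsLittleOP Q (fun n ω => l2err ν (ξ n ω).e η.e * l2err ν (ξ n ω).mu0 η.mu0)
    fun n => (n : ℝ) ^ (-(1 / 2) : ℝ)
  pi_mu0 : IsLittleOP Q (fun n ω => l2err ν (ξ n ω).pi η.pi * l2err ν (ξ n ω).mu0 η.mu0)
    fun n => (n : ℝ) ^ (-(1 / 2) : ℝ)

/-- The quantity whose boundedness makes a nuisance estimate admissible: the larger of the two
suprema of inverse propensity scores and of the total error. -/
noncomputable def admissibilityBound {𝒳 : Type*} [MeasurableSpace 𝒳] (ν : Measure 𝒳)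
    (ξ η : Nuisance 𝒳) : ℝ≥0∞ :=
  max (max (invSup ν ξ.e) (invSup ν fun x => 1 - ξ.e x)) (nuisanceErr ν ξ η)

namespace ConsistentEstimates

variable {Ω 𝒳 : Type*} [MeasurableSpace Ω] [MeasurableSpace 𝒳] {Q : Measure Ω} {ν : Measure 𝒳}
  {ρ : Measure (Obs 𝒳)} {c : Bool} {η : Nuisance 𝒳} {ξ : ℕ → Ω → Nuisance 𝒳} {ε M B : ℝ}

lemma isLittleOP_nuisanceErr (h : ConsistentEstimates Q ν η ξ) :
    IsLittleOP Q (fun n ω => nuisanceErr ν (ξ n ω) η) fun _ => 1 :=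
  ((h.e.add h.pi).add h.mu1).add h.mu0

lemma isLittleOP_productErr (h : ConsistentEstimates Q ν η ξ) :
    IsLittleOP Q (fun n ω => productErr ν (ξ n ω) η) fun n => (n : ℝ) ^ (-(1 / 2) : ℝ) :=
  ((h.e_pi.add h.e_mu1).add h.e_mu0).add h.pi_mu0

lemma isBigOP_admissibilityBound (h : ConsistentEstimates Q ν η ξ) :
    IsBigOP Q (fun n ω => admissibilityBound ν (ξ n ω) η) fun _ => 1 :=
  .max (fun _ => zero_le_one) (.max (fun _ => zero_le_one) h.inv1 h.inv0)
    h.isLittleOP_nuisanceErr.isBigOP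

lemma isAdmissible (h : ConsistentEstimates Q ν η ξ) (hη : IsAdmissible ν η ε) {n : ℕ} {ω : Ω}
    (hM : admissibilityBound ν (ξ n ω) η ≤ ENNReal.ofReal M) :
    IsAdmissible ν (ξ n ω) (max M 1)⁻¹ := by
  have hM1 : 0 < max M 1 := one_pos.trans_le (le_max_right M 1)
  have hbound : admissibilityBound ν (ξ n ω) η ≤ ENNReal.ofReal (max M 1) :=
    hM.trans (ENNReal.ofReal_le_ofReal (le_max_left M 1))
  obtain ⟨hinv, herr⟩ := max_le_iff.1 hbound
  obtain ⟨hinv1, hinv0⟩ := max_le_iff.1 hinv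
  have herr_top := (herr.trans_lt ENNReal.ofReal_lt_top).ne
  simp only [nuisanceErr, ne_eq, ENNReal.add_eq_top, not_or] at herr_top
  have hmeas := h.isMeasurable n ω
  refine ⟨hmeas, inv_pos.2 hM1, ?_, .of_forall (h.pi_mem n ω),
    memLp_of_l2err_ne_top hmeas.measurable_mu1 hη.memLp_mu1 herr_top.1.2,
    memLp_of_l2err_ne_top hmeas.measurable_mu0 hη.memLp_mu0 herr_top.2⟩
  filter_upwards [ae_inv_le_of_invSup_le hM1 hinv1, ae_inv_le_of_invSup_le hM1 hinv0]
    with x h1 h0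
  exact ⟨h1, by linarith⟩

theorem isLittleOP_eLpNorm_score_sub [IsFiniteMeasure ρ]
    (h : ConsistentEstimates Q (ρ.map Prod.fst) η ξ) (hη : IsAdmissible (ρ.map Prod.fst) η ε)
    (hY : MemLp outcome 2 ρ) (a b : ℝ) :
    IsLittleOP Q (fun n ω => eLpNorm (fun o => score c a b (ξ n ω) o - score c a b η o) 2 ρ)
      fun _ => 1 := by
  refine isLittleOP_of_forall_bounded h.isBigOP_admissibilityBound h.isLittleOP_nuisanceErr
    fun M γ hγ => ?_
  have hκ : 0 < min (max M 1)⁻¹ ε :=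
    lt_min (inv_pos.2 (one_pos.trans_le (le_max_right M 1))) hη.pos
  obtain ⟨δ, hδ, hle⟩ :=
    (hη.mono hκ (min_le_right _ _)).exists_eLpNorm_score_sub_le hY c a b hγ
  refine ⟨δ, hδ, fun n ω hM herr => ?_⟩
  rw [mul_one] at herr ⊢
  exact hle _ ((h.isAdmissible hη hM).mono hκ (min_le_left _ _)) herr

theorem isLittleOP_abs_integral_score_sub [IsFiniteMeasure ρ]
    (h : ConsistentEstimates Q (ρ.map Prod.fst) η ξ) (hη : Identified ρ c η ε)
    (hB : ∀ᵐ x ∂ρ.map Prod.fst, |η.mu1 x - η.mu0 x| ≤ B) (a b : ℝ) :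
    IsLittleOP Q
      (fun n ω => ENNReal.ofReal |∫ o, score c a b (ξ n ω) o - score c a b η o ∂ρ|)
      fun n => (n : ℝ) ^ (-(1 / 2) : ℝ) := by
  refine isLittleOP_of_forall_bounded h.isBigOP_admissibilityBound h.isLittleOP_productErr
    fun M γ hγ => ?_
  set L := |a| * ((max M 1)⁻¹⁻¹ * (B + 2) + 1) + |b| * (max M 1)⁻¹⁻¹
  refine ⟨γ / (|L| + 1), by positivity, fun n ω hM herr => ?_⟩
  have hrate : (0 : ℝ) ≤ (n : ℝ) ^ (-(1 / 2) : ℝ) := by positivity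
  calc ENNReal.ofReal |∫ o, score c a b (ξ n ω) o - score c a b η o ∂ρ|
      ≤ ENNReal.ofReal L * ENNReal.ofReal (γ / (|L| + 1) * (n : ℝ) ^ (-(1 / 2) : ℝ)) :=
        (hη.ofReal_abs_integral_score_sub_le (h.isAdmissible hη.admissible hM) hB).trans
          (mul_le_mul_right herr _)
    _ = ENNReal.ofReal (L * (γ / (|L| + 1)) * (n : ℝ) ^ (-(1 / 2) : ℝ)) := by
        rw [← ENNReal.ofReal_mul' (by positivity), mul_assoc]
    _ ≤ ENNReal.ofReal (γ * (n : ℝ) ^ (-(1 / 2) : ℝ)) := by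
        refine ENNReal.ofReal_le_ofReal (mul_le_mul_of_nonneg_right ?_ hrate)
        rw [← mul_div_assoc, div_le_iff₀ (by positivity)]
        nlinarith [le_abs_self L]

end ConsistentEstimates

end ConsistentEstimates

section SampleSplitting

variable {ι Ω 𝒪 𝒯 : Type*} [MeasurableSpace Ω] [MeasurableSpace 𝒪] [MeasurableSpace 𝒯]
  {Q : Measure Ω} {ρ : Measure 𝒪} {O : ι → Ω → 𝒪} {I : Finset ι} {f : 𝒪 → ℝ}

lemma variance_le_sq_of_eLpNorm_le [IsProbabilityMeasure ρ] (hf : MemLp f 2 ρ) {κ : ℝ}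
    (hκ : 0 ≤ κ) (hle : eLpNorm f 2 ρ ≤ ENNReal.ofReal κ) : Var[f; ρ] ≤ κ ^ 2 := by
  refine (variance_le_expectation_sq hf.aestronglyMeasurable).trans ?_
  rw [hf.eLpNorm_eq_integral_rpow_norm two_ne_zero ENNReal.ofNat_ne_top,
    ENNReal.ofReal_le_ofReal_iff hκ] at hle
  simp only [ENNReal.toReal_ofNat, Real.rpow_ofNat, Real.norm_eq_abs, sq_abs,
    ← one_div, ← Real.sqrt_eq_rpow] at hle
  exact (Real.sqrt_le_left hκ).1 hle

lemma integral_sum_comp (hO : ∀ i, MeasurePreserving (O i) Q ρ) (hf : Integrable f ρ) :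
    ∫ ω, ∑ i ∈ I, f (O i ω) ∂Q = I.card * ∫ o, f o ∂ρ := by
  have hcomp : ∀ i ∈ I, Integrable (fun ω => f (O i ω)) Q := fun i _ =>
    (hO i).integrable_comp_of_integrable hf
  rw [integral_finsetSum _ hcomp]
  have hint : ∀ i, ∫ ω, f (O i ω) ∂Q = ∫ o, f o ∂ρ := fun i => by
    rw [← (hO i).map_eq, integral_map (hO i).aemeasurable]
    exact (hO i).map_eq ▸ hf.aestronglyMeasurable
  simp only [hint, Finset.sum_const, nsmul_eq_mul]

lemma variance_sum_comp [IsProbabilityMeasure Q] (hO : ∀ i, MeasurePreserving (O i) Q ρ)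
    (hindep : iIndepFun O Q) (hf : Measurable f) (hf2 : MemLp f 2 ρ) :
    Var[fun ω => ∑ i ∈ I, f (O i ω); Q] = I.card * Var[f; ρ] := by
  have hvar : ∀ i, Var[f ∘ O i; Q] = Var[f; ρ] := fun i => by
    rw [← (hO i).map_eq, variance_map hf.aemeasurable (hO i).aemeasurable]
  have hsum := IndepFun.variance_sum (X := fun i => f ∘ O i) (s := I)
    (fun i _ => hf2.comp_measurePreserving (hO i))
    fun i _ j _ hij => (hindep.indepFun hij).comp hf hf
  simp only [hvar, Finset.sum_const, nsmul_eq_mul] at hsum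
  rw [← hsum]
  congr 1 with ω
  simp only [Finset.sum_apply, Function.comp_apply]

lemma measure_two_mul_le_abs_sum_le [IsProbabilityMeasure Q]
    (hO : ∀ i, MeasurePreserving (O i) Q ρ) (hindep : iIndepFun O Q) (hf : Measurable f)
    {κ r : ℝ} (hκ : 0 ≤ κ) (hle : eLpNorm f 2 ρ ≤ ENNReal.ofReal κ) (hr : 0 < r)
    (hmean : I.card * |∫ o, f o ∂ρ| ≤ r) :
    Q {ω | 2 * r ≤ |∑ i ∈ I, f (O i ω)|} ≤ ENNReal.ofReal (I.card * κ ^ 2 / r ^ 2) := by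
  rcases I.eq_empty_or_nonempty with rfl | ⟨i, -⟩
  · simp [show ¬2 * r ≤ 0 by linarith]
  have : IsProbabilityMeasure ρ :=
    (hO i).map_eq ▸ Measure.isProbabilityMeasure_map (hO i).aemeasurable
  have hf2 : MemLp f 2 ρ := ⟨hf.aestronglyMeasurable, hle.trans_lt ENNReal.ofReal_lt_top⟩
  have hsum2 : MemLp (fun ω => ∑ i ∈ I, f (O i ω)) 2 Q :=
    memLp_finsetSum I fun i _ => hf2.comp_measurePreserving (hO i)
  calc Q {ω | 2 * r ≤ |∑ i ∈ I, f (O i ω)|}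
      ≤ Q {ω | r ≤ |∑ i ∈ I, f (O i ω) - ∫ ω, ∑ i ∈ I, f (O i ω) ∂Q|} := by
        refine measure_mono fun ω hω => ?_
        have hsplit := abs_sub_abs_le_abs_sub (∑ i ∈ I, f (O i ω)) (I.card * ∫ o, f o ∂ρ)
        rw [abs_mul, Nat.abs_cast] at hsplit
        rw [Set.mem_ofPred_eq] at hω
        rw [Set.mem_ofPred_eq, integral_sum_comp hO (hf2.integrable one_le_two)]
        linarith
    _ ≤ ENNReal.ofReal (Var[fun ω => ∑ i ∈ I, f (O i ω); Q] / r ^ 2) :=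
        meas_ge_le_variance_div_sq hsum2 hr
    _ ≤ ENNReal.ofReal (I.card * κ ^ 2 / r ^ 2) := by
        rw [variance_sum_comp hO hindep hf hf2]
        gcongr
        exact variance_le_sq_of_eLpNorm_le hf2 hκ hle

lemma measure_prodMk_mem_le_of_indepFun [IsProbabilityMeasure Q] {𝒰 : Type*} [MeasurableSpace 𝒰]
    {T : Ω → 𝒯} {U : Ω → 𝒰} (hT : Measurable T) (hU : Measurable U) (hTU : IndepFun T U Q)
    {A : Set (𝒯 × 𝒰)} (hA : MeasurableSet A) {τ : ℝ≥0∞}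
    (hτ : ∀ t, Q {ω | (t, U ω) ∈ A} ≤ τ) : Q {ω | (T ω, U ω) ∈ A} ≤ τ := by
  have hprob : IsProbabilityMeasure (Q.map T) := Measure.isProbabilityMeasure_map hT.aemeasurable
  calc Q {ω | (T ω, U ω) ∈ A}
      = ∫⁻ t, (Q.map U) (Prod.mk t ⁻¹' A) ∂Q.map T := by
        rw [← Measure.prod_apply hA, ← (indepFun_iff_map_prod_eq_prod_map_map hT.aemeasurable
          hU.aemeasurable).1 hTU, Measure.map_apply (hT.prodMk hU) hA]
        rfl
    _ ≤ ∫⁻ _, τ ∂Q.map T := by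
        refine lintegral_mono fun t => ?_
        rw [Measure.map_apply hU (measurable_prodMk_left hA)]
        exact hτ t
    _ = τ := by rw [lintegral_const, measure_univ, mul_one]

lemma measure_mem_and_two_mul_le_abs_sum_le [IsProbabilityMeasure Q]
    (hO : ∀ i, MeasurePreserving (O i) Q ρ) (hindep : iIndepFun O Q) {T : Ω → 𝒯}
    (hT : Measurable T) (hTI : IndepFun T (fun ω (i : I) => O i ω) Q) {g : 𝒯 × 𝒪 → ℝ}
    (hg : Measurable g) {G : Set 𝒯} (hG : MeasurableSet G) {κ r : ℝ} (hκ : 0 ≤ κ) (hr : 0 < r)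
    (hle : ∀ t ∈ G, eLpNorm (fun o => g (t, o)) 2 ρ ≤ ENNReal.ofReal κ)
    (hmean : ∀ t ∈ G, I.card * |∫ o, g (t, o) ∂ρ| ≤ r) :
    Q {ω | T ω ∈ G ∧ 2 * r ≤ |∑ i ∈ I, g (T ω, O i ω)|}
      ≤ ENNReal.ofReal (I.card * κ ^ 2 / r ^ 2) := by
  have hsum : Measurable fun p : 𝒯 × (I → 𝒪) => ∑ i : I, g (p.1, p.2 i) :=
    Finset.measurable_fun_sum _ fun i _ =>
      hg.comp (measurable_fst.prodMk ((measurable_pi_apply i).comp measurable_snd))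
  have hcoe : ∀ t ω, ∑ i ∈ I, g (t, O i ω) = ∑ i : I, g (t, O i ω) := fun t ω =>
    (Finset.sum_coe_sort I fun i => g (t, O i ω)).symm
  simp only [hcoe]
  refine measure_prodMk_mem_le_of_indepFun hT
    (measurable_pi_lambda _ fun i : I => (hO i).measurable) hTI
    (A := {p | p.1 ∈ G ∧ 2 * r ≤ |∑ i : I, g (p.1, p.2 i)|})
    ((measurable_fst hG).inter (measurableSet_le measurable_const hsum.abs)) fun t => ?_
  simp only [Set.mem_ofPred_eq, ← hcoe]
  by_cases ht : t ∈ G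
  · simp only [ht, true_and]
    exact measure_two_mul_le_abs_sum_le hO hindep (hg.comp measurable_prodMk_left) hκ (hle t ht) hr
      (hmean t ht)
  · simp only [ht, false_and, Set.ofPred_false, measure_empty, zero_le]

lemma measurable_eLpNorm_prodMk [SFinite ρ] {g : 𝒯 × 𝒪 → ℝ} (hg : Measurable g) :
    Measurable fun t => eLpNorm (fun o => g (t, o)) 2 ρ := by
  simp only [eLpNorm_eq_lintegral_rpow_enorm_toReal two_ne_zero ENNReal.ofNat_ne_top]
  exact ((hg.enorm.pow_const _).lintegral_prod_right').pow_const _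

lemma measurable_integral_prodMk [SFinite ρ] {g : 𝒯 × 𝒪 → ℝ} (hg : Measurable g) :
    Measurable fun t => ∫ o, g (t, o) ∂ρ :=
  hg.stronglyMeasurable.integral_prod_right'.measurable

lemma sqrt_mul_rpow_neg_half {x : ℝ} (hx : 0 < x) : √x * x ^ (-(1 / 2) : ℝ) = 1 := by
  rw [Real.rpow_neg hx.le, ← Real.sqrt_eq_rpow, mul_inv_cancel₀ (Real.sqrt_ne_zero'.2 hx)]

lemma measure_le_abs_inv_sqrt_mul_sum_le [IsProbabilityMeasure Q] [SFinite ρ]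
    (hO : ∀ i, MeasurePreserving (O i) Q ρ) (hindep : iIndepFun O Q) {T : Ω → 𝒯}
    (hT : Measurable T) (hTI : IndepFun T (fun ω (i : I) => O i ω) Q) {g : 𝒯 × 𝒪 → ℝ}
    (hg : Measurable g) {n : ℕ} (hn : 0 < n) (hcard : I.card ≤ n) {κ θ : ℝ} (hκ : 0 ≤ κ)
    (hθ : 0 < θ) :
    Q {ω | θ ≤ |(√n)⁻¹ * ∑ i ∈ I, g (T ω, O i ω)|}
      ≤ Q {ω | ENNReal.ofReal κ < eLpNorm (fun o => g (T ω, o)) 2 ρ}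
        + Q {ω | ENNReal.ofReal (θ / 2 * (n : ℝ) ^ (-(1 / 2) : ℝ))
            < ENNReal.ofReal |∫ o, g (T ω, o) ∂ρ|}
        + ENNReal.ofReal (4 * κ ^ 2 / θ ^ 2) := by
  have hn0 : (0 : ℝ) < n := Nat.cast_pos.2 hn
  have hsqrt : 0 < √(n : ℝ) := Real.sqrt_pos.2 hn0
  have hcard' : (I.card : ℝ) ≤ n := Nat.cast_le.2 hcard
  set G : Set 𝒯 := {t | eLpNorm (fun o => g (t, o)) 2 ρ ≤ ENNReal.ofReal κ ∧
    ENNReal.ofReal |∫ o, g (t, o) ∂ρ| ≤ ENNReal.ofReal (θ / 2 * (n : ℝ) ^ (-(1 / 2) : ℝ))}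
  have hG : MeasurableSet G := (measurableSet_le (measurable_eLpNorm_prodMk hg)
    measurable_const).inter (measurableSet_le
      (measurable_integral_prodMk hg).abs.ennreal_ofReal measurable_const)
  have hmean : ∀ t ∈ G, I.card * |∫ o, g (t, o) ∂ρ| ≤ θ * √n / 2 := fun t ht =>
    calc I.card * |∫ o, g (t, o) ∂ρ|
        ≤ n * (θ / 2 * (n : ℝ) ^ (-(1 / 2) : ℝ)) := by
          gcongr
          exact (ENNReal.ofReal_le_ofReal_iff (by positivity)).1 ht.2
      _ = θ * √n / 2 * (√n * (n : ℝ) ^ (-(1 / 2) : ℝ)) := by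
          nth_rw 1 [← Real.mul_self_sqrt hn0.le]
          ring
      _ = θ * √n / 2 := by rw [sqrt_mul_rpow_neg_half hn0, mul_one]
  have hvar : I.card * κ ^ 2 / (θ * √n / 2) ^ 2 ≤ 4 * κ ^ 2 / θ ^ 2 :=
    calc I.card * κ ^ 2 / (θ * √n / 2) ^ 2 ≤ n * κ ^ 2 / (θ * √n / 2) ^ 2 := by gcongr
      _ = 4 * κ ^ 2 / θ ^ 2 := by
          rw [div_pow, mul_pow, Real.sq_sqrt hn0.le]
          field_simp
          norm_num
  have hdev := (measure_mem_and_two_mul_le_abs_sum_le hO hindep hT hTI hg hG hκ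
    (by positivity : 0 < θ * √n / 2) (fun t ht => ht.1) hmean).trans
    (ENNReal.ofReal_le_ofReal hvar)
  refine (measure_mono fun ω hω => ?_).trans ((measure_union_le _ _).trans
    (add_le_add (measure_union_le _ _) hdev))
  rw [Set.mem_ofPred_eq, abs_mul, abs_inv, abs_of_pos hsqrt, inv_mul_eq_div,
    le_div_iff₀ hsqrt] at hω
  by_cases hTG : T ω ∈ G
  · exact Or.inr ⟨hTG, by rwa [mul_div_cancel₀ _ two_ne_zero]⟩
  · exact Or.inl ((not_and_or.1 hTG).imp not_le.1 not_le.1)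

theorem tendstoInMeasure_inv_sqrt_mul_sum [IsProbabilityMeasure Q] [SFinite ρ]
    (hO : ∀ i, MeasurePreserving (O i) Q ρ) (hindep : iIndepFun O Q)
    {𝒯 : ℕ → Type*} [∀ n, MeasurableSpace (𝒯 n)] {T : ∀ n, Ω → 𝒯 n} {I : ℕ → Finset ι}
    (hT : ∀ n, Measurable (T n)) (hTI : ∀ n, IndepFun (T n) (fun ω (i : I n) => O i ω) Q)
    (hcard : ∀ n, (I n).card ≤ n) {g : ∀ n, 𝒯 n × 𝒪 → ℝ} (hg : ∀ n, Measurable (g n))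
    (hnorm : IsLittleOP Q (fun n ω => eLpNorm (fun o => g n (T n ω, o)) 2 ρ) fun _ => 1)
    (hmean : IsLittleOP Q (fun n ω => ENNReal.ofReal |∫ o, g n (T n ω, o) ∂ρ|)
      fun n => (n : ℝ) ^ (-(1 / 2) : ℝ)) :
    TendstoInMeasure Q (fun (n : ℕ) ω => (√n)⁻¹ * ∑ i ∈ I n, g n (T n ω, O i ω)) atTop
      fun _ => 0 := by
  simp only [tendstoInMeasure_iff_norm, sub_zero, Real.norm_eq_abs]
  refine fun θ hθ => ENNReal.tendsto_nhds_zero.2 fun τ hτ => ?_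
  obtain ⟨δ, hδ, hδτ⟩ := ENNReal.lt_iff_exists_nnreal_btwn.1 (ENNReal.half_pos hτ.ne')
  have hδ0 : (0 : ℝ) < δ := by exact_mod_cast hδ
  have hτ4 : 0 < τ / 2 / 2 := ENNReal.half_pos (ENNReal.half_pos hτ.ne').ne'
  have hκ : 0 < θ / 2 * √δ := by positivity
  have hκθ : 4 * (θ / 2 * √δ) ^ 2 / θ ^ 2 = δ := by
    rw [mul_pow, Real.sq_sqrt hδ0.le]
    field_simp
    norm_num
  filter_upwards [ENNReal.tendsto_nhds_zero.1 (hnorm _ hκ) _ hτ4,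
    ENNReal.tendsto_nhds_zero.1 (hmean _ (half_pos hθ)) _ hτ4, eventually_gt_atTop 0]
    with n hnorm_n hmean_n hn
  rw [mul_one] at hnorm_n
  calc Q {ω | θ ≤ |(√n)⁻¹ * ∑ i ∈ I n, g n (T n ω, O i ω)|}
      ≤ τ / 2 / 2 + τ / 2 / 2 + τ / 2 := by
        refine (measure_le_abs_inv_sqrt_mul_sum_le hO hindep (hT n) (hTI n) (hg n) hn (hcard n)
          hκ.le hθ).trans (add_le_add (add_le_add hnorm_n hmean_n) ?_)
        rw [hκθ, ENNReal.ofReal_coe_nnreal]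
        exact hδτ.le
    _ = τ := by rw [ENNReal.add_halves, ENNReal.add_halves]

end SampleSplitting

section Convergence

variable {α Ω : Type*} [MeasurableSpace Ω] {Q : Measure Ω} {l : Filter α}

lemma tendstoInMeasure_comp_of_continuousAt {E F : Type*} [PseudoMetricSpace E]
    [PseudoMetricSpace F] {f : α → Ω → E} {r : E} {g : E → F}
    (hf : TendstoInMeasure Q f l fun _ => r) (hg : ContinuousAt g r) :
    TendstoInMeasure Q (fun n ω => g (f n ω)) l fun _ => g r := by
  rw [tendstoInMeasure_iff_dist] at hf ⊢
  intro ε hε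
  obtain ⟨δ, hδ, hdist⟩ := Metric.continuousAt_iff.1 hg ε hε
  exact tendsto_of_tendsto_of_tendsto_of_le_of_le tendsto_const_nhds (hf δ hδ)
    (fun _ => zero_le) fun n => measure_mono fun ω hω => not_lt.1 fun hlt => (hdist hlt).not_ge hω

variable {E : Type*} [SeminormedAddCommGroup E]

lemma tendstoInMeasure_add {f g : α → Ω → E} {u v : Ω → E} (hf : TendstoInMeasure Q f l u)
    (hg : TendstoInMeasure Q g l v) :
    TendstoInMeasure Q (fun n ω => f n ω + g n ω) l fun ω => u ω + v ω := by
  rw [tendstoInMeasure_iff_norm] at hf hg ⊢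
  intro ε hε
  have hsum := (hf (ε / 2) (half_pos hε)).add (hg (ε / 2) (half_pos hε))
  rw [add_zero] at hsum
  refine tendsto_of_tendsto_of_tendsto_of_le_of_le tendsto_const_nhds hsum
    (fun _ => zero_le) fun n => (measure_mono fun ω hω => ?_).trans (measure_union_le _ _)
  by_contra hsmall
  simp only [Set.mem_union, Set.mem_ofPred_eq, not_or, not_le] at hω hsmall
  have htri := norm_add_le (f n ω - u ω) (g n ω - v ω)
  rw [← add_sub_add_comm] at htri
  linarith [hsmall.1, hsmall.2]

lemma tendstoInMeasure_finsetSum {β : Type*} {f : β → α → Ω → E} {u : β → Ω → E} (s : Finset β)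
    (hf : ∀ k ∈ s, TendstoInMeasure Q (f k) l (u k)) :
    TendstoInMeasure Q (fun n ω => ∑ k ∈ s, f k n ω) l fun ω => ∑ k ∈ s, u k ω := by
  induction s using Finset.cons_induction with
  | empty =>
    simp only [Finset.sum_empty, tendstoInMeasure_iff_norm, sub_self, norm_zero]
    exact fun ε hε => by simp [hε.not_ge, tendsto_const_nhds]
  | cons k s hk ih =>
    simp only [Finset.sum_cons, Finset.forall_mem_cons] at hf ⊢
    exact tendstoInMeasure_add hf.1 (ih hf.2)

lemma tendstoInMeasure_zero_of_sqrt_mul {f : ℕ → Ω → ℝ}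
    (hf : TendstoInMeasure Q (fun (n : ℕ) ω => √n * f n ω) atTop fun _ => 0) :
    TendstoInMeasure Q f atTop fun _ => 0 := by
  rw [tendstoInMeasure_iff_norm] at hf ⊢
  refine fun κ hκ => tendsto_of_tendsto_of_tendsto_of_le_of_le' tendsto_const_nhds (hf κ hκ)
    (Eventually.of_forall fun _ => zero_le) ?_
  filter_upwards [eventually_ge_atTop 1] with n hn
  refine measure_mono fun ω hω => ?_
  rw [Set.mem_ofPred_eq, sub_zero] at hω ⊢
  have hsqrt : 1 ≤ ‖√(n : ℝ)‖ := by
    rw [Real.norm_of_nonneg (Real.sqrt_nonneg _), Real.one_le_sqrt]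
    exact_mod_cast hn
  exact hω.trans ((le_mul_of_one_le_left (norm_nonneg _) hsqrt).trans (norm_mul _ _).ge)

end Convergence

section ConvergenceInDistribution

variable {Ω Ω' : Type*} [MeasurableSpace Ω] [MeasurableSpace Ω'] {Q : Measure Ω}
  [IsProbabilityMeasure Q] {N : Measure Ω'} [IsProbabilityMeasure N]

lemma exists_measure_le_norm_lt {E : Type*} [NormedAddCommGroup E] [CompleteSpace E]
    [SecondCountableTopology E] [MeasurableSpace E] [BorelSpace E] (μ : Measure E)
    [IsFiniteMeasure μ] {δ : ℝ≥0∞} (hδ : 0 < δ) : ∃ R : ℝ, μ {x | R ≤ ‖x‖} < δ := by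
  have htail := tendsto_measure_norm_gt_of_isTightMeasureSet
    (isTightMeasureSet_singleton (μ := μ))
  simp only [Set.mem_singleton_iff, iSup_iSup_eq_left] at htail
  obtain ⟨R, hR⟩ := (htail.eventually (gt_mem_nhds hδ)).exists
  exact ⟨R + 1, (measure_mono fun x hx => (lt_add_one R).trans_le hx).trans_lt hR⟩

lemma exists_eventually_measure_le_norm_lt {α E : Type*} [NormedAddCommGroup E] [CompleteSpace E]
    [SecondCountableTopology E] [MeasurableSpace E] [BorelSpace E] {l : Filter α}
    {f : α → Ω → E} {W : Ω' → E} (hf : TendstoInDistribution f l W (fun _ => Q) N)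
    {δ : ℝ≥0∞} (hδ : 0 < δ) : ∃ R : ℝ, ∀ᶠ n in l, Q {ω | R ≤ ‖f n ω‖} < δ := by
  have : IsProbabilityMeasure (N.map W) :=
    Measure.isProbabilityMeasure_map hf.aemeasurable_limit
  obtain ⟨R, hR⟩ := exists_measure_le_norm_lt (N.map W) hδ
  have hclosed : IsClosed {x : E | R ≤ ‖x‖} := isClosed_le continuous_const continuous_norm
  have hlim := ProbabilityMeasure.limsup_measure_closed_le_of_tendsto hf.tendsto hclosed
  simp only [ProbabilityMeasure.coe_mk] at hlim
  refine ⟨R, (eventually_lt_of_limsup_lt (hlim.trans_lt hR)).mono fun n hn => ?_⟩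
  rwa [Measure.map_apply_of_aemeasurable (hf.forall_aemeasurable n) hclosed.measurableSet] at hn

lemma isBigOP_of_tendstoInDistribution {f : ℕ → Ω → ℝ} {W : Ω' → ℝ}
    (hf : TendstoInDistribution (fun (n : ℕ) ω => √n * f n ω) atTop W (fun _ => Q) N) :
    IsBigOP Q (fun n ω => ENNReal.ofReal |f n ω|) fun n => (n : ℝ) ^ (-(1 / 2) : ℝ) := by
  intro δ hδ
  obtain ⟨R, hR⟩ := exists_eventually_measure_le_norm_lt hf (ENNReal.ofReal_pos.2 hδ)
  refine ⟨R, ?_⟩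
  filter_upwards [hR, eventually_gt_atTop 0] with n hn hn0
  refine (measure_mono fun ω hω => ?_).trans hn.le
  have hlt := (ENNReal.ofReal_lt_ofReal_iff'.1 hω).1
  rw [Set.mem_ofPred_eq, norm_mul, Real.norm_of_nonneg (Real.sqrt_nonneg _), Real.norm_eq_abs]
  calc R = √n * (R * (n : ℝ) ^ (-(1 / 2) : ℝ)) := by
        rw [mul_left_comm, sqrt_mul_rpow_neg_half (Nat.cast_pos.2 hn0), mul_one]
    _ ≤ √n * |f n ω| := by gcongr

lemma tendstoInDistribution_mul_div_sub {A D : ℕ → Ω → ℝ} {s : ℕ → ℝ} {p Δ : ℝ} {W : Ω' → ℝ}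
    (hAD : TendstoInDistribution (fun n ω => s n * (p⁻¹ * A n ω + -Δ * p⁻¹ * D n ω)) atTop W
      (fun _ => Q) N)
    (hD : TendstoInMeasure Q D atTop fun _ => p) (hp : p ≠ 0) (hA_meas : ∀ n, Measurable (A n))
    (hD_meas : ∀ n, Measurable (D n)) :
    TendstoInDistribution (fun n ω => s n * (A n ω / D n ω - Δ)) atTop W (fun _ => Q) N := by
  have hratio := tendstoInMeasure_comp_of_continuousAt (g := fun x => p / x) hD
    (continuousAt_const.div continuousAt_id hp)
  have hslutsky := hAD.continuous_comp_prodMk_of_tendstoInMeasure_const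
    (g := fun x : ℝ × ℝ => x.1 * x.2) (by fun_prop) hratio
    fun n => ((hD_meas n).const_div p).aemeasurable
  simp only [div_self hp, mul_one] at hslutsky
  refine tendstoInDistribution_of_tendstoInMeasure_sub _ W hslutsky ?_ fun n =>
    ((((hA_meas n).div (hD_meas n)).sub_const Δ).const_mul _).aemeasurable
  rw [tendstoInMeasure_iff_norm] at hD ⊢
  -- The two sequences agree wherever the denominator does not vanish.
  refine fun κ hκ => tendsto_of_tendsto_of_tendsto_of_le_of_le tendsto_const_nhds
    (hD |p| (abs_pos.2 hp)) (fun _ => zero_le) fun n => measure_mono fun ω hω => ?_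
  have hDω : D n ω = 0 := by
    by_contra hne
    refine hω.not_gt (lt_of_eq_of_lt (norm_eq_zero.2 ?_) hκ)
    simp only [Pi.sub_apply, Pi.zero_apply, sub_zero]
    field_simp
    ring
  rw [Set.mem_ofPred_eq, hDω, zero_sub, norm_neg, Real.norm_eq_abs]

end ConvergenceInDistribution

section IidSample

variable {Ω 𝒪 : Type*} [MeasurableSpace Ω] [MeasurableSpace 𝒪] {Q : Measure Ω} {ρ : Measure 𝒪}
  {O : ℕ → Ω → 𝒪} {f : 𝒪 → ℝ}

lemma identDistrib_comp (hO : ∀ i, MeasurePreserving (O i) Q ρ) (hf : Measurable f) (i j : ℕ) :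
    IdentDistrib (fun ω => f (O i ω)) (fun ω => f (O j ω)) Q Q :=
  IdentDistrib.comp (u := f) ⟨(hO i).aemeasurable, (hO j).aemeasurable,
    (hO i).map_eq.trans (hO j).map_eq.symm⟩ hf

variable [IsProbabilityMeasure Q]

lemma tendstoInMeasure_sum_div (hO : ∀ i, MeasurePreserving (O i) Q ρ) (hindep : iIndepFun O Q)
    (hf : Measurable f) (hint : Integrable f ρ) :
    TendstoInMeasure Q (fun (n : ℕ) ω => (∑ i ∈ Finset.range n, f (O i ω)) / n) atTop
      fun _ => ∫ o, f o ∂ρ := by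
  have hmean : ∫ ω, f (O 0 ω) ∂Q = ∫ o, f o ∂ρ := by
    rw [← (hO 0).map_eq, integral_map (hO 0).aemeasurable hf.aestronglyMeasurable]
  rw [← hmean]
  exact tendstoInMeasure_of_tendsto_ae
    (fun n => ((Finset.measurable_fun_sum _ fun i _ =>
      hf.comp (hO i).measurable).div_const _).aestronglyMeasurable)
    (strong_law_ae_real (fun i ω => f (O i ω)) ((hO 0).integrable_comp_of_integrable hint)
      (fun i j hij => (hindep.indepFun hij).comp hf hf) fun i => identDistrib_comp hO hf i 0)

lemma tendstoInDistribution_inv_sqrt_mul_sum_comp (hO : ∀ i, MeasurePreserving (O i) Q ρ)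
    (hindep : iIndepFun O Q) (hf : Measurable f) (hf2 : MemLp f 2 ρ) (hmean : ∫ o, f o ∂ρ = 0) :
    TendstoInDistribution (fun (n : ℕ) ω => (√n)⁻¹ * ∑ i ∈ Finset.range n, f (O i ω)) atTop id
      (fun _ => Q) (gaussianReal 0 (Var[f; ρ]).toNNReal) := by
  have hmean' : ∫ ω, f (O 0 ω) ∂Q = 0 := by
    rw [← hmean, ← (hO 0).map_eq, integral_map (hO 0).aemeasurable hf.aestronglyMeasurable]
  have hvar : Var[fun ω => f (O 0 ω); Q] = Var[f; ρ] := by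
    rw [← (hO 0).map_eq, variance_map hf.aemeasurable (hO 0).aemeasurable, Function.comp_def]
  have hclt := tendstoInDistribution_inv_sqrt_mul_sum_sub (P := Q)
    (P' := gaussianReal 0 (Var[f; ρ]).toNNReal) (Y := id) (X := fun i ω => f (O i ω))
    ⟨aemeasurable_id, by rw [hvar, Measure.map_id]⟩ (hf2.comp_measurePreserving (hO 0))
    (hindep.comp _ fun _ => hf) fun i => identDistrib_comp hO hf i 0
  simpa only [hmean', mul_zero, sub_zero] using hclt

end IidSample

section CrossFitting

variable {𝒳 : Type*} [MeasurableSpace 𝒳]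

lemma measurable_score {𝒯 : Type*} [MeasurableSpace 𝒯] (c : Bool) (a b : ℝ) {ξ : 𝒯 → Nuisance 𝒳}
    (he : Measurable fun p : 𝒯 × 𝒳 => (ξ p.1).e p.2)
    (hpi : Measurable fun p : 𝒯 × 𝒳 => (ξ p.1).pi p.2)
    (hmu1 : Measurable fun p : 𝒯 × 𝒳 => (ξ p.1).mu1 p.2)
    (hmu0 : Measurable fun p : 𝒯 × 𝒳 => (ξ p.1).mu0 p.2) :
    Measurable fun p : 𝒯 × Obs 𝒳 => score c a b (ξ p.1) p.2 := by
  have hcov : Measurable fun p : 𝒯 × Obs 𝒳 => (p.1, p.2.1) := by fun_prop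
  have he_obs : Measurable fun p : 𝒯 × Obs 𝒳 => (ξ p.1).e p.2.1 := he.comp hcov
  have hpi_obs : Measurable fun p : 𝒯 × Obs 𝒳 => (ξ p.1).pi p.2.1 := hpi.comp hcov
  have hmu1_obs : Measurable fun p : 𝒯 × Obs 𝒳 => (ξ p.1).mu1 p.2.1 := hmu1.comp hcov
  have hmu0_obs : Measurable fun p : 𝒯 × Obs 𝒳 => (ξ p.1).mu0 p.2.1 := hmu0.comp hcov
  have htreatment : Measurable fun p : 𝒯 × Obs 𝒳 => ind p.2.2.1 :=
    (measurable_of_countable ind).comp (by fun_prop)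
  have hstratum : Measurable fun p : 𝒯 × Obs 𝒳 => ind (p.2.2.2.1 == c) :=
    measurable_ind_beq (by fun_prop) c
  simp only [score, phiNu1, phiNu0, phiPi]
  fun_prop

lemma Nuisance.IsMeasurable.measurable_score {ξ : Nuisance 𝒳} (hξ : ξ.IsMeasurable)
    (c : Bool) (a b : ℝ) : Measurable (score c a b ξ) := by
  have hconst : Measurable fun p : Unit × Obs 𝒳 => score c a b ξ p.2 :=
    PrincipalStrat.measurable_score (ξ := fun _ => ξ) c a b
      (hξ.measurable_e.comp measurable_snd) (hξ.measurable_pi.comp measurable_snd)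
      (hξ.measurable_mu1.comp measurable_snd) (hξ.measurable_mu0.comp measurable_snd)
  simpa only [Function.comp_def] using hconst.comp (measurable_prodMk_left (x := ()))

namespace CrossFit

variable {K : ℕ} (S : CrossFit 𝒳 K)

lemma deltaIF_eq (c : Bool) (n : ℕ) (o : ℕ → Obs 𝒳) :
    S.deltaIF c n o = S.average (score c 1 0) n o / S.average (score c 0 1) n o := by
  simp only [deltaIF, average, score, one_mul, zero_mul, add_zero, zero_add,
    Finset.sum_sub_distrib, sub_div]

lemma average_score (c : Bool) (a b : ℝ) (n : ℕ) (o : ℕ → Obs 𝒳) :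
    S.average (score c a b) n o
      = a * S.average (score c 1 0) n o + b * S.average (score c 0 1) n o := by
  simp only [average, score, one_mul, zero_mul, add_zero, zero_add, mul_div_assoc',
    Finset.mul_sum, Finset.sum_add_distrib, add_div]

lemma sqrt_mul_average_sub (φ : Nuisance 𝒳 → Obs 𝒳 → ℝ) (ψ : Obs 𝒳 → ℝ) (n : ℕ)
    (o : ℕ → Obs 𝒳) :
    √n * (S.average φ n o - (∑ i ∈ Finset.range n, ψ (o i)) / n)
      = ∑ k, (√n)⁻¹ * ∑ i ∈ Finset.range n with S.fold n i = k,
        (φ (S.estimate n k o) (o i) - ψ (o i)) := by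
  have hfolds : ∑ k, ∑ i ∈ Finset.range n with S.fold n i = k,
      (φ (S.estimate n k o) (o i) - ψ (o i))
      = ∑ i ∈ Finset.range n, (φ (S.estimate n (S.fold n i) o) (o i) - ψ (o i)) := by
    rw [← Finset.sum_fiberwise (Finset.range n) (S.fold n)]
    refine Finset.sum_congr rfl fun k _ => Finset.sum_congr rfl fun i hi => ?_
    rw [(Finset.mem_filter.1 hi).2]
  rw [← Finset.mul_sum, hfolds, average, ← sub_div, ← Finset.sum_sub_distrib, mul_div_assoc',
    mul_div_right_comm, Real.sqrt_div_self', one_div]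

lemma isMeasurable_estimate (n : ℕ) (k : Fin K) (o : ℕ → Obs 𝒳) :
    (S.estimate n k o).IsMeasurable where
  measurable_e := (S.measurable_e n k).comp measurable_prodMk_left
  measurable_pi := (S.measurable_pi n k).comp measurable_prodMk_left
  measurable_mu1 := (S.measurable_mu1 n k).comp measurable_prodMk_left
  measurable_mu0 := (S.measurable_mu0 n k).comp measurable_prodMk_left

lemma measurable_score_learner (c : Bool) (a b : ℝ) (n : ℕ) (k : Fin K) :
    Measurable fun p : (S.train n k → Obs 𝒳) × Obs 𝒳 => score c a b (S.learner n k p.1) p.2 :=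
  measurable_score c a b (S.measurable_e n k) (S.measurable_pi n k) (S.measurable_mu1 n k)
    (S.measurable_mu0 n k)

variable {Ω : Type*} [MeasurableSpace Ω] {Q : Measure Ω} {O : ℕ → Ω → Obs 𝒳} {c : Bool}
  {ρ : Measure (Obs 𝒳)} {η : Nuisance 𝒳} {ε B : ℝ}

lemma measurable_average_score (hO : ∀ i, Measurable (O i)) (c : Bool) (a b : ℝ) (n : ℕ) :
    Measurable fun ω => S.average (score c a b) n fun i => O i ω := by
  have hscore : ∀ i, Measurable fun ω =>
      score c a b (S.estimate n (S.fold n i) fun i => O i ω) (O i ω) := fun i =>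
    (S.measurable_score_learner c a b n (S.fold n i)).comp (f := fun ω => (_, O i ω))
      ((measurable_pi_lambda _ fun j => hO _).prodMk (hO i))
  exact (Finset.measurable_fun_sum _ fun i _ => hscore i).div_const _

variable [IsProbabilityMeasure Q] [IsProbabilityMeasure ρ]

lemma tendstoInMeasure_fold_sum (hO : ∀ i, MeasurePreserving (O i) Q ρ) (hindep : iIndepFun O Q)
    (hη : Identified ρ c η ε) (hB : ∀ᵐ x ∂ρ.map Prod.fst, |η.mu1 x - η.mu0 x| ≤ B) {k : Fin K}
    (hS : ConsistentEstimates Q (ρ.map Prod.fst) η fun n ω => S.estimate n k fun i => O i ω)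
    (a b : ℝ) :
    TendstoInMeasure Q (fun (n : ℕ) ω => (√n)⁻¹ * ∑ i ∈ Finset.range n with S.fold n i = k,
      (score c a b (S.estimate n k fun i => O i ω) (O i ω) - score c a b η (O i ω))) atTop
      fun _ => 0 := by
  refine tendstoInMeasure_inv_sqrt_mul_sum hO hindep (T := fun n ω (j : S.train n k) => O j ω)
    (I := fun n => {i ∈ Finset.range n | S.fold n i = k})
    (g := fun n p => score c a b (S.learner n k p.1) p.2 - score c a b η p.2)
    (fun n => measurable_pi_lambda _ fun j => (hO j).measurable) (fun n => ?_) (fun n => ?_)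
    (fun n => (S.measurable_score_learner c a b n k).sub
      ((hη.admissible.measurable_score c a b).comp measurable_snd))
    (hS.isLittleOP_eLpNorm_score_sub hη.admissible hη.memLp_outcome a b)
    (hS.isLittleOP_abs_integral_score_sub hη hB a b)
  · refine hindep.indepFun_finset _ _ (Finset.disjoint_right.2 fun i hi => ?_)
      fun i => (hO i).measurable
    obtain ⟨hin, hik⟩ := Finset.mem_filter.1 hi
    exact S.disjoint n k i (Finset.mem_range.1 hin) hik
  · exact (Finset.card_filter_le _ _).trans (Finset.card_range n).le

variable (hO : ∀ i, MeasurePreserving (O i) Q ρ) (hindep : iIndepFun O Q)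
  (hη : Identified ρ c η ε) (hB : ∀ᵐ x ∂ρ.map Prod.fst, |η.mu1 x - η.mu0 x| ≤ B)
  (hS : ∀ k, ConsistentEstimates Q (ρ.map Prod.fst) η fun n ω => S.estimate n k fun i => O i ω)
include hO hindep hη hB hS

theorem tendstoInMeasure_sqrt_mul_average_sub (a b : ℝ) :
    TendstoInMeasure Q (fun (n : ℕ) ω => √n * (S.average (score c a b) n (fun i => O i ω)
      - (∑ i ∈ Finset.range n, score c a b η (O i ω)) / n)) atTop fun _ => 0 := by
  simp only [S.sqrt_mul_average_sub (score c a b)]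
  simpa only [Finset.sum_const_zero] using tendstoInMeasure_finsetSum Finset.univ fun k _ =>
    S.tendstoInMeasure_fold_sum hO hindep hη hB (hS k) a b

lemma tendstoInMeasure_average (a b : ℝ) :
    TendstoInMeasure Q (fun n ω => S.average (score c a b) n fun i => O i ω) atTop
      fun _ => ∫ o, score c a b η o ∂ρ := by
  have hdiff := tendstoInMeasure_zero_of_sqrt_mul
    (S.tendstoInMeasure_sqrt_mul_average_sub hO hindep hη hB hS a b)
  have hlln := tendstoInMeasure_sum_div hO hindep (hη.admissible.measurable_score c a b)
    (hη.integrable_score a b)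
  simpa only [sub_add_cancel, zero_add] using tendstoInMeasure_add hdiff hlln

lemma tendstoInDistribution_sqrt_mul_average {a b : ℝ}
    (hmean : ∫ o, score c a b η o ∂ρ = 0) :
    TendstoInDistribution
      (fun (n : ℕ) ω => √n * S.average (score c a b) n fun i => O i ω) atTop id (fun _ => Q)
      (gaussianReal 0 (Var[score c a b η; ρ]).toNNReal) := by
  have hclt := tendstoInDistribution_inv_sqrt_mul_sum_comp hO hindep
    (hη.admissible.measurable_score c a b)
    (hη.admissible.memLp_score c a b hη.memLp_outcome) hmean
  refine tendstoInDistribution_of_tendstoInMeasure_sub _ id hclt ?_ fun n =>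
    ((S.measurable_average_score (fun i => (hO i).measurable) c a b n).const_mul _).aemeasurable
  refine (S.tendstoInMeasure_sqrt_mul_average_sub hO hindep hη hB hS a b).congr_left fun n =>
    Eventually.of_forall fun ω => ?_
  simp only [Pi.sub_apply]
  rw [mul_sub, mul_div_assoc', mul_div_right_comm, Real.sqrt_div_self', one_div]

theorem tendstoInDistribution_deltaIF (hpi : ∫ o, η.pi o.1 ∂ρ ≠ 0) :
    TendstoInDistribution (fun (n : ℕ) ω => √n * (S.deltaIF c n (fun i => O i ω) - deltaPI c ρ))
      atTop id (fun _ => Q)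
      (gaussianReal 0
        (Var[phiDelta c η (∫ o, η.pi o.1 ∂ρ) (deltaPI c ρ); ρ]).toNNReal) := by
  obtain ⟨-, hmean, -⟩ := hη.isInfluenceFunction hpi
  simp only [phiDelta_eq_score] at hmean ⊢
  have hclt := S.tendstoInDistribution_sqrt_mul_average hO hindep hη hB hS hmean
  have hden := S.tendstoInMeasure_average hO hindep hη hB hS 0 1
  simp only [hη.integral_score, zero_mul, one_mul, zero_add] at hden
  simp only [S.average_score c (∫ o, η.pi o.1 ∂ρ)⁻¹] at hclt
  simp only [S.deltaIF_eq]
  have hmeas := S.measurable_average_score fun i => (hO i).measurable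
  exact tendstoInDistribution_mul_div_sub hclt hden hpi (hmeas c 1 0) (hmeas c 0 1)

end CrossFit

end CrossFitting

section ObservedLaw

namespace IsIgnorableStudy

variable {Ω 𝒳 : Type*} [MeasurableSpace Ω] [StandardBorelSpace Ω] [MeasurableSpace 𝒳]
  {P : Measure Ω} {X : Ω → 𝒳} {Z C : Ω → Bool} {Y1 Y0 : Ω → ℝ} {c : Bool} {η : Nuisance 𝒳}
  {ε B : ℝ} [IsFiniteMeasure P]

lemma integral_map_observe (h : IsIgnorableStudy P X Z C Y1 Y0) {f : 𝒳 → ℝ}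
    (hf : Measurable f) : ∫ o, f o.1 ∂P.map (observe X Z C Y1 Y0) = ∫ ω, f (X ω) ∂P :=
  integral_map h.measurable_observe.aemeasurable (hf.comp measurable_fst).aestronglyMeasurable

lemma integral_pi_map_observe_ne_zero (h : IsIgnorableStudy P X Z C Y1 Y0)
    (hη : IsTrueNuisance P c X Z C Y1 Y0 η) (hc : P {ω | C ω = c} ≠ 0) :
    ∫ o, η.pi o.1 ∂P.map (observe X Z C Y1 Y0) ≠ 0 := by
  rw [h.integral_map_observe hη.pi_eq.measurable, hη.integral_pi h.measurable_X h.measurable_C]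
  exact ENNReal.toReal_ne_zero.2 ⟨hc, measure_ne_top _ _⟩

lemma ae_map_observe_abs_contrast_le (h : IsIgnorableStudy P X Z C Y1 Y0)
    (hη : IsTrueNuisance P c X Z C Y1 Y0 η)
    (hbdd : ∀ᵐ ω ∂P, |η.mu1 (X ω) - η.mu0 (X ω)| ≤ B) :
    ∀ᵐ x ∂(P.map (observe X Z C Y1 Y0)).map Prod.fst, |η.mu1 x - η.mu0 x| ≤ B := by
  have hmeas := measurableSet_le (hη.mu1_eq.measurable.sub hη.mu0_eq.measurable).abs
    (measurable_const (a := B))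
  rw [h.map_fst_map_observe]
  exact (ae_map_iff h.measurable_X.aemeasurable hmeas).2 hbdd

theorem deltaPI_map_observe_eq_delta (h : IsIgnorableStudy P X Z C Y1 Y0)
    (hη : IsTrueNuisance P c X Z C Y1 Y0 η) (hpos : IsPositive P X η.e ε)
    (hbdd : ∀ᵐ ω ∂P, |η.mu1 (X ω) - η.mu0 (X ω)| ≤ B) (hPI : PrincipalIgnorability P X C Y0) :
    deltaPI c (P.map (observe X Z C Y1 Y0)) = delta P c C Y1 Y0 := by
  have hI := h.identified hη hpos hbdd
  have hmeas : Measurable fun x => η.pi x * (η.mu1 x - η.mu0 x) :=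
    hη.pi_eq.measurable.mul (hη.mu1_eq.measurable.sub hη.mu0_eq.measurable)
  rw [h.delta_eq_of_principalIgnorability hη hpos hPI, hI.deltaPI_eq, hI.integral_score,
    hI.integral_score, ← h.integral_map_observe hη.pi_eq.measurable, ← h.integral_map_observe hmeas]
  simp only [zero_mul, one_mul, add_zero, zero_add, sub_zero, mul_sub]

end IsIgnorableStudy

end ObservedLaw

end PrincipalStrat

theorem mainTheorem9
    -- the population: full data of a generic individual
    {Ω 𝒳 : Type*} [MeasurableSpace Ω] [StandardBorelSpace Ω] [MeasurableSpace 𝒳]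
    (P : Measure Ω) [IsProbabilityMeasure P]
    (X : Ω → 𝒳) (Z C : Ω → Bool) (Y1 Y0 : Ω → ℝ)
    (hX : Measurable X) (hZ : Measurable Z) (hC : Measurable C)
    (hY1 : Measurable Y1) (hY0 : Measurable Y0)
    (hY1_sq : MemLp Y1 2 P) (hY0_sq : MemLp Y0 2 P)
    (c : Bool) (hc : P {ω | C ω = c} ≠ 0)
    -- treatment assignment ignorability
    (hign : CondIndepFun (MeasurableSpace.comap X inferInstance) hX.comap_le
      Z (fun ω => (C ω, Y1 ω, Y0 ω)) P)
    -- true nuisance functions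
    (η : PrincipalStrat.Nuisance 𝒳)
    (hη : PrincipalStrat.IsTrueNuisance P c X Z C Y1 Y0 η)
    -- positivity
    (hpos : ∃ ε : ℝ, 0 < ε ∧ ∀ᵐ ω ∂P, ε ≤ η.e (X ω) ∧ η.e (X ω) < 1 - ε)
    -- bounded contrast of the conditional outcome means
    (hbdd : ∃ B : ℝ, ∀ᵐ ω ∂P, |η.mu1 (X ω) - η.mu0 (X ω)| ≤ B)
    -- the sample: i.i.d. copies of the observed data
    {Ω' : Type*} [MeasurableSpace Ω'] (Q : Measure Ω') [IsProbabilityMeasure Q]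
    (O : ℕ → Ω' → PrincipalStrat.Obs 𝒳)
    (hO : ∀ i, Measurable (O i)) (hindep : iIndepFun O Q)
    (hlaw : ∀ i, Q.map (O i) = P.map (PrincipalStrat.observe X Z C Y1 Y0))
    -- cross-fitted nuisance estimators
    {K : ℕ} (S : PrincipalStrat.CrossFit 𝒳 K) (est : ℕ → Fin K → Ω' → PrincipalStrat.Nuisance 𝒳)
    (hest : ∀ n k ω, est n k ω = S.estimate n k (fun i => O i ω))
    (hpi_range : ∀ n k ω x, 0 ≤ (est n k ω).pi x ∧ (est n k ω).pi x ≤ 1)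
    -- mean squared error consistency
    (he : ∀ k, PrincipalStrat.IsLittleOP Q
      (fun n ω => PrincipalStrat.l2err (P.map X) (est n k ω).e η.e) (fun _ => 1))
    (hpi : ∀ k, PrincipalStrat.IsLittleOP Q
      (fun n ω => PrincipalStrat.l2err (P.map X) (est n k ω).pi η.pi) (fun _ => 1))
    (hmu1 : ∀ k, PrincipalStrat.IsLittleOP Q
      (fun n ω => PrincipalStrat.l2err (P.map X) (est n k ω).mu1 η.mu1) (fun _ => 1))
    (hmu0 : ∀ k, PrincipalStrat.IsLittleOP Q
      (fun n ω => PrincipalStrat.l2err (P.map X) (est n k ω).mu0 η.mu0) (fun _ => 1))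
    -- bounded inverse propensity estimates, for both arms
    (hinv1 : ∀ k, PrincipalStrat.IsBigOP Q
      (fun n ω => PrincipalStrat.invSup (P.map X) (est n k ω).e) (fun _ => 1))
    (hinv0 : ∀ k, PrincipalStrat.IsBigOP Q
      (fun n ω => PrincipalStrat.invSup (P.map X) (fun x => 1 - (est n k ω).e x)) (fun _ => 1))
    -- error rate conditions
    (hrate_e_pi : ∀ k, PrincipalStrat.IsLittleOP Q
      (fun n ω => PrincipalStrat.l2err (P.map X) (est n k ω).e η.e
        * PrincipalStrat.l2err (P.map X) (est n k ω).pi η.pi)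
      (fun n => (n : ℝ) ^ (-(1 / 2) : ℝ)))
    (hrate_e_mu1 : ∀ k, PrincipalStrat.IsLittleOP Q
      (fun n ω => PrincipalStrat.l2err (P.map X) (est n k ω).e η.e
        * PrincipalStrat.l2err (P.map X) (est n k ω).mu1 η.mu1)
      (fun n => (n : ℝ) ^ (-(1 / 2) : ℝ)))
    (hrate_e_mu0 : ∀ k, PrincipalStrat.IsLittleOP Q
      (fun n ω => PrincipalStrat.l2err (P.map X) (est n k ω).e η.e
        * PrincipalStrat.l2err (P.map X) (est n k ω).mu0 η.mu0)
      (fun n => (n : ℝ) ^ (-(1 / 2) : ℝ)))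
    (hrate_pi_mu0 : ∀ k, PrincipalStrat.IsLittleOP Q
      (fun n ω => PrincipalStrat.l2err (P.map X) (est n k ω).pi η.pi
        * PrincipalStrat.l2err (P.map X) (est n k ω).mu0 η.mu0)
      (fun n => (n : ℝ) ^ (-(1 / 2) : ℝ)))
    -- the law of the observed data, the identified effect and its influence function
    (PO : Measure (PrincipalStrat.Obs 𝒳))
    (hPO : PO = P.map (PrincipalStrat.observe X Z C Y1 Y0))
    (Δ : ℝ) (hΔ : Δ = PrincipalStrat.deltaPI c PO)
    (φ : PrincipalStrat.Obs 𝒳 → ℝ)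
    (hφ : φ = PrincipalStrat.phiDelta c η (∫ ω, η.pi (X ω) ∂P) Δ) :
    -- the estimated functional is the principal causal effect under principal ignorability
    (PrincipalStrat.PrincipalIgnorability P X C Y0 → Δ = PrincipalStrat.delta P c C Y1 Y0) ∧
    -- root-n consistency
    PrincipalStrat.IsBigOP Q
      (fun n ω => ENNReal.ofReal |S.deltaIF c n (fun i => O i ω) - Δ|)
      (fun n => (n : ℝ) ^ (-(1 / 2) : ℝ)) ∧
    -- asymptotic normality, the asymptotic variance being that of the influence function
    PrincipalStrat.IsInfluenceFunction (PrincipalStrat.deltaPI c) PO φ ∧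
    TendstoInDistribution
      (fun (n : ℕ) (ω : Ω') => Real.sqrt n * (S.deltaIF c n (fun i => O i ω) - Δ))
      atTop (id : ℝ → ℝ) (fun _ => Q) (gaussianReal 0 (Var[φ; PO]).toNNReal) := by
  obtain ⟨ε, hε, hpos⟩ := hpos
  obtain ⟨B, hbdd⟩ := hbdd
  obtain rfl : est = fun n k ω => S.estimate n k fun i => O i ω :=
    funext fun n => funext fun k => funext fun ω => hest n k ω
  have hstudy : PrincipalStrat.IsIgnorableStudy P X Z C Y1 Y0 :=
    ⟨hX, hZ, hC, hY1, hY0, hY1_sq, hY0_sq, hign⟩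
  have hpositive : PrincipalStrat.IsPositive P X η.e ε :=
    ⟨hε, hpos.mono fun _ hω => ⟨hω.1, hω.2.le⟩⟩
  have hestimates (k : Fin K) : PrincipalStrat.ConsistentEstimates Q (P.map X) η
      fun n ω => S.estimate n k fun i => O i ω :=
    ⟨fun n _ => S.isMeasurable_estimate n k _, fun n => hpi_range n k, he k, hpi k, hmu1 k,
      hmu0 k, hinv1 k, hinv0 k, hrate_e_pi k, hrate_e_mu1 k, hrate_e_mu0 k, hrate_pi_mu0 k⟩
  have hidentified := hstudy.identified hη hpositive hbdd
  have hpi_ne := hstudy.integral_pi_map_observe_ne_zero hη hc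
  have := Measure.isProbabilityMeasure_map hstudy.measurable_observe.aemeasurable (μ := P)
  simp only [← hstudy.map_fst_map_observe] at hestimates
  rw [← hstudy.integral_map_observe hη.pi_eq.measurable] at hφ
  subst hPO hΔ hφ
  have hnormal := S.tendstoInDistribution_deltaIF (fun i => .mk (hO i) (hlaw i)) hindep hidentified
    (hstudy.ae_map_observe_abs_contrast_le hη hbdd) hestimates hpi_ne
  exact ⟨hstudy.deltaPI_map_observe_eq_delta hη hpositive hbdd,
    PrincipalStrat.isBigOP_of_tendstoInDistribution hnormal,
    hidentified.isInfluenceFunction hpi_ne, hnormal⟩
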